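/- Let $n\ge 0$, and for each $\varepsilon\ge 0$ let $A^\varepsilon(x,\lambda)\in\mathbb C^{n\times n}$ ($x\in\mathbb R$, $\lambda\in\mathbb C$) be analytic in $\lambda$ and $C^1$ in $x$; for $\varepsilon>0$ let $A^\varepsilon(\cdot,\lambda)$ be periodic with period $X^\varepsilon>0$. Fix $M$ and assume that there are constants $C_0$ and $\nu,\bar\theta>0$ and matrices $A^0_\infty(\lambda)$ such that (H1) $X^\varepsilon\to\infty$ as $\varepsilon\to0^+$; (H2) $|A^0(x,\lambda)-A^0_\infty(\lambda)|\le C_0e^{-\nu|x|}$ for $|\lambda|\le M$, $x\in\mathbb R$; (H3) $|A^\varepsilon(x,\lambda)-A^0(x,\lambda)|\le C_0e^{-\bar\theta X^\varepsilon/2}$ for $\varepsilon>0$, $|\lambda|\le M$, $|x|\le X^\varepsilon/2$. For $\varepsilon>0$ let $\Psi^\varepsilon(x,\lambda)$ be the solution operator of $W'=A^\varepsilon(x,\lambda)W$ with $\Psi^\varepsilon(0,\lambda)=\mathrm{Id}$, and $E^\varepsilon(\lambda,\gamma)=\det(\Psi^\varepsilon(X^\varepsilon,\lambda)-\gamma\,\mathrm{Id})$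 the periodic Evans function. For $|\gamma|=1$ the $\gamma$-eigenvalues are the zeros of $E^\varepsilon(\cdot,\gamma)$, with their order as multiplicity, and the spectrum of $L^\varepsilon$ is the union of the $\gamma$-eigenvalues over $|\gamma|=1$. An eigenvalue of $L^0$ is a $\lambda$ for which $W'=A^0(x,\lambda)W$ has a nontrivial solution on $\mathbb R$ tending to $0$ as $x\to\pm\infty$. Let $\Lambda_r$ be a domain of hyperbolicity, i.e. a connected component of the set of $\lambda\in\mathbb C$ for which $A^0_\infty(\lambda)$ has no purely imaginary eigenvalue. On $\Lambda_r\cap\{|\lambda|\le M\}$ the homoclinic Evans function is $$D^0_r(\lambda)=\frac{\det\big(P^0_-(0)R^-_\infty,\;P^0_+(0)R^+_\infty\big)}{\det\big(R^-_\infty,\;R^+_\infty\big)},$$ where the columns of $R^-_\infty$ and $R^+_\infty$ are bases of the unstable and stable subspaces of $A^0_\infty(\lambda)$, and $P^0_\pm(x)$, defined for $x\gtrless0$, are invertible, satisfy $|P^0_\pm(x)-\mathrm{Id}|\le Ce^{-\kappa|x|}$ for some $C$ and some $\kappa>0$, and are such that $W=P^0_\pm Z$ transforms $W'=A^0W$ into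 $Z'=A^0_\infty Z$. (The quotient does not depend on these choices.) **Corollary.** Let $K\subset\Lambda_r\cap\{|\lambda|\le M\}$ be compact, with $D^0_r$ nonvanishing on $\partial K$, and let $0<\eta<\min(\nu,\bar\theta)$ be such that $\eta<|\operatorname{Re}\mu|$ for all $\lambda\in K$ and all eigenvalues $\mu$ of $A^0_\infty(\lambda)$. Then $L^0$ has only finitely many eigenvalues in $K$, and each such eigenvalue $\lambda_*$ is a zero of $D^0_r$ of finite order $m(\lambda_*)\ge1$, its multiplicity. Moreover there are $C>0$ and $X_0$ such that, for every $\varepsilon>0$ with $X^\varepsilon\ge X_0$, there exist for each eigenvalue $\lambda_*\in K$ of $L^0$ continuous functions $\lambda^\varepsilon_{*,k}:\mathbb R\to\mathbb C$, $k=1,\dots,m(\lambda_*)$, and a permutation $\sigma_*$ of $\{1,\dots,m(\lambda_*)\}$, with the following properties. 1. $\lambda^\varepsilon_{*,k}(t+2\pi)=\lambda^\varepsilon_{*,\sigma_*(k)}(t)$ for all $t\in\mathbb R$, so that the curves close up to loops, parametrized by $\gamma=e^{it}$. 2. $|\lambda^\varepsilon_{*,k}(t)-\lambda_*|\le Ce^{-\eta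 X^\varepsilon/(2m(\lambda_*))}$ for all $t\in\mathbb R$ and all $k$. 3. The spectrum of $L^\varepsilon$ in $K$ is the union of these loops over all eigenvalues $\lambda_*\in K$ of $L^0$ and all $k$. More precisely, for each $t\in\mathbb R$ the $\gamma$-eigenvalues in $K$ with $\gamma=e^{it}$, repeated according to multiplicity, are exactly the points $\lambda^\varepsilon_{*,k}(t)$. -/

import Mathlib

open scoped Matrix.Norms.Operator

/-- `Ψ` is the solution operator (fundamental matrix) of the linear system `W' = a(x) W`,
normalized by `Ψ(0) = Id`. -/
def IsSolutionOperator {n : ℕ} (a : ℝ → Matrix (Fin n) (Fin n) ℂ)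
    (Ψ : ℝ → Matrix (Fin n) (Fin n) ℂ) : Prop :=
  Ψ 0 = 1 ∧ ∀ x : ℝ, HasDerivAt Ψ (a x * Ψ x) x

/-- The solution operator of `W' = a(x) W`.  For continuous `a` it exists and is unique. -/
noncomputable def solutionOperator {n : ℕ} (a : ℝ → Matrix (Fin n) (Fin n) ℂ) :
    ℝ → Matrix (Fin n) (Fin n) ℂ :=
  Classical.epsilon (IsSolutionOperator a)

/-- The periodic Evans function `E(z, γ) = det (Ψ(X, z) - γ Id)` of the system
`W' = A(x, z) W` with period `X`. -/
noncomputable def periodicEvans {n : ℕ} (A : ℝ → ℂ → Matrix (Fin n) (Fin n) ℂ) (X : ℝ)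
    (z γ : ℂ) : ℂ :=
  (solutionOperator (fun x => A x z) X - γ • (1 : Matrix (Fin n) (Fin n) ℂ)).det

/-- The spectrum of the periodic problem: the union over `|γ| = 1` of the `γ`-eigenvalues, that is,
of the zeros of `E(·, γ)`. -/
def periodicSpectrum {n : ℕ} (A : ℝ → ℂ → Matrix (Fin n) (Fin n) ℂ) (X : ℝ) : Set ℂ :=
  {z | ∃ γ : ℂ, ‖γ‖ = 1 ∧ periodicEvans A X z γ = 0}

/-- The eigenvalues of the homoclinic problem: those `z` for which `W' = A⁰(x, z) W` has a
nontrivial solution on the line that decays at both ends. -/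
def homoclinicEigenvalues {n : ℕ} (A0 : ℝ → ℂ → Matrix (Fin n) (Fin n) ℂ) : Set ℂ :=
  {z | ∃ W : ℝ → (Fin n → ℂ), W ≠ 0 ∧
    (∀ x : ℝ, HasDerivAt W ((A0 x z).mulVec (W x)) x) ∧
    Filter.Tendsto W Filter.atBot (nhds 0) ∧ Filter.Tendsto W Filter.atTop (nhds 0)}

/-- The set of `z` for which no eigenvalue of `A⁰_∞(z)` is purely imaginary: the complement of the
dispersion curves `{z | i k ∈ σ(A⁰_∞(z)) for some real k}`. -/
def hyperbolicSet {n : ℕ} (Ainf : ℂ → Matrix (Fin n) (Fin n) ℂ) : Set ℂ :=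
  {z | ∀ k : ℝ, Complex.I * (k : ℂ) ∉ spectrum ℂ (Ainf z)}

/-- `Λ` is a domain of hyperbolicity: a connected component of the complement of the dispersion
curves. -/
def IsHyperbolicityDomain {n : ℕ} (Ainf : ℂ → Matrix (Fin n) (Fin n) ℂ) (Λ : Set ℂ) : Prop :=
  ∃ z₀ ∈ hyperbolicSet Ainf, Λ = connectedComponentIn (hyperbolicSet Ainf) z₀

/-- The stable subspace of a matrix: the sum of its generalized eigenspaces for eigenvalues of
negative real part. -/
noncomputable def stableSubspace {n : ℕ} (B : Matrix (Fin n) (Fin n) ℂ) :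
    Submodule ℂ (Fin n → ℂ) :=
  ⨆ μ : ℂ, ⨆ _ : μ.re < 0, Module.End.maxGenEigenspace (Matrix.toLin' B) μ

/-- The unstable subspace of a matrix: the sum of its generalized eigenspaces for eigenvalues of
positive real part. -/
noncomputable def unstableSubspace {n : ℕ} (B : Matrix (Fin n) (Fin n) ℂ) :
    Submodule ℂ (Fin n → ℂ) :=
  ⨆ μ : ℂ, ⨆ _ : 0 < μ.re, Module.End.maxGenEigenspace (Matrix.toLin' B) μ

/-- `P` is a conjugator on the half-line `s`: the change of coordinates `W = P Z` turns the
constant-coefficient system `Z' = B Z` into `W' = a(x) W` (that is, `P' = a P - P B`), it is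
invertible, and `P → Id` at an exponential rate. -/
def IsConjugator {n : ℕ} (a : ℝ → Matrix (Fin n) (Fin n) ℂ) (B : Matrix (Fin n) (Fin n) ℂ)
    (s : Set ℝ) (P : ℝ → Matrix (Fin n) (Fin n) ℂ) : Prop :=
  (∀ x ∈ s, HasDerivWithinAt P (a x * P x - P x * B) s x) ∧
  (∀ x ∈ s, IsUnit (P x)) ∧
  ∃ C κ : ℝ, 0 < κ ∧ ∀ x ∈ s, ‖P x - 1‖ ≤ C * Real.exp (-κ * |x|)

/-- `d` is a value of the quotient `det (P⁻(0) R⁻, P⁺(0) R⁺) / det (R⁻, R⁺)`, where the columns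
of `R⁻` and `R⁺` are bases of the unstable and of the stable subspace of `B`, and `P⁻`, `P⁺` are
conjugators on `x ≤ 0` and `x ≥ 0`.  The bijection `e` makes the matrices square; it cancels in the
quotient. -/
def IsEvansValue {n : ℕ} (a : ℝ → Matrix (Fin n) (Fin n) ℂ) (B : Matrix (Fin n) (Fin n) ℂ)
    (d : ℂ) : Prop :=
  ∃ (p q : ℕ) (e : Fin n ≃ Fin p ⊕ Fin q)
    (Rm : Matrix (Fin n) (Fin p) ℂ) (Rp : Matrix (Fin n) (Fin q) ℂ)
    (Pm Pp : ℝ → Matrix (Fin n) (Fin n) ℂ),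
    LinearIndependent ℂ Rm.col ∧ Submodule.span ℂ (Set.range Rm.col) = unstableSubspace B ∧
    LinearIndependent ℂ Rp.col ∧ Submodule.span ℂ (Set.range Rp.col) = stableSubspace B ∧
    IsConjugator a B (Set.Iic 0) Pm ∧ IsConjugator a B (Set.Ici 0) Pp ∧
    d = ((Matrix.fromCols (Pm 0 * Rm) (Pp 0 * Rp)).submatrix id e).det /
        ((Matrix.fromCols Rm Rp).submatrix id e).det

/-- The homoclinic Evans function `D⁰(z)` of the system `W' = A⁰(x, z) W` with limit `A⁰_∞(z)`
as `x → ±∞`.  For hyperbolic `A⁰_∞(z)` the value does not depend on the bases and conjugators. -/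
noncomputable def homoclinicEvans {n : ℕ} (A0 : ℝ → ℂ → Matrix (Fin n) (Fin n) ℂ)
    (Ainf : ℂ → Matrix (Fin n) (Fin n) ℂ) (z : ℂ) : ℂ :=
  Classical.epsilon (IsEvansValue (fun x => A0 x z) (Ainf z))

/-- The multiplicity of an eigenvalue of the homoclinic problem: its order as a zero of `D⁰`. -/
noncomputable def homoclinicMultiplicity {n : ℕ} (A0 : ℝ → ℂ → Matrix (Fin n) (Fin n) ℂ)
    (Ainf : ℂ → Matrix (Fin n) (Fin n) ℂ) (z : ℂ) : ℕ :=
  analyticOrderNatAt (homoclinicEvans A0 Ainf) z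

/-- A family of first-order eigenvalue systems `W' = A^ε(x, z) W` with periodic coefficients of
period `X^ε` for `ε > 0`, converging to a homoclinic system at `ε = 0` in the large-period limit;
the bounds are required for `|z| ≤ M`. -/
structure IsHomoclinicLimitFamily {n : ℕ} (A : ℝ → ℝ → ℂ → Matrix (Fin n) (Fin n) ℂ)
    (Ainf : ℂ → Matrix (Fin n) (Fin n) ℂ) (X : ℝ → ℝ) (M C ν θ : ℝ) : Prop where
  analytic : ∀ ε : ℝ, 0 ≤ ε → ∀ x : ℝ, AnalyticOnNhd ℂ (A ε x) Set.univ
  contDiff : ∀ ε : ℝ, 0 ≤ ε → ∀ z : ℂ, ContDiff ℝ 1 (fun x => A ε x z)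
  period_pos : ∀ ε : ℝ, 0 < ε → 0 < X ε
  periodic : ∀ ε : ℝ, 0 < ε → ∀ z : ℂ, Function.Periodic (fun x => A ε x z) (X ε)
  period_tendsto : Filter.Tendsto X (nhdsWithin 0 (Set.Ioi 0)) Filter.atTop
  ν_pos : 0 < ν
  limit_bound : ∀ z : ℂ, ‖z‖ ≤ M → ∀ x : ℝ,
    ‖A 0 x z - Ainf z‖ ≤ C * Real.exp (-ν * |x|)
  θ_pos : 0 < θ
  converge_bound : ∀ ε : ℝ, 0 < ε → ∀ z : ℂ, ‖z‖ ≤ M → ∀ x : ℝ, |x| ≤ X ε / 2 →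
    ‖A ε x z - A 0 x z‖ ≤ C * Real.exp (-θ * X ε / 2)

/-! Fix `λ` in `K`, write `B` for the limit matrix, and cut the period `[-X/2, X/2]` into `2 N`
steps of a length `h` between 1 and 2. Divided by `det (flow B X - γ)`, the periodic Evans function
becomes `det (1 + K (F - flow B X))`, where `F` is the propagator across the period and `K = (flow B
X - γ)⁻¹`. By `det_one_sub_green` this is the determinant of a discrete boundary value problem on
the grid: identity minus a constant-coefficient Green's function times the local defect, i.e. the
one-step propagator minus the one-step flow. In this form no large exponentials occur, and such
determinants are Lipschitz in the sum of the moduli of their entries, with constants that do not see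
the number of grid points (`norm_det_one_add_sub_le`).

Replacing the periodic Green's function by that of the line (boundary operator `flow B (-X) * Qu`)
costs two terms reflected at the ends. Each is large only where the defect is of size `e^{-νX/2}`,
and of size `e^{-gX/2}` in the middle, so together they cost `O(e^{-ηX/2})`. Replacing the periodic
coefficient by the homoclinic one costs the number of steps times `e^{-θX/2}`, which is again
`O(e^{-ηX/2})` because `η < θ`. This is `exists_norm_det_periodic_sub_le`; the dichotomy constants
in it are uniform by `exists_dichotomy`.

The determinants on the line, `lineDet`, and the normalizing factors `wronskianRatio` are Cauchy in
`N` at rate `η`, since defects outside a window are small. Their product converges to `det (Pm 0 *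
Qu + Pp 0 * Qs)`, the homoclinic Evans function (`tendsto_lineDet`, `evans_quotient_eq`). The
conjugators identify the limit only; the rate comes from the Cauchy estimate, so no uniformity in
`λ` of the conjugators is needed. Altogether the normalized periodic Evans function is
`O(e^{-ηX/2})`-close to `D⁰`, uniformly in `λ ∈ K` and `|γ| = 1`
(`exists_norm_periodic_sub_evans_le`). Hence `D⁰` is a uniform limit of functions continuous on `K`
and holomorphic inside, and inherits both properties without any holomorphic choice of bases. Its
zeros are the eigenvalues by `exists_decaying_solution_iff`.

The rest is function theory. Since `D⁰` has no zero on the boundary of `K`, its zeros in `K` are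
finitely many and of finite order. Rouché's theorem in small disjoint disks gives exactly `m` zeros
of the perturbation around a zero of order `m`; there `|z - w|^m` is at most a constant times `|D⁰
z|`, which produces the exponent `1/m`. As an unordered tuple these zeros depend continuously and
periodically on `t`, and a continuous path of unordered tuples lifts to continuous functions
permuted after one period (`exists_continuous_selection_of_periodic`). -/

/-- Square complex matrices. -/
abbrev CMat (n : ℕ) := Matrix (Fin n) (Fin n) ℂ


/-- Cauchy's estimate turns the bound on `F` into a bound on its `z`-derivative on a smaller disk,
which permits differentiation under the integral sign. -/
theorem differentiableOn_intervalIntegral_param {E : Type*} [NormedAddCommGroup E] [NormedSpace ℝ E]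
    [NormedSpace ℂ E] [CompleteSpace E]
    {F : ℝ → ℂ → E} {U : Set ℂ} (hU : IsOpen U) {a b C : ℝ}
    (hc : ∀ z ∈ U, Continuous fun s => F s z)
    (hd : ∀ s, DifferentiableOn ℂ (F s) U)
    (hb : ∀ s ∈ Set.uIcc a b, ∀ z ∈ U, ‖F s z‖ ≤ C) :
    DifferentiableOn ℂ (fun z => ∫ s in a..b, F s z) U := by
  intro z₀ hz₀
  obtain ⟨r, hr, hrU⟩ := Metric.isOpen_iff.1 hU z₀ hz₀
  have hr2 : 0 < r / 2 := by positivity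
  have hball : Metric.ball z₀ (r / 2) ⊆ U :=
    (Metric.ball_subset_ball (by linarith)).trans hrU
  have hderiv : ∀ s ∈ Set.uIcc a b, ∀ z ∈ Metric.ball z₀ (r / 2),
      ‖deriv (F s) z‖ ≤ C / (r / 4) := by
    intro s hs z hz
    have hsub : Metric.closedBall z (r / 4) ⊆ U := by
      intro y hy
      apply hrU
      rw [Metric.mem_ball] at hz ⊢
      rw [Metric.mem_closedBall] at hy
      linarith [dist_triangle y z z₀]
    apply Complex.norm_deriv_le_of_forall_mem_sphere_norm_le (by positivity)
    · apply DifferentiableOn.diffContOnCl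
      rw [closure_ball _ (by positivity)]
      exact (hd s).mono hsub
    · intro y hy
      exact hb s hs y (hsub (Metric.sphere_subset_closedBall hy))
  -- Only `F` itself is known to be continuous in `s`; its `z`-derivative is measurable as a
  -- pointwise limit of difference quotients.
  have hmeas : MeasureTheory.AEStronglyMeasurable (fun s => deriv (F s) z₀)
      (MeasureTheory.volume.restrict (Set.uIoc a b)) := by
    have hlim : ∀ s, Filter.Tendsto
        (fun k : ℕ => ((r / 2 / (k + 2) : ℝ) : ℂ)⁻¹ • (F s (z₀ + ((r / 2 / (k + 2) : ℝ) : ℂ)) - F s z₀))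
        Filter.atTop (nhds (deriv (F s) z₀)) := by
      intro s
      have h1 : HasDerivAt (F s) (deriv (F s) z₀) z₀ :=
        ((hd s).differentiableAt (hU.mem_nhds hz₀)).hasDerivAt
      have h2 := h1.tendsto_slope_zero
      refine h2.comp ?_
      rw [tendsto_nhdsWithin_iff]
      constructor
      · have : Filter.Tendsto (fun k : ℕ => r / 2 / ((k : ℝ) + 2)) Filter.atTop (nhds 0) :=
          Filter.Tendsto.div_atTop tendsto_const_nhds
            (Filter.tendsto_atTop_add_const_right _ _ tendsto_natCast_atTop_atTop)
        have h3 := (Complex.continuous_ofReal.tendsto 0).comp this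
        simpa [Function.comp_def] using h3
      · refine Filter.Eventually.of_forall fun k => ?_
        simp only [Set.mem_compl_iff, Set.mem_singleton_iff, Complex.ofReal_eq_zero]
        positivity
    refine aestronglyMeasurable_of_tendsto_ae Filter.atTop (fun k => ?_)
      (Filter.Eventually.of_forall hlim)
    refine Continuous.aestronglyMeasurable ?_
    refine Continuous.const_smul ((hc _ (hball ?_)).sub (hc _ hz₀)) _
    rw [Metric.mem_ball, dist_eq_norm]
    simp only [add_sub_cancel_left, Complex.norm_real, Real.norm_eq_abs]
    rw [abs_of_pos (by positivity)]
    rw [div_lt_iff₀ (by positivity)]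
    nlinarith [(Nat.cast_nonneg k : (0:ℝ) ≤ k)]
  have key := intervalIntegral.hasDerivAt_integral_of_dominated_loc_of_deriv_le
    (F := fun z s => F s z) (F' := fun z s => deriv (F s) z) (x₀ := z₀) (a := a) (b := b)
    (μ := MeasureTheory.volume) (bound := fun _ => C / (r / 4))
    (Metric.ball_mem_nhds z₀ hr2)
    (Filter.eventually_of_mem (hU.mem_nhds hz₀) fun z hz => (hc z hz).aestronglyMeasurable)
    ((hc z₀ hz₀).intervalIntegrable _ _) hmeas
    (Filter.Eventually.of_forall fun s hs z hz => hderiv s (Set.uIoc_subset_uIcc hs) z hz)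
    (continuous_const.intervalIntegrable _ _)
    (Filter.Eventually.of_forall fun s hs z hz =>
      ((hd s).differentiableAt (hU.mem_nhds (hball hz))).hasDerivAt)
  exact key.2.differentiableAt.differentiableWithinAt

/-! ### Linear equations in a Banach algebra by Picard iteration. -/

section LinearODE

variable {𝔸 : Type*} [NormedRing 𝔸] [NormedAlgebra ℝ 𝔸]

/-- The Picard iterates for the matrix equation `Y' = a Y`, `Y 0 = 1`. -/
noncomputable def picardIter (a : ℝ → 𝔸) : ℕ → ℝ → 𝔸
  | 0 => fun _ => 1
  | k + 1 => fun x => 1 + ∫ s in (0 : ℝ)..x, a s * picardIter a k s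

/-- The limit of the Picard iterates, written as a telescoping series. -/
noncomputable def picardLim (a : ℝ → 𝔸) (x : ℝ) : 𝔸 :=
  1 + ∑' k, (picardIter a (k + 1) x - picardIter a k x)

theorem continuous_picardIter {a : ℝ → 𝔸} (ha : Continuous a) (k : ℕ) :
    Continuous (picardIter a k) := by
  induction k with
  | zero => exact continuous_const
  | succ k ih =>
    refine continuous_const.add ?_
    exact intervalIntegral.continuous_primitive
      (fun u v => (ha.mul ih).intervalIntegrable u v) 0

theorem norm_intervalIntegral_le_pow {E : Type*} [NormedAddCommGroup E] [NormedSpace ℝ E]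
    {f : ℝ → E} {c x : ℝ} {k : ℕ} (hf : ∀ s ∈ Set.uIoc 0 x, ‖f s‖ ≤ c * |s| ^ k) :
    ‖∫ s in (0 : ℝ)..x, f s‖ ≤ c * (|x| ^ (k + 1) / (k + 1)) := by
  rw [intervalIntegral.norm_integral_eq_norm_integral_uIoc]
  have h1 : ∫ s in Set.uIoc 0 x, c * |s| ^ k = c * (|x| ^ (k + 1) / (k + 1)) := by
    rw [MeasureTheory.integral_const_mul]
    have := integral_pow_abs_sub_uIoc (a := 0) (b := x) (n := k)
    simp only [sub_zero] at this
    rw [this]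
  rw [← h1]
  refine MeasureTheory.norm_integral_le_of_norm_le ?_ ?_
  · have : Continuous fun s : ℝ => c * |s| ^ k := by fun_prop
    exact (this.intervalIntegrable 0 x).def'
  · exact (MeasureTheory.ae_restrict_iff' measurableSet_uIoc).2 (Filter.Eventually.of_forall hf)

/-- Each iteration integrates the previous bound once more, so the differences are dominated by the
terms of an exponential series. -/
theorem norm_picardIter_succ_sub_le {a : ℝ → 𝔸} (ha : Continuous a) {L R : ℝ}
    (hL : ∀ s, |s| ≤ R → ‖a s‖ ≤ L) (k : ℕ) (x : ℝ) (hx : |x| ≤ R) :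
    ‖picardIter a (k + 1) x - picardIter a k x‖ ≤
      ‖(1 : 𝔸)‖ * ((L * |x|) ^ (k + 1) / (k + 1).factorial) := by
  have hsub : ∀ s ∈ Set.uIoc 0 x, |s| ≤ |x| := by
    intro s hs
    have := Set.abs_sub_left_of_mem_uIcc (Set.uIoc_subset_uIcc hs)
    simpa using this
  have hL0 : 0 ≤ L := (norm_nonneg _).trans (hL x hx)
  induction k generalizing x with
  | zero =>
    have h := norm_intervalIntegral_le_pow (f := fun s => a s * 1) (c := L * ‖(1 : 𝔸)‖)
      (x := x) (k := 0) fun s hs => by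
        refine (norm_mul_le _ _).trans ?_
        simpa using mul_le_mul_of_nonneg_right (hL s ((hsub s hs).trans hx)) (norm_nonneg _)
    simp only [picardIter, add_sub_cancel_left]
    refine h.trans_eq ?_
    simp
    ring
  | succ k ih =>
    have hdiff : picardIter a (k + 2) x - picardIter a (k + 1) x =
        ∫ s in (0 : ℝ)..x, a s * (picardIter a (k + 1) s - picardIter a k s) := by
      have h1 : ∀ j, IntervalIntegrable (fun s => a s * picardIter a j s)
          MeasureTheory.volume 0 x :=
        fun j => (ha.mul (continuous_picardIter ha j)).intervalIntegrable _ _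
      simp only [mul_sub]
      rw [intervalIntegral.integral_sub (h1 _) (h1 _)]
      change (1 + _) - (1 + _) = _
      rw [add_sub_add_left_eq_sub]
    rw [hdiff]
    have h := norm_intervalIntegral_le_pow
      (f := fun s => a s * (picardIter a (k + 1) s - picardIter a k s))
      (c := L * (‖(1 : 𝔸)‖ * (L ^ (k + 1) / (k + 1).factorial)))
      (x := x) (k := k + 1) fun s hs => by
        refine (norm_mul_le _ _).trans ?_
        have hs' := (hsub s hs).trans hx
        have := ih s hs' fun u hu => by
          have := Set.abs_sub_left_of_mem_uIcc (Set.uIoc_subset_uIcc hu)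
          simpa using this
        refine (mul_le_mul (hL s hs') this (norm_nonneg _) hL0).trans_eq ?_
        rw [mul_pow]
        ring
    refine h.trans_eq ?_
    rw [mul_pow, Nat.factorial_succ (k + 1)]
    push_cast
    field_simp
    ring

theorem summable_picard_bound (c t : ℝ) :
    Summable fun k : ℕ => c * (t ^ (k + 1) / (k + 1).factorial) :=
  ((summable_nat_add_iff 1).2 (Real.summable_pow_div_factorial t)).mul_left c

theorem exists_bound_of_continuous {E : Type*} [NormedAddCommGroup E] {a : ℝ → E} (ha : Continuous a) (R : ℝ) :
    ∃ L, ∀ s, |s| ≤ R → ‖a s‖ ≤ L := by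
  obtain ⟨L, hL⟩ := (isCompact_Icc (a := -R) (b := R)).exists_bound_of_continuousOn
    ha.continuousOn
  exact ⟨L, fun s hs => hL s (abs_le.1 hs)⟩

theorem eq_of_hasDerivAt_zero {E : Type*} [NormedAddCommGroup E] [NormedSpace ℝ E] {f : ℝ → E}
    (h : ∀ x, HasDerivAt f 0 x) (x y : ℝ) : f x = f y :=
  is_const_of_deriv_eq_zero (fun x => (h x).differentiableAt) (fun x => (h x).deriv) x y

/-- The product has zero derivative. Thus `Θ` acts as a left inverse of the fundamental solution,
and both invertibility and uniqueness follow from its existence. -/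
theorem adjoint_mul_solution {a Θ Y : ℝ → 𝔸}
    (h0 : Θ 0 = 1) (h1 : ∀ x, HasDerivAt Θ (-(Θ x * a x)) x)
    (hY : ∀ x, HasDerivAt Y (a x * Y x) x) (x : ℝ) : Θ x * Y x = Y 0 := by
  have : ∀ x, HasDerivAt (fun s => Θ s * Y s) 0 x := fun x => by
    refine ((h1 x).mul (hY x)).congr_deriv ?_
    noncomm_ring
  rw [eq_of_hasDerivAt_zero this x 0, h0, one_mul]

variable [CompleteSpace 𝔸]

/-- The index `β` may carry the time, the spectral parameter, or nothing, so that one estimate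
yields continuity in `x`, regularity in `z` and pointwise convergence. -/
theorem tendstoUniformlyOn_picardIter {β : Type*} {a : β → ℝ → 𝔸} {x : β → ℝ}
    {S : Set β} {L R : ℝ}
    (ha : ∀ z ∈ S, Continuous (a z)) (hL : ∀ z ∈ S, ∀ s, |s| ≤ R → ‖a z s‖ ≤ L)
    (hx : ∀ z ∈ S, |x z| ≤ R) :
    TendstoUniformlyOn (fun k z => picardIter (a z) k (x z)) (fun z => picardLim (a z) (x z))
      Filter.atTop S := by
  have h := tendstoUniformlyOn_tsum_nat
    (f := fun k z => picardIter (a z) (k + 1) (x z) - picardIter (a z) k (x z))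
    (summable_picard_bound ‖(1 : 𝔸)‖ (L * R)) (s := S) fun k z hz => by
      refine (norm_picardIter_succ_sub_le (ha z hz) (hL z hz) k (x z) (hx z hz)).trans ?_
      have hL0 : 0 ≤ L := (norm_nonneg _).trans (hL z hz _ (hx z hz))
      have := hx z hz
      gcongr
  intro u hu
  rw [Metric.uniformity_basis_dist.mem_iff] at hu
  obtain ⟨ε, hε, hu⟩ := hu
  filter_upwards [Metric.tendstoUniformlyOn_iff.1 h ε hε] with k hk z hz
  apply hu
  have := hk z hz
  rw [dist_eq_norm, Finset.sum_range_sub (fun k => picardIter (a z) k (x z))] at this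
  rw [show picardIter (a z) 0 (x z) = 1 from rfl] at this
  change dist (1 + _) _ < ε
  rw [dist_eq_norm]
  convert this using 2
  abel

theorem tendsto_picardIter {a : ℝ → 𝔸} (ha : Continuous a) (x : ℝ) :
    Filter.Tendsto (fun k => picardIter a k x) Filter.atTop (nhds (picardLim a x)) := by
  obtain ⟨L, hL⟩ := exists_bound_of_continuous ha |x|
  exact (tendstoUniformlyOn_picardIter (a := fun _ : Unit => a) (x := fun _ => x)
    (S := Set.univ) (fun _ _ => ha) (fun _ _ => hL) (fun _ _ => le_rfl)).tendsto_at
    (Set.mem_univ ())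

theorem continuous_picardLim {a : ℝ → 𝔸} (ha : Continuous a) :
    Continuous (picardLim a) := by
  rw [continuous_iff_continuousAt]
  intro x₀
  obtain ⟨L, hL⟩ := exists_bound_of_continuous ha (|x₀| + 1)
  have h := tendstoUniformlyOn_picardIter (a := fun _ : ℝ => a) (x := fun x => x)
    (S := Metric.ball x₀ 1) (R := |x₀| + 1) (fun _ _ => ha) (fun _ _ => hL) (fun x hx => by
      rw [Metric.mem_ball, Real.dist_eq] at hx
      have := abs_sub_abs_le_abs_sub x x₀
      linarith)
  exact (h.continuousOn (Filter.Frequently.of_forall fun k =>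
    (continuous_picardIter ha k).continuousOn)).continuousAt (Metric.ball_mem_nhds x₀ one_pos)

theorem picardLim_eq_integral {a : ℝ → 𝔸} (ha : Continuous a) (x : ℝ) :
    picardLim a x = 1 + ∫ s in (0 : ℝ)..x, a s * picardLim a s := by
  have h1 : Filter.Tendsto (fun k => picardIter a (k + 1) x) Filter.atTop
      (nhds (picardLim a x)) := (tendsto_picardIter ha x).comp (Filter.tendsto_add_atTop_nat 1)
  refine tendsto_nhds_unique h1 ?_
  refine Filter.Tendsto.const_add _ ?_
  obtain ⟨L, hL⟩ := exists_bound_of_continuous ha |x|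
  have hu := tendstoUniformlyOn_picardIter (a := fun _ : ℝ => a) (x := fun s => s)
    (S := {s | |s| ≤ |x|}) (R := |x|) (fun _ _ => ha) (fun _ _ => hL) (fun _ hs => hs)
  obtain ⟨D, hD⟩ := (isCompact_Icc (a := -|x|) (b := |x|)).exists_bound_of_continuousOn
    (continuous_picardLim ha).continuousOn
  refine intervalIntegral.tendsto_integral_filter_of_dominated_convergence
    (fun _ => L * (D + 1)) ?_ ?_ (continuous_const.intervalIntegrable _ _) ?_
  · exact Filter.Eventually.of_forall fun k =>
      (ha.mul (continuous_picardIter ha k)).aestronglyMeasurable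
  · filter_upwards [Metric.tendstoUniformlyOn_iff.1 hu 1 one_pos] with k hk
    refine Filter.Eventually.of_forall fun s hs => ?_
    have hs' : |s| ≤ |x| := by
      have := Set.abs_sub_left_of_mem_uIcc (Set.uIoc_subset_uIcc hs)
      simpa using this
    have h2 := hk s hs'
    have h3 := hD s (abs_le.1 hs')
    rw [dist_eq_norm] at h2
    refine (norm_mul_le _ _).trans (mul_le_mul (hL s hs') ?_ (norm_nonneg _)
      ((norm_nonneg _).trans (hL s hs')))
    have h4 := norm_sub_norm_le (picardIter a k s) (picardLim a s)
    rw [norm_sub_rev] at h4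
    linarith
  · exact Filter.Eventually.of_forall fun s _ => (tendsto_picardIter ha s).const_mul (a s)

theorem picardLim_zero {a : ℝ → 𝔸} (ha : Continuous a) : picardLim a 0 = 1 := by
  rw [picardLim_eq_integral ha]
  simp

theorem hasDerivAt_picardLim {a : ℝ → 𝔸} (ha : Continuous a) (x : ℝ) :
    HasDerivAt (picardLim a) (a x * picardLim a x) x := by
  have hc : Continuous fun s => a s * picardLim a s := ha.mul (continuous_picardLim ha)
  have h := ((hc.integral_hasStrictDerivAt 0 x).hasDerivAt).const_add (1 : 𝔸)
  refine h.congr_of_eventuallyEq (Filter.Eventually.of_forall fun y => ?_)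
  exact picardLim_eq_integral ha y

/-- The adjoint equation has a solution. -/
theorem exists_adjoint_solution {a : ℝ → 𝔸} (ha : Continuous a) :
    ∃ Θ : ℝ → 𝔸, Θ 0 = 1 ∧ ∀ x, HasDerivAt Θ (-(Θ x * a x)) x := by
  -- The adjoint equation multiplies by the coefficient on the right; in the opposite algebra it is
  -- an equation of the original type.
  have hb : Continuous fun s => MulOpposite.op (-(a s)) :=
    MulOpposite.continuous_op.comp ha.neg
  refine ⟨fun s => (picardLim (fun s => MulOpposite.op (-(a s))) s).unop,
    (congrArg MulOpposite.unop (picardLim_zero hb)).trans MulOpposite.unop_one, fun x => ?_⟩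
  have h := (MulOpposite.opContinuousLinearEquiv ℝ (M := 𝔸)).symm.toContinuousLinearMap.hasFDerivAt.comp_hasDerivAt
    x (hasDerivAt_picardLim hb x)
  refine h.congr_deriv ?_
  simp

/-- The adjoint solution is a left inverse, and in a Dedekind-finite monoid a one-sided inverse is
two-sided. -/
theorem isUnit_picardLim [IsDedekindFiniteMonoid 𝔸] {a : ℝ → 𝔸} (ha : Continuous a) (x : ℝ) :
    IsUnit (picardLim a x) := by
  obtain ⟨Θ, h0, h1⟩ := exists_adjoint_solution ha
  have h := adjoint_mul_solution h0 h1 (hasDerivAt_picardLim ha) x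
  rw [picardLim_zero ha] at h
  exact IsUnit.of_mul_eq_one _ (mul_eq_one_comm.1 h)

theorem eq_picardLim_mul [IsDedekindFiniteMonoid 𝔸] {a : ℝ → 𝔸} (ha : Continuous a) {Y : ℝ → 𝔸}
    (hY : ∀ x, HasDerivAt Y (a x * Y x) x) (x : ℝ) : Y x = picardLim a x * Y 0 := by
  obtain ⟨Θ, h0, h1⟩ := exists_adjoint_solution ha
  have h := adjoint_mul_solution h0 h1 (hasDerivAt_picardLim ha) x
  rw [picardLim_zero ha] at h
  rw [← adjoint_mul_solution h0 h1 hY x, ← mul_assoc, mul_eq_one_comm.1 h, one_mul]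

/-- Continuity and analyticity of the solution in a parameter. -/
theorem picardLim_param [NormedAlgebra ℂ 𝔸] {a : ℝ → ℂ → 𝔸} {S U : Set ℂ} (hU : IsOpen U)
    (hUS : U ⊆ S) (ha : ∀ z ∈ S, Continuous fun s => a s z)
    (hb : ∀ R, ∃ L, ∀ s, |s| ≤ R → ∀ z ∈ S, ‖a s z‖ ≤ L)
    (hc : ∀ s, ContinuousOn (a s) S) (hd : ∀ s, DifferentiableOn ℂ (a s) U) (x : ℝ) :
    ContinuousOn (fun z => picardLim (fun s => a s z) x) S ∧
      DifferentiableOn ℂ (fun z => picardLim (fun s => a s z) x) U := by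
  let _ : NormedSpace ℝ 𝔸 := NormedAlgebra.toNormedSpace 𝔸
  have hiter : ∀ k x, ContinuousOn (fun z => picardIter (fun s => a s z) k x) S ∧
      DifferentiableOn ℂ (fun z => picardIter (fun s => a s z) k x) U := by
    intro k
    induction k with
    | zero => exact fun x => ⟨continuousOn_const, differentiableOn_const _⟩
    | succ k ih =>
      intro x
      obtain ⟨L, hL⟩ := hb |x|
      have hx : ∀ s ∈ Set.uIcc 0 x, |s| ≤ |x| := fun s hs => by
        have := Set.abs_sub_left_of_mem_uIcc hs
        simpa using this
      -- The iterate is the telescoping sum of its differences; bounding these uniformly in `z`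
      -- supplies the dominating constant for the next integral.
      obtain ⟨D, hD⟩ : ∃ D, ∀ s, |s| ≤ |x| → ∀ z ∈ S, ‖picardIter (fun s => a s z) k s‖ ≤ D := by
        refine ⟨‖(1 : 𝔸)‖ + ∑ j ∈ Finset.range k,
          ‖(1 : 𝔸)‖ * ((L * |x|) ^ (j + 1) / (j + 1).factorial), fun s hs z hz => ?_⟩
        have h := Finset.sum_range_sub (fun k => picardIter (fun s => a s z) k s) k
        have h1 : picardIter (fun s => a s z) k s = 1 + ∑ j ∈ Finset.range k,
            (picardIter (fun s => a s z) (j + 1) s - picardIter (fun s => a s z) j s) := by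
          rw [h]
          simp [picardIter]
        rw [h1]
        refine (norm_add_le _ _).trans (add_le_add le_rfl ?_)
        refine (norm_sum_le _ _).trans (Finset.sum_le_sum fun j _ => ?_)
        have hL0 : 0 ≤ L := (norm_nonneg _).trans (hL s hs z hz)
        refine (norm_picardIter_succ_sub_le (ha z hz) (fun s hs => hL s hs z hz) j s hs).trans ?_
        gcongr
      have hbound : ∀ s ∈ Set.uIcc 0 x, ∀ z ∈ S,
          ‖a s z * picardIter (fun s => a s z) k s‖ ≤ L * D := fun s hs z hz =>
        (norm_mul_le _ _).trans (mul_le_mul (hL s (hx s hs) z hz) (hD s (hx s hs) z hz)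
          (norm_nonneg _) ((norm_nonneg _).trans (hL s (hx s hs) z hz)))
      have hcont : ∀ z ∈ S, Continuous fun s => a s z * picardIter (fun s => a s z) k s :=
        fun z hz => (ha z hz).mul (continuous_picardIter (ha z hz) k)
      constructor
      · refine continuousOn_const.add fun z hz => ?_
        refine intervalIntegral.continuousWithinAt_of_dominated_interval (bound := fun _ => L * D)
          ?_ ?_ (continuous_const.intervalIntegrable _ _) ?_
        · exact Filter.eventually_of_mem self_mem_nhdsWithin fun z hz =>
            (hcont z hz).aestronglyMeasurable
        · exact Filter.eventually_of_mem self_mem_nhdsWithin fun z hz =>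
            Filter.Eventually.of_forall fun s hs => hbound s (Set.uIoc_subset_uIcc hs) z hz
        · exact Filter.Eventually.of_forall fun s _ => ((hc s).mul (ih s).1) z hz
      · refine (differentiableOn_const _).add ?_
        exact differentiableOn_intervalIntegral_param hU
          (fun z hz => hcont z (hUS hz)) (fun s => (hd s).mul (ih s).2)
          (fun s hs z hz => hbound s hs z (hUS hz))
  obtain ⟨L, hL⟩ := hb |x|
  have hunif := tendstoUniformlyOn_picardIter (a := fun z s => a s z) (x := fun _ => x)
    (S := S) (R := |x|) ha (fun z hz s hs => hL s hs z hz) (fun _ _ => le_rfl)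
  constructor
  · exact hunif.continuousOn (Filter.Frequently.of_forall fun k => (hiter k x).1)
  · exact (hunif.mono hUS).tendstoLocallyUniformlyOn.differentiableOn
      (Filter.Eventually.of_forall fun k => (hiter k x).2) hU

end LinearODE

/-! ### The solution operator of a matrix system. -/

section SolutionOperator

variable {n : ℕ} {a : ℝ → CMat n}

theorem isSolutionOperator_solutionOperator (ha : Continuous a) :
    IsSolutionOperator a (solutionOperator a) :=
  Classical.epsilon_spec ⟨_, picardLim_zero ha, hasDerivAt_picardLim ha⟩

theorem solutionOperator_zero (ha : Continuous a) : solutionOperator a 0 = 1 :=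
  (isSolutionOperator_solutionOperator ha).1

theorem hasDerivAt_solutionOperator (ha : Continuous a) (x : ℝ) :
    HasDerivAt (solutionOperator a) (a x * solutionOperator a x) x :=
  (isSolutionOperator_solutionOperator ha).2 x

theorem solutionOperator_eq_picardLim (ha : Continuous a) : solutionOperator a = picardLim a := by
  funext x
  rw [eq_picardLim_mul ha (hasDerivAt_solutionOperator ha) x, solutionOperator_zero ha, mul_one]

theorem isUnit_solutionOperator (ha : Continuous a) (x : ℝ) : IsUnit (solutionOperator a x) := by
  rw [solutionOperator_eq_picardLim ha]
  exact isUnit_picardLim ha x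

theorem eq_solutionOperator_mul (ha : Continuous a) {Y : ℝ → CMat n}
    (hY : ∀ x, HasDerivAt Y (a x * Y x) x) (x : ℝ) : Y x = solutionOperator a x * Y 0 := by
  rw [solutionOperator_eq_picardLim ha]
  exact eq_picardLim_mul ha hY x

/-- Vector solutions of `W' = a W` are propagated by the solution operator. -/
theorem eq_solutionOperator_mulVec (ha : Continuous a) {W : ℝ → Fin n → ℂ}
    (hW : ∀ x, HasDerivAt W ((a x).mulVec (W x)) x) (x : ℝ) :
    W x = (solutionOperator a x).mulVec (W 0) := by
  -- A vector is repeated in every column of a matrix, so that uniqueness for matrix solutions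
  -- applies to vector solutions.
  let T : (Fin n → ℂ) →ₗ[ℝ] CMat n :=
    { toFun := fun v => Matrix.of fun i _ => v i
      map_add' := fun _ _ => rfl
      map_smul' := fun _ _ => rfl }
  have hmul : ∀ (m : CMat n) (v : Fin n → ℂ), T (m.mulVec v) = m * T v := fun m v => by
    ext i j
    rfl
  have h : ∀ x, HasDerivAt (fun s => T (W s)) (a x * T (W x)) x := fun x => by
    rw [← hmul]
    exact T.toContinuousLinearMap.hasFDerivAt.comp_hasDerivAt x (hW x)
  have h2 := eq_solutionOperator_mul ha h x
  rw [← hmul] at h2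
  funext i
  exact congrFun (congrFun h2 i) i

theorem hasDerivAt_solutionOperator_mulVec (ha : Continuous a) (v : Fin n → ℂ) (x : ℝ) :
    HasDerivAt (fun s => (solutionOperator a s).mulVec v)
      ((a x).mulVec ((solutionOperator a x).mulVec v)) x := by
  let T : CMat n →ₗ[ℝ] (Fin n → ℂ) :=
    { toFun := fun m => m.mulVec v
      map_add' := fun _ _ => Matrix.add_mulVec _ _ _
      map_smul' := fun _ _ => Matrix.smul_mulVec _ _ _ }
  have := T.toContinuousLinearMap.hasFDerivAt.comp_hasDerivAt x (hasDerivAt_solutionOperator ha x)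
  rw [Matrix.mulVec_mulVec]
  exact this

/-- A solution shifted by a period is again a solution, hence determined by its value at `0`. -/
theorem solutionOperator_add_period (ha : Continuous a) {X : ℝ} (hX : Function.Periodic a X)
    (x : ℝ) : solutionOperator a (x + X) = solutionOperator a x * solutionOperator a X := by
  have h : ∀ x, HasDerivAt (fun s => solutionOperator a (s + X))
      (a x * solutionOperator a (x + X)) x := fun x => by
    have := (hasDerivAt_solutionOperator ha (x + X)).comp_add_const x X
    rwa [hX x] at this
  have := eq_solutionOperator_mul ha h x
  simpa using this

end SolutionOperator

/-- Continuity and analyticity of the solution operator in a parameter. -/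
theorem solutionOperator_param {n : ℕ} {a : ℝ → ℂ → CMat n} {S U : Set ℂ} (hU : IsOpen U)
    (hUS : U ⊆ S) (ha : ∀ z ∈ S, Continuous fun s => a s z)
    (hb : ∀ R, ∃ L, ∀ s, |s| ≤ R → ∀ z ∈ S, ‖a s z‖ ≤ L)
    (hc : ∀ s, ContinuousOn (a s) S) (hd : ∀ s, DifferentiableOn ℂ (a s) U) (x : ℝ) :
    ContinuousOn (fun z => solutionOperator (fun s => a s z) x) S ∧
      DifferentiableOn ℂ (fun z => solutionOperator (fun s => a s z) x) U := by
  have heq : ∀ z ∈ S, solutionOperator (fun s => a s z) x = picardLim (fun s => a s z) x :=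
    fun z hz => by rw [solutionOperator_eq_picardLim (ha z hz)]
  have h := picardLim_param hU hUS ha hb hc hd x
  exact ⟨h.1.congr heq, h.2.congr fun z hz => heq z (hUS hz)⟩

/-! ### Gronwall estimates for solutions and their differences. -/

section Gronwall

variable {𝔸 : Type*} [NormedRing 𝔸] [NormedAlgebra ℝ 𝔸]

theorem norm_solution_le {a Y : ℝ → 𝔸} {x y L : ℝ} (hxy : y ≤ x)
    (hY : ∀ s, HasDerivAt Y (a s * Y s) s) (ha : ∀ s ∈ Set.Icc y x, ‖a s‖ ≤ L) :
    ‖Y x‖ ≤ ‖Y y‖ * Real.exp (L * (x - y)) := by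
  have h := norm_le_gronwallBound_of_norm_deriv_right_le (f := Y) (f' := fun s => a s * Y s)
    (δ := ‖Y y‖) (K := L) (ε := 0) (a := y) (b := x)
    (fun s _ => (hY s).continuousAt.continuousWithinAt)
    (fun s _ => (hY s).hasDerivWithinAt) le_rfl
    (fun s hs => by
      rw [add_zero]
      exact (norm_mul_le _ _).trans
        (mul_le_mul_of_nonneg_right (ha s (Set.Ico_subset_Icc_self hs)) (norm_nonneg _)))
    x (Set.right_mem_Icc.2 hxy)
  rwa [gronwallBound_ε0] at h

/-- The difference solves the equation of `a` with forcing `(a - b) Z`, and `Z` is bounded by the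
homogeneous estimate. -/
theorem norm_solution_sub_le {a b Y Z : ℝ → 𝔸} {x y L δ : ℝ} (hL : 0 < L) (hxy : y ≤ x)
    (hY : ∀ s, HasDerivAt Y (a s * Y s) s) (hZ : ∀ s, HasDerivAt Z (b s * Z s) s)
    (hYZ : Y y = Z y) (ha : ∀ s ∈ Set.Icc y x, ‖a s‖ ≤ L) (hb : ∀ s ∈ Set.Icc y x, ‖b s‖ ≤ L)
    (hab : ∀ s ∈ Set.Icc y x, ‖a s - b s‖ ≤ δ) :
    ‖Y x - Z x‖ ≤ δ * (‖Y y‖ * ((x - y) * Real.exp (2 * L * (x - y)))) := by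
  have hδ : 0 ≤ δ := (norm_nonneg _).trans (hab y (Set.left_mem_Icc.2 hxy))
  set ε := δ * (‖Y y‖ * Real.exp (L * (x - y)))
  have hε : 0 ≤ ε := by positivity
  have h := norm_le_gronwallBound_of_norm_deriv_right_le (f := fun s => Y s - Z s)
    (f' := fun s => a s * Y s - b s * Z s)
    (δ := 0) (K := L) (ε := ε) (a := y) (b := x)
    (fun s _ => ((hY s).sub (hZ s)).continuousAt.continuousWithinAt)
    (fun s _ => ((hY s).sub (hZ s)).hasDerivWithinAt) (by simp [hYZ])
    (fun s hs => by
      have hs' := Set.Ico_subset_Icc_self hs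
      have h1 : a s * Y s - b s * Z s = a s * (Y s - Z s) + (a s - b s) * Z s := by noncomm_ring
      rw [h1]
      refine (norm_add_le _ _).trans (add_le_add ?_ ?_)
      · exact (norm_mul_le _ _).trans (mul_le_mul_of_nonneg_right (ha s hs') (norm_nonneg _))
      · refine (norm_mul_le _ _).trans (mul_le_mul (hab s hs') ?_ (norm_nonneg _) hδ)
        refine (norm_solution_le hs'.1 hZ fun u hu => hb u ⟨hu.1, hu.2.trans hs'.2⟩).trans ?_
        rw [hYZ]
        gcongr
        exact hs'.2)
    x (Set.right_mem_Icc.2 hxy)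
  refine h.trans ?_
  rw [gronwallBound_of_K_ne_0 hL.ne']
  simp only [zero_mul, zero_add]
  -- This cancels the division by `L` in the Gronwall bound.
  have hu : Real.exp (L * (x - y)) - 1 ≤ L * (x - y) * Real.exp (L * (x - y)) := by
    have h2 := Real.add_one_le_exp (-(L * (x - y)))
    rw [Real.exp_neg] at h2
    have h3 := Real.exp_pos (L * (x - y))
    have h4 := mul_le_mul_of_nonneg_right h2 h3.le
    rw [inv_mul_cancel₀ h3.ne'] at h4
    linarith
  calc ε / L * (Real.exp (L * (x - y)) - 1)
      ≤ ε / L * (L * (x - y) * Real.exp (L * (x - y))) := by gcongr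
    _ = δ * (‖Y y‖ * ((x - y) * (Real.exp (L * (x - y)) * Real.exp (L * (x - y))))) := by
        simp only [ε]
        field_simp
    _ = _ := by
        rw [← Real.exp_add]
        ring_nf

end Gronwall

/-! ### Propagators and constant-coefficient flows. -/

theorem norm_one_matrix_le (n : ℕ) : ‖(1 : CMat n)‖ ≤ 1 := by
  rcases isEmpty_or_nonempty (Fin n) with h | h
  · have : (1 : CMat n) = 0 := Subsingleton.elim _ _
    simp [this]
  · exact norm_one.le

/-- The evolution operator of `W' = a W` from time `y` to time `x`. -/
noncomputable def propagator {n : ℕ} (a : ℝ → CMat n) (x y : ℝ) : CMat n :=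
  solutionOperator a x * (solutionOperator a y)⁻¹

/-- The flow of a constant coefficient system. -/
noncomputable def flow {n : ℕ} (B : CMat n) (x : ℝ) : CMat n := solutionOperator (fun _ => B) x

section Propagator

variable {n : ℕ} {a b : ℝ → CMat n}

theorem isUnit_det_solutionOperator (ha : Continuous a) (x : ℝ) :
    IsUnit (solutionOperator a x).det :=
  (Matrix.isUnit_iff_isUnit_det _).1 (isUnit_solutionOperator ha x)

theorem propagator_self (ha : Continuous a) (x : ℝ) : propagator a x x = 1 :=
  Matrix.mul_nonsing_inv _ (isUnit_det_solutionOperator ha x)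

theorem propagator_zero (ha : Continuous a) (x : ℝ) : propagator a x 0 = solutionOperator a x := by
  rw [propagator, solutionOperator_zero ha, inv_one, mul_one]

theorem propagator_mul (ha : Continuous a) (x y z : ℝ) :
    propagator a x y * propagator a y z = propagator a x z := by
  simp only [propagator]
  rw [mul_assoc, ← mul_assoc (solutionOperator a y)⁻¹,
    Matrix.nonsing_inv_mul _ (isUnit_det_solutionOperator ha y), one_mul]

theorem hasDerivAt_propagator (ha : Continuous a) (x y : ℝ) :
    HasDerivAt (fun s => propagator a s y) (a x * propagator a x y) x := by
  have := (hasDerivAt_solutionOperator ha x).mul_const (solutionOperator a y)⁻¹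
  rw [mul_assoc] at this
  exact this

theorem norm_propagator_le (ha : Continuous a) {x y L : ℝ} (hxy : y ≤ x)
    (hL : ∀ s ∈ Set.Icc y x, ‖a s‖ ≤ L) : ‖propagator a x y‖ ≤ Real.exp (L * (x - y)) := by
  have h := norm_solution_le (Y := fun s => propagator a s y) hxy
    (fun s => hasDerivAt_propagator ha s y) hL
  simp only [propagator_self ha] at h
  exact h.trans (mul_le_of_le_one_left (Real.exp_pos _).le (norm_one_matrix_le n))

theorem norm_propagator_sub_le (ha : Continuous a) (hb : Continuous b) {x y L δ : ℝ}
    (hL : 0 < L) (hxy : y ≤ x)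
    (haL : ∀ s ∈ Set.Icc y x, ‖a s‖ ≤ L) (hbL : ∀ s ∈ Set.Icc y x, ‖b s‖ ≤ L)
    (hab : ∀ s ∈ Set.Icc y x, ‖a s - b s‖ ≤ δ) :
    ‖propagator a x y - propagator b x y‖ ≤ δ * ((x - y) * Real.exp (2 * L * (x - y))) := by
  have hδ : 0 ≤ δ := (norm_nonneg _).trans (hab y (Set.left_mem_Icc.2 hxy))
  have h := norm_solution_sub_le (Y := fun s => propagator a s y) (Z := fun s => propagator b s y)
    hL hxy (fun s => hasDerivAt_propagator ha s y) (fun s => hasDerivAt_propagator hb s y)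
    (by simp only [propagator_self ha, propagator_self hb]) haL hbL hab
  simp only [propagator_self ha] at h
  refine h.trans (mul_le_mul_of_nonneg_left ?_ hδ)
  exact mul_le_of_le_one_left (mul_nonneg (by linarith) (Real.exp_pos _).le) (norm_one_matrix_le n)

end Propagator

section Flow

variable {n : ℕ} (B : CMat n)

theorem flow_zero : flow B 0 = 1 := solutionOperator_zero continuous_const

/-- Every number is a period of a constant coefficient, so the group law is the Floquet identity. -/
theorem flow_add (x y : ℝ) : flow B (x + y) = flow B x * flow B y :=
  solutionOperator_add_period continuous_const (fun _ => rfl) x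

theorem flow_neg_mul (x : ℝ) : flow B (-x) * flow B x = 1 := by
  rw [← flow_add, neg_add_cancel, flow_zero]

theorem flow_mul_neg (x : ℝ) : flow B x * flow B (-x) = 1 := by
  rw [← flow_add, add_neg_cancel, flow_zero]

theorem hasDerivAt_flow (x : ℝ) : HasDerivAt (flow B) (B * flow B x) x :=
  hasDerivAt_solutionOperator continuous_const x

theorem flow_commute {B : CMat n} {Q : CMat n} (hQ : Commute Q B) (x : ℝ) :
    Commute Q (flow B x) := by
  have h : ∀ x, HasDerivAt (fun s => Q * flow B s) (B * (Q * flow B x)) x := fun x => by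
    have := (hasDerivAt_flow B x).const_mul Q
    rwa [← mul_assoc, hQ.eq, mul_assoc] at this
  have h2 := eq_solutionOperator_mul continuous_const h x
  simp only [flow_zero, mul_one] at h2
  exact h2

theorem flow_nat_mul (h : ℝ) (k : ℕ) : flow B h ^ k = flow B (k * h) := by
  induction k with
  | zero => simp [flow_zero]
  | succ k ih => rw [pow_succ, ih, ← flow_add]; push_cast; ring_nf

theorem propagator_const (x y : ℝ) : propagator (fun _ => B) x y = flow B (x - y) := by
  have h1 : (solutionOperator (fun _ => B) y)⁻¹ = flow B (-y) :=
    Matrix.inv_eq_left_inv (flow_neg_mul B y)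
  rw [propagator, h1, sub_eq_add_neg, flow_add]
  rfl

theorem isUnit_det_flow (x : ℝ) : IsUnit (flow B x).det :=
  isUnit_det_solutionOperator continuous_const x

theorem norm_flow_le {L : ℝ} (hB : ‖B‖ ≤ L) {x : ℝ} (hx : 0 ≤ x) :
    ‖flow B x‖ ≤ Real.exp (L * x) := by
  have := norm_propagator_le (a := fun _ => B) continuous_const hx (fun _ _ => hB)
  rwa [propagator_const, sub_zero] at this

theorem flow_neg (x : ℝ) : flow (-B) x = flow B (-x) := by
  have h : ∀ x, HasDerivAt (fun s => flow B (-s)) ((-B) * flow B (-x)) x := fun x => by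
    have := (hasDerivAt_flow B (-x)).scomp x (hasDerivAt_neg x)
    refine this.congr_deriv ?_
    rw [neg_one_smul, neg_mul]
  have h2 := eq_solutionOperator_mul continuous_const h x
  simp only [neg_zero, flow_zero, mul_one] at h2
  exact h2.symm

end Flow

/-! ### Growth on sums of generalized eigenspaces. -/

/-- The constant in the growth bound for solutions annihilated by a product of `d` factors
`T - μ`, when `‖T‖, |μ| ≤ L`. -/
noncomputable def growthConst (L : ℝ) : ℕ → ℝ
  | 0 => 0
  | d + 1 => 1 + 2 * L * growthConst L d

theorem growthConst_nonneg {L : ℝ} (hL : 0 ≤ L) (d : ℕ) : 0 ≤ growthConst L d := by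
  induction d with
  | zero => exact le_rfl
  | succ d ih => simp only [growthConst]; positivity

theorem growthConst_mono {L : ℝ} (hL : 0 ≤ L) : Monotone (growthConst L) := by
  refine monotone_nat_of_le_succ fun d => ?_
  induction d with
  | zero => simp [growthConst]
  | succ d ih =>
    simp only [growthConst] at ih ⊢
    gcongr

/-- Peeling off the last factor, `w = (T - μ) v` is annihilated by a shorter product, and `e^{-μ s}
U s v` has derivative `e^{-μ s} U s w`. The constants depend only on `L` and on the number of
factors, never on a basis or on the conditioning of eigenvectors; this is what makes the dichotomies
uniform. -/
theorem norm_evolution_le {V : Type*} [NormedAddCommGroup V] [NormedSpace ℝ V] [NormedSpace ℂ V]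
    [IsScalarTower ℝ ℂ V] {T : Module.End ℂ V} {U : ℝ → Module.End ℂ V} {L r : ℝ} (hL : 0 ≤ L)
    (hT : ∀ v, ‖T v‖ ≤ L * ‖v‖) (hU0 : ∀ v, U 0 v = v)
    (hU : ∀ v x, HasDerivAt (fun s => U s v) (U x (T v)) x)
    (l : List ℂ) (hl : ∀ μ ∈ l, μ.re ≤ r ∧ ‖μ‖ ≤ L) (v : V)
    (hv : (l.map fun μ => T - algebraMap ℂ (Module.End ℂ V) μ).prod v = 0) {x : ℝ} (hx : 0 ≤ x) :
    ‖U x v‖ ≤ growthConst L l.length * (1 + x) ^ l.length * Real.exp (r * x) * ‖v‖ := by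
  induction l using List.reverseRecOn generalizing v x with
  | nil =>
    have : v = 0 := by simpa using hv
    simp [this]
  | append_singleton l μ ih =>
    have hμ := hl μ (by simp)
    set w := (T - algebraMap ℂ (Module.End ℂ V) μ) v with hw
    have hw' : (l.map fun μ => T - algebraMap ℂ (Module.End ℂ V) μ).prod w = 0 := by
      rw [List.map_append, List.prod_append, List.map_singleton, List.prod_singleton,
        Module.End.mul_apply] at hv
      exact hv
    have hwv : w = T v - μ • v := by simp [hw, Module.algebraMap_end_apply]
    have hwn : ‖w‖ ≤ 2 * L * ‖v‖ := by
      rw [hwv]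
      refine (norm_sub_le _ _).trans ?_
      rw [norm_smul]
      have := mul_le_mul_of_nonneg_right hμ.2 (norm_nonneg v)
      linarith [hT v]
    have ihw := fun {x : ℝ} (hx : 0 ≤ x) =>
      ih (fun μ' h => hl μ' (by simp [h])) w hw' (x := x) hx
    set K := growthConst L l.length
    have hK : 0 ≤ K := growthConst_nonneg hL _
    set d := l.length
    have hder : ∀ s : ℝ, HasDerivAt (fun s : ℝ => Complex.exp (-μ * s) • U s v)
        (Complex.exp (-μ * s) • U s w) s := fun s => by
      have h1 : HasDerivAt (fun s : ℝ => Complex.exp (-μ * s)) (Complex.exp (-μ * s) * (-μ)) s := by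
        have := ((hasDerivAt_id (s : ℂ)).const_mul (-μ)).cexp.comp_ofReal
        simpa using this
      refine (h1.smul (hU v s)).congr_deriv ?_
      rw [hwv, map_sub, map_smul, smul_sub, mul_smul, neg_smul, smul_neg]
      abel
    have hbd : ∀ s ∈ Set.Ico 0 x, ‖Complex.exp (-μ * s) • U s w‖ ≤
        K * (1 + x) ^ d * Real.exp ((r - μ.re) * x) * ‖w‖ := fun s hs => by
      rw [norm_smul, Complex.norm_exp]
      have h1 : (-μ * (s : ℂ)).re = -μ.re * s := by simp
      rw [h1]
      have h2 : Real.exp ((r - μ.re) * s) ≤ Real.exp ((r - μ.re) * x) :=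
        Real.exp_le_exp.2 (mul_le_mul_of_nonneg_left hs.2.le (by linarith [hμ.1]))
      have h3 : (1 + s) ^ d ≤ (1 + x) ^ d :=
        pow_le_pow_left₀ (by linarith [hs.1]) (by linarith [hs.2]) _
      calc Real.exp (-μ.re * s) * ‖U s w‖
          ≤ Real.exp (-μ.re * s) * (K * (1 + s) ^ d * Real.exp (r * s) * ‖w‖) := by
            gcongr; exact ihw hs.1
        _ = K * (1 + s) ^ d * Real.exp ((r - μ.re) * s) * ‖w‖ := by
            rw [sub_mul, sub_eq_add_neg, Real.exp_add]; ring_nf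
        _ ≤ _ := by
            have : 0 ≤ (1 + s) ^ d := pow_nonneg (by linarith [hs.1]) _
            gcongr
    have hmv := norm_image_sub_le_of_norm_deriv_le_segment'
      (fun s _ => (hder s).hasDerivWithinAt) hbd x (Set.right_mem_Icc.2 hx)
    simp only [Complex.ofReal_zero, mul_zero, Complex.exp_zero, one_smul, hU0, sub_zero] at hmv
    have h4 : U x v = Complex.exp (μ * x) • (v + (Complex.exp (-μ * x) • U x v - v)) := by
      rw [add_sub_cancel, smul_smul, ← Complex.exp_add, neg_mul, add_neg_cancel, Complex.exp_zero,
        one_smul]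
    rw [h4, norm_smul, Complex.norm_exp]
    have h5 : (μ * (x : ℂ)).re = μ.re * x := by simp
    rw [h5]
    have hx1 : (1 : ℝ) ≤ (1 + x) ^ (d + 1) := one_le_pow₀ (by linarith)
    have h6 : Real.exp (μ.re * x) ≤ Real.exp (r * x) :=
      Real.exp_le_exp.2 (mul_le_mul_of_nonneg_right hμ.1 hx)
    have hlen : (l ++ [μ]).length = d + 1 := by simp [d]
    rw [hlen]
    calc Real.exp (μ.re * x) * ‖v + (Complex.exp (-μ * x) • U x v - v)‖
        ≤ Real.exp (μ.re * x) *
          (‖v‖ + K * (1 + x) ^ d * Real.exp ((r - μ.re) * x) * (2 * L * ‖v‖) * (1 + x)) := by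
          gcongr
          refine (norm_add_le _ _).trans (add_le_add le_rfl (hmv.trans ?_))
          have : 0 ≤ K * (1 + x) ^ d * Real.exp ((r - μ.re) * x) := by positivity
          gcongr
          linarith
      _ = Real.exp (μ.re * x) * ‖v‖ + 2 * L * K * (1 + x) ^ (d + 1) *
            (Real.exp (μ.re * x) * Real.exp ((r - μ.re) * x)) * ‖v‖ := by ring
      _ ≤ Real.exp (r * x) * ‖v‖ * (1 + x) ^ (d + 1) + 2 * L * K * (1 + x) ^ (d + 1) *
            Real.exp (r * x) * ‖v‖ := by
          rw [← Real.exp_add]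
          have : μ.re * x + (r - μ.re) * x = r * x := by ring
          rw [this]
          refine add_le_add ?_ le_rfl
          calc Real.exp (μ.re * x) * ‖v‖ ≤ Real.exp (r * x) * ‖v‖ := by gcongr
            _ ≤ _ := le_mul_of_one_le_right (by positivity) hx1
      _ = _ := by simp only [growthConst, K, d]; ring

/-- Vectors in a sum of generalized eigenspaces are annihilated by a product of factors `T - μ`
of controlled length. -/
theorem exists_list_annihilating {V : Type*} [AddCommGroup V] [Module ℂ V] [FiniteDimensional ℂ V]
    (T : Module.End ℂ V) (p : ℂ → Prop) :
    ∃ l : List ℂ, l.length ≤ Module.finrank ℂ V * Module.finrank ℂ V ∧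
      (∀ μ ∈ l, p μ ∧ T.HasEigenvalue μ) ∧
      ∀ v ∈ ⨆ μ : ℂ, ⨆ _ : p μ, T.maxGenEigenspace μ,
        (l.map fun μ => T - algebraMap ℂ (Module.End ℂ V) μ).prod v = 0 := by
  classical
  set d := Module.finrank ℂ V
  set s : Finset ℂ := T.charpoly.roots.toFinset.filter p
  have hmem : ∀ μ, μ ∈ s ↔ p μ ∧ T.HasEigenvalue μ := fun μ => by
    simp only [s, Finset.mem_filter, Multiset.mem_toFinset,
      Polynomial.mem_roots T.charpoly_monic.ne_zero, Module.End.hasEigenvalue_iff_isRoot_charpoly]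
    tauto
  have hcard : s.card ≤ d := by
    refine (Finset.card_filter_le _ _).trans ((Multiset.toFinset_card_le _).trans ?_)
    refine (Polynomial.card_roots' _).trans ?_
    rw [LinearMap.charpoly_natDegree]
  -- Each selected eigenvalue is listed `d` times, `d` being the dimension: that power annihilates
  -- its generalized eigenspace whatever the actual multiplicity.
  refine ⟨(List.replicate d s.toList).flatten, ?_, ?_, ?_⟩
  · simp only [List.length_flatten, List.map_replicate, List.sum_replicate, Finset.length_toList,
      smul_eq_mul]
    exact Nat.mul_le_mul_left _ hcard
  · intro μ hμ
    simp only [List.mem_flatten, List.mem_replicate] at hμ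
    obtain ⟨l, ⟨_, rfl⟩, h⟩ := hμ
    exact (hmem μ).1 (Finset.mem_toList.1 h)
  · set f : ℂ → Module.End ℂ V := fun μ => T - algebraMap ℂ (Module.End ℂ V) μ with hf
    have hcomm : ∀ μ ν, Commute (f μ) (f ν) := fun μ ν =>
      (((Commute.refl T).sub_right (Algebra.commutes ν T).symm).sub_left
        (Algebra.commute_algebraMap_left μ _))
    have hprod : (((List.replicate d s.toList).flatten).map f).prod = (s.toList.map f).prod ^ d := by
      simp [List.map_flatten, List.prod_flatten]
    rw [hprod]
    intro v hv
    suffices h : ∀ μ, p μ → T.maxGenEigenspace μ ≤ LinearMap.ker ((s.toList.map f).prod ^ d) by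
      exact (iSup_le fun μ => iSup_le fun hμ => h μ hμ :
        (⨆ μ : ℂ, ⨆ _ : p μ, T.maxGenEigenspace μ) ≤ _) hv
    intro μ hp
    by_cases hμ : T.HasEigenvalue μ
    · intro w hw
      rw [Module.End.maxGenEigenspace_eq_genEigenspace_finrank, Module.End.mem_genEigenspace_nat,
        LinearMap.mem_ker] at hw
      have hms : μ ∈ s.toList := Finset.mem_toList.2 ((hmem μ).2 ⟨hp, hμ⟩)
      have hperm := (List.perm_cons_erase hms).map f
      have hprod2 : (s.toList.map f).prod = ((s.toList.erase μ).map f).prod * f μ := by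
        rw [hperm.prod_eq' ?_, List.map_cons, List.prod_cons]
        · refine (Commute.list_prod_right _ _ ?_).eq
          intro x hx
          obtain ⟨ν, _, rfl⟩ := List.mem_map.1 hx
          exact hcomm _ _
        · rw [List.pairwise_map]
          exact List.pairwise_of_forall fun _ _ => hcomm _ _
      have hc : Commute ((s.toList.erase μ).map f).prod (f μ) := by
        refine Commute.list_prod_left _ _ ?_
        intro x hx
        obtain ⟨ν, _, rfl⟩ := List.mem_map.1 hx
        exact hcomm _ _
      rw [LinearMap.mem_ker, hprod2, hc.mul_pow, Module.End.mul_apply]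
      have : (f μ ^ d) w = 0 := hw
      rw [this, map_zero]
    · have : T.maxGenEigenspace μ = ⊥ := by
        by_contra h
        exact hμ (Module.End.HasUnifEigenvalue.lt zero_lt_one h)
      rw [this]
      exact bot_le

/-- A single term of the exponential series at `δ (1 + x)` suffices. This trades the polynomial
factor for a slightly worse exponent. -/
theorem one_add_pow_le_exp {δ : ℝ} (hδ : 0 < δ) (D : ℕ) {x : ℝ} (hx : 0 ≤ x) :
    (1 + x) ^ D ≤ (D.factorial / δ ^ D * Real.exp δ) * Real.exp (δ * x) := by
  have h := Real.pow_div_factorial_le_exp (x := δ * (1 + x)) (by positivity) D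
  rw [div_le_iff₀ (by positivity), mul_pow] at h
  have h2 : (1 + x) ^ D ≤ Real.exp (δ * (1 + x)) * D.factorial / δ ^ D := by
    rw [le_div_iff₀ (by positivity)]
    linarith
  refine h2.trans_eq ?_
  rw [mul_add, Real.exp_add, mul_one]
  ring

section Evolution

variable {V : Type*} [NormedAddCommGroup V] [NormedSpace ℝ V] [NormedSpace ℂ V]
  [IsScalarTower ℝ ℂ V] [FiniteDimensional ℂ V]

/-- Uniform growth bound on the sum of the generalized eigenspaces with `p μ`. -/
theorem exists_norm_evolution_iSup_le (V : Type*) [NormedAddCommGroup V] [NormedSpace ℝ V]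
    [NormedSpace ℂ V] [IsScalarTower ℝ ℂ V] [FiniteDimensional ℂ V]
    {L r r' : ℝ} (hL : 0 ≤ L) (hr : r < r') :
    ∃ K : ℝ, 0 ≤ K ∧ ∀ (T : Module.End ℂ V) (U : ℝ → Module.End ℂ V),
      (∀ v, ‖T v‖ ≤ L * ‖v‖) → (∀ v, U 0 v = v) →
      (∀ v x, HasDerivAt (fun s => U s v) (U x (T v)) x) →
      ∀ p : ℂ → Prop, (∀ μ, p μ → T.HasEigenvalue μ → μ.re ≤ r) →
      ∀ v ∈ ⨆ μ : ℂ, ⨆ _ : p μ, T.maxGenEigenspace μ, ∀ x, 0 ≤ x →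
        ‖U x v‖ ≤ K * Real.exp (r' * x) * ‖v‖ := by
  set D := Module.finrank ℂ V * Module.finrank ℂ V
  set c := D.factorial / (r' - r) ^ D * Real.exp (r' - r)
  have hδ : 0 < r' - r := sub_pos.2 hr
  have hc : 0 ≤ c := by positivity
  have hG := growthConst_nonneg hL D
  refine ⟨growthConst L D * c, by positivity, fun T U hT hU0 hU p hp v hv x hx => ?_⟩
  obtain ⟨l, hlen, hl, hann⟩ := exists_list_annihilating T p
  have hl' : ∀ μ ∈ l, μ.re ≤ r ∧ ‖μ‖ ≤ L := fun μ hμ => by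
    obtain ⟨h1, h2⟩ := hl μ hμ
    refine ⟨hp μ h1 h2, ?_⟩
    obtain ⟨w, hw⟩ := h2.exists_hasEigenvector
    have h3 := hT w
    rw [hw.apply_eq_smul, norm_smul] at h3
    exact le_of_mul_le_mul_right h3 (norm_pos_iff.2 hw.2)
  refine (norm_evolution_le hL hT hU0 hU l hl' v (hann v hv) hx).trans ?_
  have h1 : growthConst L l.length ≤ growthConst L D := growthConst_mono hL hlen
  have h2 : (1 + x) ^ l.length ≤ (1 + x) ^ D := pow_le_pow_right₀ (by linarith) hlen
  calc growthConst L l.length * (1 + x) ^ l.length * Real.exp (r * x) * ‖v‖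
      ≤ growthConst L D * (c * Real.exp ((r' - r) * x)) * Real.exp (r * x) * ‖v‖ := by
        gcongr
        exact h2.trans (one_add_pow_le_exp hδ D hx)
    _ = growthConst L D * c * (Real.exp ((r' - r) * x) * Real.exp (r * x)) * ‖v‖ := by ring
    _ = _ := by rw [← Real.exp_add]; ring_nf

theorem maxGenEigenspace_neg {V : Type*} [AddCommGroup V] [Module ℂ V] (T : Module.End ℂ V)
    (μ : ℂ) : (-T).maxGenEigenspace (-μ) = T.maxGenEigenspace μ := by
  ext v
  simp only [Module.End.mem_maxGenEigenspace]
  refine exists_congr fun k => ?_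
  have h : -T - (-μ) • (1 : Module.End ℂ V) = -(T - μ • 1) := by
    rw [neg_smul]
    abel
  rw [h, neg_pow]
  rcases neg_one_pow_eq_or (Module.End ℂ V) k with h | h <;> simp [h]

theorem iSup_maxGenEigenspace_neg {V : Type*} [AddCommGroup V] [Module ℂ V]
    (T : Module.End ℂ V) (p : ℂ → Prop) :
    ⨆ μ : ℂ, ⨆ _ : p (-μ), (-T).maxGenEigenspace μ = ⨆ μ : ℂ, ⨆ _ : p μ, T.maxGenEigenspace μ := by
  refine (Equiv.neg ℂ).iSup_congr fun μ => ?_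
  simp only [Equiv.neg_apply]
  rw [← maxGenEigenspace_neg T (-μ), neg_neg]

theorem hasEigenvalue_neg {V : Type*} [AddCommGroup V] [Module ℂ V] {T : Module.End ℂ V} {μ : ℂ}
    (h : (-T).HasEigenvalue μ) : T.HasEigenvalue (-μ) := by
  obtain ⟨v, hv⟩ := h.exists_hasEigenvector
  refine Module.End.hasEigenvalue_of_hasEigenvector (x := v) ⟨?_, hv.2⟩
  rw [Module.End.mem_eigenspace_iff]
  have := hv.apply_eq_smul
  rw [LinearMap.neg_apply] at this
  rw [neg_smul, ← this, neg_neg]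

theorem isCompl_iSup_maxGenEigenspace {V : Type*} [AddCommGroup V] [Module ℂ V]
    [FiniteDimensional ℂ V] (T : Module.End ℂ V) (p q : ℂ → Prop)
    (hpq : ∀ μ, ¬ (p μ ∧ q μ)) (hT : ∀ μ, T.HasEigenvalue μ → p μ ∨ q μ) :
    IsCompl (⨆ μ : ℂ, ⨆ _ : p μ, T.maxGenEigenspace μ)
      (⨆ μ : ℂ, ⨆ _ : q μ, T.maxGenEigenspace μ) := by
  constructor
  · exact T.independent_maxGenEigenspace.disjoint_biSup_biSup (s := {μ | p μ}) (t := {μ | q μ})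
      (Set.disjoint_left.2 fun μ h1 h2 => hpq μ ⟨h1, h2⟩)
  · rw [codisjoint_iff, eq_top_iff, ← T.iSup_maxGenEigenspace_eq_top]
    refine iSup_le fun μ => ?_
    by_cases hμ : T.HasEigenvalue μ
    · rcases hT μ hμ with h | h
      · exact le_sup_of_le_left (le_iSup₂_of_le μ h le_rfl)
      · exact le_sup_of_le_right (le_iSup₂_of_le μ h le_rfl)
    · have : T.maxGenEigenspace μ = ⊥ := by
        by_contra h
        exact hμ (Module.End.HasUnifEigenvalue.lt zero_lt_one h)
      rw [this]
      exact bot_le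

theorem iSup_maxGenEigenspace_invariant {V : Type*} [AddCommGroup V] [Module ℂ V]
    (T : Module.End ℂ V) (p : ℂ → Prop) :
    ∀ v ∈ ⨆ μ : ℂ, ⨆ _ : p μ, T.maxGenEigenspace μ,
      T v ∈ ⨆ μ : ℂ, ⨆ _ : p μ, T.maxGenEigenspace μ := by
  suffices h : (⨆ μ : ℂ, ⨆ _ : p μ, T.maxGenEigenspace μ) ≤
      (⨆ μ : ℂ, ⨆ _ : p μ, T.maxGenEigenspace μ).comap T from fun v hv => h hv
  refine iSup₂_le fun μ hμ v hv => ?_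
  exact (le_iSup₂_of_le (f := fun μ (_ : p μ) => T.maxGenEigenspace μ) μ hμ le_rfl)
    (Module.End.mapsTo_maxGenEigenspace_of_comm (Commute.refl T) μ hv)

/-- The projection onto an invariant subspace along an invariant complement commutes. -/
theorem projection_commute {V : Type*} [AddCommGroup V] [Module ℂ V] {T : Module.End ℂ V}
    {E F : Submodule ℂ V} (h : IsCompl E F) (hE : ∀ v ∈ E, T v ∈ E) (hF : ∀ v ∈ F, T v ∈ F)
    (v : V) : E.projection F h (T v) = T (E.projection F h v) := by
  have h1 : T v = T (E.projection F h v) + T (v - E.projection F h v) := by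
    rw [← map_add, add_sub_cancel]
  rw [h1, map_add,
    Submodule.projection_apply_of_mem_left h (hE _ (Submodule.projection_apply_mem h v)),
    (Submodule.projection_apply_eq_zero_iff h).2 (hF _ (Submodule.sub_projection_mem h v)), add_zero]

end Evolution

/-! ### Uniform exponential dichotomies of hyperbolic matrices. -/

/-- `Qs`, `Qu` are the spectral projections of a hyperbolic matrix `B` onto its stable and unstable
subspaces, and the flow decays at rate `g` on them. -/
structure IsDichotomy {n : ℕ} (B Qs Qu : CMat n) (c g : ℝ) : Prop where
  add : Qs + Qu = 1
  mul_su : Qs * Qu = 0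
  mul_us : Qu * Qs = 0
  comm_s : Commute Qs B
  comm_u : Commute Qu B
  mem_s : ∀ v, Qs.mulVec v ∈ stableSubspace B
  mem_u : ∀ v, Qu.mulVec v ∈ unstableSubspace B
  eq_s : ∀ v ∈ stableSubspace B, Qs.mulVec v = v
  eq_u : ∀ v ∈ unstableSubspace B, Qu.mulVec v = v
  bound_s : ∀ x, 0 ≤ x → ‖flow B x * Qs‖ ≤ c * Real.exp (-g * x)
  bound_u : ∀ x, 0 ≤ x → ‖flow B (-x) * Qu‖ ≤ c * Real.exp (-g * x)

theorem hasDerivAt_flow_mulVec {n : ℕ} (B : CMat n) (v : Fin n → ℂ) (x : ℝ) :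
    HasDerivAt (fun s => (flow B s).mulVec v) ((flow B x).mulVec (B.mulVec v)) x := by
  have h := hasDerivAt_solutionOperator_mulVec (a := fun _ => B) continuous_const v x
  rw [Matrix.mulVec_mulVec] at h ⊢
  exact h.congr_deriv (by rw [← (flow_commute (Commute.refl B) x).eq]; rfl)

theorem norm_matrix_le_of_mulVec {n : ℕ} (A : CMat n) {C : ℝ} (hC : 0 ≤ C)
    (h : ∀ v, ‖A.mulVec v‖ ≤ C * ‖v‖) : ‖A‖ ≤ C := by
  rw [Matrix.linfty_opNorm_eq_opNorm]
  exact ContinuousLinearMap.opNorm_le_bound _ hC h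

/-- Time reversal: estimates on the unstable subspace are those on the stable subspace of `-B`. -/
theorem unstableSubspace_eq {n : ℕ} (B : CMat n) : unstableSubspace B = stableSubspace (-B) := by
  have h := iSup_maxGenEigenspace_neg (Matrix.toLin' B) (fun μ => 0 < μ.re)
  simp only [Complex.neg_re, Left.neg_pos_iff] at h
  rw [unstableSubspace, ← h, stableSubspace, map_neg]

theorem hasEigenvalue_toLin'_iff {n : ℕ} (B : CMat n) (μ : ℂ) :
    Module.End.HasEigenvalue (Matrix.toLin' B) μ ↔ μ ∈ spectrum ℂ B := by
  rw [Module.End.hasEigenvalue_iff_mem_spectrum, Matrix.spectrum_toLin']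

/-- On the stable subspace the flow decays, uniformly in bounded sets of matrices. -/
theorem exists_flow_stable_bound (n : ℕ) {L g g' : ℝ} (hL : 0 ≤ L) (hg : g < g') :
    ∃ K : ℝ, 0 ≤ K ∧ ∀ B : CMat n, ‖B‖ ≤ L → (∀ μ ∈ spectrum ℂ B, g' ≤ |μ.re|) →
      ∀ v ∈ stableSubspace B, ∀ x, 0 ≤ x →
        ‖(flow B x).mulVec v‖ ≤ K * Real.exp (-g * x) * ‖v‖ := by
  obtain ⟨K, hK, h⟩ := exists_norm_evolution_iSup_le (Fin n → ℂ) hL (neg_lt_neg hg)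
  refine ⟨K, hK, fun B hB hspec v hv x hx => ?_⟩
  refine h (Matrix.toLin' B) (fun x => Matrix.toLin' (flow B x)) (fun v => ?_) (fun v => ?_)
    (fun v x => ?_) (fun μ => μ.re < 0) (fun μ hμ hev => ?_) v hv x hx
  · exact (Matrix.linfty_opNorm_mulVec B v).trans (mul_le_mul_of_nonneg_right hB (norm_nonneg _))
  · simp [flow_zero]
  · exact hasDerivAt_flow_mulVec B v x
  · have := hspec μ ((hasEigenvalue_toLin'_iff B μ).1 hev)
    rw [abs_of_neg hμ] at this
    linarith

theorem spectrum_neg_re {n : ℕ} {B : CMat n} {g' : ℝ} (h : ∀ μ ∈ spectrum ℂ B, g' ≤ |μ.re|) :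
    ∀ μ ∈ spectrum ℂ (-B), g' ≤ |μ.re| := fun μ hμ => by
  have h1 : -μ ∈ spectrum ℂ B := by
    rw [← hasEigenvalue_toLin'_iff] at hμ ⊢
    rw [map_neg (Matrix.toLin' (R := ℂ)) B] at hμ
    exact hasEigenvalue_neg hμ
  simpa using h _ h1

/-- The decay on each subspace is already uniform; the remaining point is a bound for the spectral
projections that depends only on `n`, `L`, `g` and `g'`. It is read off from the flow at one fixed
time, without contour integrals. -/
theorem exists_dichotomy (n : ℕ) {L g g' : ℝ} (hL : 0 ≤ L) (hg0 : 0 < g) (hg : g < g') :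
    ∃ c : ℝ, 0 < c ∧ ∀ B : CMat n, ‖B‖ ≤ L → (∀ μ ∈ spectrum ℂ B, g' ≤ |μ.re|) →
      ∃ Qs Qu, IsDichotomy B Qs Qu c g := by
  obtain ⟨K, hK, hdecay⟩ := exists_flow_stable_bound n hL hg
  -- After time `N` the flow contracts the stable subspace, and its inverse the unstable one, by a
  -- factor `1/4`.
  obtain ⟨N, hN0, hN⟩ : ∃ N : ℝ, 0 ≤ N ∧ K * Real.exp (-g * N) ≤ 1 / 4 := by
    have h1 : Filter.Tendsto (fun x : ℝ => K * Real.exp (-g * x)) Filter.atTop (nhds (K * 0)) := by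
      refine Filter.Tendsto.const_mul K (Real.tendsto_exp_atBot.comp ?_)
      exact Filter.tendsto_id.const_mul_atTop_of_neg (by linarith)
    rw [mul_zero] at h1
    obtain ⟨N, hN⟩ := ((h1.eventually_le_const (show (0 : ℝ) < 1 / 4 by norm_num)).and
      (Filter.eventually_ge_atTop 0)).exists
    exact ⟨N, hN.2, hN.1⟩
  set q := Real.exp (L * N) + 1
  have hq : 1 ≤ q := by linarith [Real.exp_pos (L * N)]
  refine ⟨K * (1 + q) + 1, by positivity, fun B hB hspec => ?_⟩
  have hdec_s := hdecay B hB hspec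
  have hdec_u : ∀ v ∈ unstableSubspace B, ∀ x, 0 ≤ x →
      ‖(flow B (-x)).mulVec v‖ ≤ K * Real.exp (-g * x) * ‖v‖ := fun v hv x hx => by
    rw [← flow_neg]
    rw [unstableSubspace_eq] at hv
    exact hdecay (-B) (by rwa [norm_neg]) (spectrum_neg_re hspec) v hv x hx
  have hcompl : IsCompl (stableSubspace B) (unstableSubspace B) := by
    refine isCompl_iSup_maxGenEigenspace _ _ _ (fun μ h => lt_asymm h.1 h.2) (fun μ hμ => ?_)
    have := hspec μ ((hasEigenvalue_toLin'_iff B μ).1 hμ)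
    refine lt_or_gt_of_ne fun h0 => ?_
    rw [h0, abs_zero] at this
    linarith
  have hinv_s : ∀ v ∈ stableSubspace B, Matrix.toLin' B v ∈ stableSubspace B :=
    iSup_maxGenEigenspace_invariant _ _
  have hinv_u : ∀ v ∈ unstableSubspace B, Matrix.toLin' B v ∈ unstableSubspace B :=
    iSup_maxGenEigenspace_invariant _ _
  set ps := (stableSubspace B).projection _ hcompl
  set pu := (unstableSubspace B).projection _ hcompl.symm
  set Qs : CMat n := LinearMap.toMatrix' ps
  set Qu : CMat n := LinearMap.toMatrix' pu
  have hQs : ∀ v, Qs.mulVec v = ps v := fun v => LinearMap.toMatrix'_mulVec ps v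
  have hQu : ∀ v, Qu.mulVec v = pu v := fun v => LinearMap.toMatrix'_mulVec pu v
  have hps : ∀ v, Qs.mulVec v ∈ stableSubspace B := fun v => by
    rw [hQs]; exact Submodule.projection_apply_mem hcompl v
  have hpu : ∀ v, Qu.mulVec v ∈ unstableSubspace B := fun v => by
    rw [hQu]; exact Submodule.projection_apply_mem hcompl.symm v
  have hes : ∀ v ∈ stableSubspace B, Qs.mulVec v = v := fun v hv => by
    rw [hQs]; exact Submodule.projection_apply_of_mem_left hcompl hv
  have heu : ∀ v ∈ unstableSubspace B, Qu.mulVec v = v := fun v hv => by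
    rw [hQu]; exact Submodule.projection_apply_of_mem_left hcompl.symm hv
  have hadd : ∀ v, Qs.mulVec v + Qu.mulVec v = v := fun v => by
    rw [hQs, hQu]; exact Submodule.projection_add_projection_eq_self hcompl v
  have hext : ∀ M N : CMat n, (∀ v, M.mulVec v = N.mulVec v) → M = N := fun M N h =>
    (Matrix.toLin' (R := ℂ)).injective (LinearMap.ext h)
  have hcs : Commute Qs B := hext _ _ fun v => by
    rw [← Matrix.mulVec_mulVec, ← Matrix.mulVec_mulVec, hQs, hQs]
    exact projection_commute hcompl hinv_s hinv_u v
  have hcu : Commute Qu B := hext _ _ fun v => by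
    rw [← Matrix.mulVec_mulVec, ← Matrix.mulVec_mulVec, hQu, hQu]
    exact projection_commute hcompl.symm hinv_u hinv_s v
  -- With `u`, `s` the components of `v`: `|u| ≤ |flow B N u| / 4 ≤ (e^{LN} |v| + |s| / 4) / 4` and
  -- `|s| ≤ |v| + |u|`, so `|u|` can be absorbed on the left.
  have hnorm_u : ∀ v, ‖Qu.mulVec v‖ ≤ q * ‖v‖ := fun v => by
    have h1 : (flow B N).mulVec v =
        (flow B N).mulVec (Qs.mulVec v) + (flow B N).mulVec (Qu.mulVec v) := by
      rw [← Matrix.mulVec_add, hadd]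
    have h2 : ‖(flow B N).mulVec v‖ ≤ Real.exp (L * N) * ‖v‖ :=
      (Matrix.linfty_opNorm_mulVec _ _).trans
        (mul_le_mul_of_nonneg_right (norm_flow_le B hB hN0) (norm_nonneg _))
    have h3 : ‖(flow B N).mulVec (Qs.mulVec v)‖ ≤ 1 / 4 * ‖Qs.mulVec v‖ :=
      (hdec_s _ (hps v) N hN0).trans (mul_le_mul_of_nonneg_right hN (norm_nonneg _))
    have h4 : ‖Qu.mulVec v‖ ≤ 1 / 4 * ‖(flow B N).mulVec (Qu.mulVec v)‖ := by
      have hmem : (flow B N).mulVec (Qu.mulVec v) ∈ unstableSubspace B := by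
        rw [Matrix.mulVec_mulVec, ← (flow_commute hcu N).eq, ← Matrix.mulVec_mulVec]
        exact hpu _
      have := hdec_u _ hmem N hN0
      rw [Matrix.mulVec_mulVec _ (flow B (-N)), flow_neg_mul, Matrix.one_mulVec] at this
      exact this.trans (mul_le_mul_of_nonneg_right hN (norm_nonneg _))
    have h5 : ‖(flow B N).mulVec (Qu.mulVec v)‖ ≤
        ‖(flow B N).mulVec v‖ + ‖(flow B N).mulVec (Qs.mulVec v)‖ := by
      rw [h1]
      simpa using norm_sub_le ((flow B N).mulVec (Qs.mulVec v) + (flow B N).mulVec (Qu.mulVec v))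
        ((flow B N).mulVec (Qs.mulVec v))
    have h6 : ‖Qs.mulVec v‖ ≤ ‖v‖ + ‖Qu.mulVec v‖ := by
      have h := norm_sub_le v (Qu.mulVec v)
      rwa [show v - Qu.mulVec v = Qs.mulVec v from by
        rw [sub_eq_iff_eq_add]; exact (hadd v).symm] at h
    have h7 := norm_nonneg v
    have h8 : 0 ≤ Real.exp (L * N) * ‖v‖ := by positivity
    simp only [q]
    linarith
  have hnorm_s : ∀ v, ‖Qs.mulVec v‖ ≤ (1 + q) * ‖v‖ := fun v => by
    have h := norm_sub_le v (Qu.mulVec v)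
    rw [show v - Qu.mulVec v = Qs.mulVec v from by
      rw [sub_eq_iff_eq_add]; exact (hadd v).symm] at h
    linarith [hnorm_u v]
  refine ⟨Qs, Qu, ?_, ?_, ?_, hcs, hcu, hps, hpu, hes, heu, fun x hx => ?_, fun x hx => ?_⟩
  · refine hext _ _ fun v => ?_
    rw [Matrix.add_mulVec, hadd, Matrix.one_mulVec]
  · refine hext _ _ fun v => ?_
    rw [← Matrix.mulVec_mulVec, Matrix.zero_mulVec, hQs]
    exact (Submodule.projection_apply_eq_zero_iff hcompl).2 (hpu v)
  · refine hext _ _ fun v => ?_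
    rw [← Matrix.mulVec_mulVec, Matrix.zero_mulVec, hQu]
    exact (Submodule.projection_apply_eq_zero_iff hcompl.symm).2 (hps v)
  · refine norm_matrix_le_of_mulVec _ (by positivity) fun v => ?_
    rw [← Matrix.mulVec_mulVec]
    refine (hdec_s _ (hps v) x hx).trans ?_
    calc K * Real.exp (-g * x) * ‖Qs.mulVec v‖
        ≤ K * Real.exp (-g * x) * ((1 + q) * ‖v‖) := by gcongr; exact hnorm_s v
      _ = K * (1 + q) * (Real.exp (-g * x) * ‖v‖) := by ring
      _ ≤ (K * (1 + q) + 1) * (Real.exp (-g * x) * ‖v‖) := by gcongr; linarith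
      _ = _ := by ring
  · refine norm_matrix_le_of_mulVec _ (by positivity) fun v => ?_
    rw [← Matrix.mulVec_mulVec]
    refine (hdec_u _ (hpu v) x hx).trans ?_
    calc K * Real.exp (-g * x) * ‖Qu.mulVec v‖
        ≤ K * Real.exp (-g * x) * ((1 + q) * ‖v‖) := by
          gcongr
          exact (hnorm_u v).trans (by gcongr; linarith)
      _ = K * (1 + q) * (Real.exp (-g * x) * ‖v‖) := by ring
      _ ≤ (K * (1 + q) + 1) * (Real.exp (-g * x) * ‖v‖) := by gcongr; linarith
      _ = _ := by ring

/-! ### Splittings and the discrete Green operator for asymptotic solutions. -/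

/-- A one-parameter group with a splitting into a part decaying forwards at rate `κ` and a part
growing backwards at most at rate `κ`. -/
structure IsSplitting {V : Type*} [NormedAddCommGroup V] [NormedSpace ℂ V]
    (U : ℝ → Module.End ℂ V) (P₁ P₂ : Module.End ℂ V) (K κ : ℝ) : Prop where
  add : ∀ v, P₁ v + P₂ v = v
  bound₂ : ∀ x, 0 ≤ x → ∀ v, ‖U x (P₂ v)‖ ≤ K * Real.exp (-κ * x) * ‖v‖
  bound₁ : ∀ x, 0 ≤ x → ∀ v, ‖U (-x) (P₁ v)‖ ≤ K * Real.exp (κ * x) * ‖v‖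

/-- Eigenvalues with negative real part go to `P₂`, all others to `P₁`. Eigenvalues on the imaginary
axis are allowed, as they must be: the commutator with `B`, to which this is applied, annihilates
the identity. -/
theorem exists_splitting {V : Type*} [NormedAddCommGroup V] [NormedSpace ℝ V]
    [NormedSpace ℂ V] [IsScalarTower ℝ ℂ V] [FiniteDimensional ℂ V]
    (T : Module.End ℂ V) (U : ℝ → Module.End ℂ V) (hU0 : ∀ v, U 0 v = v)
    (hU : ∀ v x, HasDerivAt (fun s => U s v) (U x (T v)) x) {ν : ℝ} (hν : 0 < ν) :
    ∃ (P₁ P₂ : Module.End ℂ V) (K κ : ℝ), 0 ≤ K ∧ 0 < κ ∧ 4 * κ ≤ ν ∧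
      IsSplitting U P₁ P₂ K κ := by
  classical
  have hcont : ∀ S : Module.End ℂ V, ∃ C : ℝ, 0 ≤ C ∧ ∀ v, ‖S v‖ ≤ C * ‖v‖ := fun S =>
    ⟨‖LinearMap.toContinuousLinearMap S‖, norm_nonneg _,
      fun v => (LinearMap.toContinuousLinearMap S).le_opNorm v⟩
  obtain ⟨L, hL, hT⟩ := hcont T
  obtain ⟨κ, hκ, hκν, hgap⟩ : ∃ κ : ℝ, 0 < κ ∧ 4 * κ ≤ ν ∧
      ∀ μ, μ.re < 0 → T.HasEigenvalue μ → μ.re ≤ -(2 * κ) := by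
    set s := (T.charpoly.roots.toFinset.filter fun μ => μ.re < 0).image fun μ => -μ.re / 2
    have hs : ∀ x ∈ insert (ν / 4) s, 0 < x := by
      intro x hx
      rcases Finset.mem_insert.1 hx with rfl | hx
      · positivity
      · obtain ⟨μ, hμ, rfl⟩ := Finset.mem_image.1 hx
        have := (Finset.mem_filter.1 hμ).2
        linarith
    -- Including `ν / 4` keeps the set nonempty and forces `4 κ ≤ ν`; the halves of the spectral
    -- distances leave room between `-2 κ` and `-κ` for polynomial factors.
    obtain ⟨κ, hκs, hmin⟩ := (insert (ν / 4) s).exists_min_image id ⟨_, Finset.mem_insert_self _ _⟩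
    refine ⟨κ, hs κ hκs, ?_, fun μ hμ hev => ?_⟩
    · have := hmin _ (Finset.mem_insert_self _ _)
      simp only [id] at this
      linarith
    · have : -μ.re / 2 ∈ s := Finset.mem_image.2 ⟨μ, Finset.mem_filter.2 ⟨?_, hμ⟩, rfl⟩
      · have := hmin _ (Finset.mem_insert_of_mem this)
        simp only [id] at this
        linarith
      · rw [Multiset.mem_toFinset, Polynomial.mem_roots T.charpoly_monic.ne_zero]
        exact (Module.End.hasEigenvalue_iff_isRoot_charpoly T μ).1 hev
  have hcompl := isCompl_iSup_maxGenEigenspace T (fun μ => ¬ μ.re < 0) (fun μ => μ.re < 0)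
    (fun μ h => h.1 h.2) (fun μ _ => (em _).symm)
  obtain ⟨K₂, hK₂, h₂⟩ := exists_norm_evolution_iSup_le V hL
    (show -(2 * κ) < -κ by linarith)
  obtain ⟨K₁, hK₁, h₁⟩ := exists_norm_evolution_iSup_le V hL hκ
  set P₁ := Submodule.projection _ _ hcompl
  set P₂ := Submodule.projection _ _ hcompl.symm
  obtain ⟨C₁, hC₁, hP₁⟩ := hcont P₁
  obtain ⟨C₂, hC₂, hP₂⟩ := hcont P₂
  refine ⟨P₁, P₂, K₁ * C₁ + K₂ * C₂, κ, by positivity, hκ, hκν,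
    Submodule.projection_add_projection_eq_self hcompl, fun x hx v => ?_, fun x hx v => ?_⟩
  · refine (h₂ T U hT hU0 hU (fun μ => μ.re < 0) hgap (P₂ v)
      (Submodule.projection_apply_mem hcompl.symm v) x hx).trans ?_
    calc K₂ * Real.exp (-κ * x) * ‖P₂ v‖ ≤ K₂ * Real.exp (-κ * x) * (C₂ * ‖v‖) := by
          gcongr; exact hP₂ v
      _ = K₂ * C₂ * (Real.exp (-κ * x) * ‖v‖) := by ring
      _ ≤ (K₁ * C₁ + K₂ * C₂) * (Real.exp (-κ * x) * ‖v‖) := by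
          gcongr
          have : 0 ≤ K₁ * C₁ := by positivity
          linarith
      _ = _ := by ring
  · have hmem : P₁ v ∈ ⨆ μ : ℂ, ⨆ _ : ¬ (-μ).re < 0, (-T).maxGenEigenspace μ := by
      rw [iSup_maxGenEigenspace_neg T fun μ => ¬ μ.re < 0]
      exact Submodule.projection_apply_mem hcompl v
    refine (h₁ (-T) (fun x => U (-x)) (fun v => by simpa using hT v) (by simpa using hU0)
      (fun v x => ?_) (fun μ => ¬ (-μ).re < 0) (fun μ hμ _ => ?_) (P₁ v) hmem x hx).trans ?_
    · refine ((hU v (-x)).scomp x (hasDerivAt_neg x)).congr_deriv ?_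
      simp
    · simpa using hμ
    · calc K₁ * Real.exp (κ * x) * ‖P₁ v‖ ≤ K₁ * Real.exp (κ * x) * (C₁ * ‖v‖) := by
            gcongr; exact hP₁ v
        _ = K₁ * C₁ * (Real.exp (κ * x) * ‖v‖) := by ring
        _ ≤ (K₁ * C₁ + K₂ * C₂) * (Real.exp (κ * x) * ‖v‖) := by
            gcongr
            have : 0 ≤ K₂ * C₂ := by positivity
            linarith
        _ = _ := by ring

section DiscreteGreen

variable {V : Type*} [NormedAddCommGroup V] [NormedSpace ℂ V]
  {U : ℝ → Module.End ℂ V} {P₁ P₂ : Module.End ℂ V} {K κ ν F : ℝ}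

/-- The bounded solution of `u (i+1) = U 1 (u i) + f i` determined by a splitting. -/
noncomputable def discreteGreen (U : ℝ → Module.End ℂ V) (P₁ P₂ : Module.End ℂ V) (f : ℕ → V)
    (i : ℕ) : V :=
  (∑ k ∈ Finset.range i, U ((i : ℝ) - 1 - k) (P₂ (f k))) -
    ∑' k : ℕ, U (-((k : ℝ) + 1)) (P₁ (f (i + k)))

theorem norm_green_tail_le (h : IsSplitting U P₁ P₂ K κ) (hK : 0 ≤ K)
    {f : ℕ → V} (hf : ∀ k : ℕ, ‖f k‖ ≤ F * Real.exp (-ν * k)) (i k : ℕ) :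
    ‖U (-((k : ℝ) + 1)) (P₁ (f (i + k)))‖ ≤
      K * F * Real.exp κ * Real.exp (-ν * i) * Real.exp (-(ν - κ)) ^ k := by
  refine (h.bound₁ _ (by positivity) _).trans ?_
  calc K * Real.exp (κ * ((k : ℝ) + 1)) * ‖f (i + k)‖
      ≤ K * Real.exp (κ * ((k : ℝ) + 1)) * (F * Real.exp (-ν * (i + k : ℕ))) := by
        gcongr; exact hf _
    _ = K * F * (Real.exp (κ * ((k : ℝ) + 1)) * Real.exp (-ν * (i + k : ℕ))) := by ring
    _ = K * F * (Real.exp κ * (Real.exp (-ν * i) * Real.exp (-(ν - κ)) ^ k)) := by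
        rw [← Real.exp_nat_mul, ← Real.exp_add, ← Real.exp_add, ← Real.exp_add]
        congr 2
        push_cast
        ring
    _ = _ := by ring

theorem exp_neg_lt_one {x : ℝ} (hx : 0 < x) : Real.exp (-x) < 1 := by
  rw [Real.exp_lt_one_iff]
  linarith

theorem summable_green_tail [CompleteSpace V] (h : IsSplitting U P₁ P₂ K κ) (hK : 0 ≤ K)
    (hκν : κ < ν) {f : ℕ → V} (hf : ∀ k : ℕ, ‖f k‖ ≤ F * Real.exp (-ν * k)) (i : ℕ) :
    Summable fun k : ℕ => U (-((k : ℝ) + 1)) (P₁ (f (i + k))) :=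
  Summable.of_norm_bounded ((summable_geometric_of_lt_one (Real.exp_pos _).le
    (exp_neg_lt_one (sub_pos.2 hκν))).mul_left _) (norm_green_tail_le h hK hf i)

/-- The norm of the discrete Green operator. -/
noncomputable def greenConst (K κ ν : ℝ) : ℝ :=
  2 * (K * Real.exp κ * (1 - Real.exp (-(ν - κ)))⁻¹)

theorem greenConst_nonneg (hK : 0 ≤ K) (hκν : κ < ν) : 0 ≤ greenConst K κ ν := by
  have := exp_neg_lt_one (sub_pos.2 hκν)
  have h2 : 0 < 1 - Real.exp (-(ν - κ)) := by linarith
  unfold greenConst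
  positivity

/-- The forcing decays at a rate `ν > κ`, so the sums over the past and over the future are both
dominated by geometric series of ratio `e^{-(ν - κ)}`. -/
theorem norm_discreteGreen_le [CompleteSpace V] (h : IsSplitting U P₁ P₂ K κ) (hK : 0 ≤ K)
    (hκν : κ < ν) (hF : 0 ≤ F) {f : ℕ → V}
    (hf : ∀ k : ℕ, ‖f k‖ ≤ F * Real.exp (-ν * k)) (i : ℕ) :
    ‖discreteGreen U P₁ P₂ f i‖ ≤ greenConst K κ ν * F * Real.exp (-κ * i) := by
  set q := Real.exp (-(ν - κ))
  have hq0 : 0 ≤ q := (Real.exp_pos _).le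
  have hq : q < 1 := exp_neg_lt_one (sub_pos.2 hκν)
  have hgeo := summable_geometric_of_lt_one hq0 hq
  have hsum1 : ‖∑ k ∈ Finset.range i, U ((i : ℝ) - 1 - k) (P₂ (f k))‖ ≤
      K * F * Real.exp κ * Real.exp (-κ * i) * (1 - q)⁻¹ := by
    calc _ ≤ ∑ k ∈ Finset.range i, K * F * Real.exp κ * Real.exp (-κ * i) * q ^ k := by
          refine (norm_sum_le _ _).trans (Finset.sum_le_sum fun k hk => ?_)
          have hk' : (k : ℝ) + 1 ≤ i := by exact_mod_cast Finset.mem_range.1 hk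
          refine (h.bound₂ _ (by linarith) _).trans ?_
          calc K * Real.exp (-κ * ((i : ℝ) - 1 - k)) * ‖f k‖
              ≤ K * Real.exp (-κ * ((i : ℝ) - 1 - k)) * (F * Real.exp (-ν * k)) := by
                gcongr; exact hf k
            _ = K * F * (Real.exp (-κ * ((i : ℝ) - 1 - k)) * Real.exp (-ν * k)) := by ring
            _ = K * F * (Real.exp κ * (Real.exp (-κ * i) * q ^ k)) := by
                simp only [q]
                rw [← Real.exp_nat_mul, ← Real.exp_add, ← Real.exp_add, ← Real.exp_add]
                congr 2
                ring
            _ = _ := by ring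
      _ ≤ _ := by
          rw [← Finset.mul_sum, ← tsum_geometric_of_lt_one hq0 hq]
          gcongr
          exact hgeo.sum_le_tsum _ fun k _ => pow_nonneg hq0 k
  have hsum2 : ‖∑' k : ℕ, U (-((k : ℝ) + 1)) (P₁ (f (i + k)))‖ ≤
      K * F * Real.exp κ * Real.exp (-κ * i) * (1 - q)⁻¹ := by
    have h1 := tsum_of_norm_bounded ((hasSum_geometric_of_lt_one hq0 hq).mul_left
      (K * F * Real.exp κ * Real.exp (-ν * i))) (norm_green_tail_le h hK hf i)
    refine h1.trans ?_
    have h2 : 0 < 1 - q := by linarith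
    have h3 : Real.exp (-ν * i) ≤ Real.exp (-κ * i) := by
      apply Real.exp_le_exp.2
      have : (0 : ℝ) ≤ i := by positivity
      nlinarith
    gcongr
  refine (norm_sub_le _ _).trans ((add_le_add hsum1 hsum2).trans_eq ?_)
  unfold greenConst
  ring

/-- One step adds the new term `P₂ (f i)` to the past and removes `P₁ (f i)` from the future; the
two recombine to `f i`. -/
theorem discreteGreen_succ [FiniteDimensional ℂ V] (h : IsSplitting U P₁ P₂ K κ) (hK : 0 ≤ K)
    (hκν : κ < ν) (hU0 : ∀ v, U 0 v = v) (hUadd : ∀ s t v, U (s + t) v = U s (U t v))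
    {f : ℕ → V} (hf : ∀ k : ℕ, ‖f k‖ ≤ F * Real.exp (-ν * k)) (i : ℕ) :
    discreteGreen U P₁ P₂ f (i + 1) = U 1 (discreteGreen U P₁ P₂ f i) + f i := by
  have : CompleteSpace V := FiniteDimensional.complete ℂ V
  have hs := summable_green_tail h hK hκν hf
  have h1 : ∑ k ∈ Finset.range (i + 1), U (((i + 1 : ℕ) : ℝ) - 1 - k) (P₂ (f k)) =
      U 1 (∑ k ∈ Finset.range i, U ((i : ℝ) - 1 - k) (P₂ (f k))) + P₂ (f i) := by
    rw [Finset.sum_range_succ, map_sum]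
    congr 1
    · refine Finset.sum_congr rfl fun k _ => ?_
      rw [← hUadd]
      congr 2
      push_cast
      ring
    · rw [show (((i + 1 : ℕ) : ℝ) - 1 - i) = 0 by push_cast; ring, hU0]
  have h2 : U 1 (∑' k : ℕ, U (-((k : ℝ) + 1)) (P₁ (f (i + k)))) =
      P₁ (f i) + ∑' k : ℕ, U (-((k : ℝ) + 1)) (P₁ (f (i + 1 + k))) := by
    have h3 : U 1 (∑' k : ℕ, U (-((k : ℝ) + 1)) (P₁ (f (i + k)))) =
        ∑' k : ℕ, U (-(k : ℝ)) (P₁ (f (i + k))) := by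
      have h4 := (LinearMap.toContinuousLinearMap (U 1)).map_tsum (hs i)
      refine h4.trans (tsum_congr fun k => ?_)
      change U 1 (U (-((k : ℝ) + 1)) (P₁ (f (i + k)))) = _
      rw [← hUadd]
      congr 2
      ring
    have h5 : Summable fun k : ℕ => U (-(k : ℝ)) (P₁ (f (i + k))) := by
      refine (summable_nat_add_iff 1).1 ((hs (i + 1)).congr fun k => ?_)
      push_cast
      rw [show i + 1 + k = i + (k + 1) by ring]
    rw [h3, h5.tsum_eq_zero_add]
    congr 1
    · simp [hU0]
    · refine tsum_congr fun k => ?_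
      push_cast
      rw [show i + 1 + k = i + (k + 1) by ring]
  rw [discreteGreen, discreteGreen, h1, map_sub, h2]
  have haux : ∀ R a b S : V, R + b - S = R - (a + S) + (a + b) := fun R a b S => by abel
  rw [haux _ (P₁ (f i)), h.add]

theorem discreteGreen_sub [CompleteSpace V] {F' : ℝ} (h : IsSplitting U P₁ P₂ K κ) (hK : 0 ≤ K)
    (hκν : κ < ν) {f f' : ℕ → V} (hf : ∀ k : ℕ, ‖f k‖ ≤ F * Real.exp (-ν * k))
    (hf' : ∀ k : ℕ, ‖f' k‖ ≤ F' * Real.exp (-ν * k)) (i : ℕ) :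
    discreteGreen U P₁ P₂ (fun k => f k - f' k) i =
      discreteGreen U P₁ P₂ f i - discreteGreen U P₁ P₂ f' i := by
  simp only [discreteGreen, map_sub, Finset.sum_sub_distrib]
  rw [(summable_green_tail h hK hκν hf i).tsum_sub (summable_green_tail h hK hκν hf' i)]
  abel

/-- Solutions of an exponentially small perturbation that are asymptotic to a fixed vector of the
unperturbed dynamics. -/
theorem exists_asymptotic_sequence [FiniteDimensional ℂ V] (h : IsSplitting U P₁ P₂ K κ)
    (hK : 0 ≤ K) (hκ : 0 < κ) (hκν : κ < ν) (hU0 : ∀ v, U 0 v = v)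
    (hUadd : ∀ s t v, U (s + t) v = U s (U t v)) {v₀ : V} (hv₀ : U 1 v₀ = v₀)
    {Δ : ℕ → Module.End ℂ V} {D : ℝ} (hD : 0 ≤ D)
    (hΔ : ∀ (j : ℕ) v, ‖Δ j v‖ ≤ D * Real.exp (-ν * j) * ‖v‖) :
    ∃ (J : ℕ) (y : ℕ → V) (C : ℝ), (∀ i, y (i + 1) = U 1 (y i) + Δ (J + i) (y i)) ∧
      ∀ i : ℕ, ‖y i - v₀‖ ≤ C * Real.exp (-κ * i) := by
  have hcomp : CompleteSpace V := FiniteDimensional.complete ℂ V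
  have hν : 0 < ν := hκ.trans hκν
  set G := greenConst K κ ν
  have hG : 0 ≤ G := greenConst_nonneg hK hκν
  -- Starting late enough makes the perturbation so small that the fixed point map has Lipschitz
  -- constant at most `1/2`.
  obtain ⟨J, hJ⟩ : ∃ J : ℕ, G * (D * Real.exp (-ν * J)) ≤ 1 / 2 := by
    have h1 : Filter.Tendsto (fun j : ℕ => G * (D * Real.exp (-ν * j))) Filter.atTop
        (nhds (G * (D * 0))) := by
      refine Filter.Tendsto.const_mul G (Filter.Tendsto.const_mul D ?_)
      refine Real.tendsto_exp_atBot.comp ?_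
      exact tendsto_natCast_atTop_atTop.const_mul_atTop_of_neg (by linarith)
    rw [mul_zero, mul_zero] at h1
    exact (h1.eventually_le_const (by norm_num)).exists
  set E := D * Real.exp (-ν * J)
  have hE : 0 ≤ E := by positivity
  have hf : ∀ (y : BoundedContinuousFunction ℕ V) (k : ℕ),
      ‖Δ (J + k) (y k)‖ ≤ E * ‖y‖ * Real.exp (-ν * k) := fun y k => by
    refine (hΔ _ _).trans ?_
    calc D * Real.exp (-ν * (J + k : ℕ)) * ‖y k‖ ≤ D * Real.exp (-ν * (J + k : ℕ)) * ‖y‖ := by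
          gcongr; exact y.norm_coe_le_norm k
      _ = D * (Real.exp (-ν * J) * Real.exp (-ν * k)) * ‖y‖ := by
          rw [← Real.exp_add]; congr 3; push_cast; ring
      _ = _ := by simp only [E]; ring
  have hexp : ∀ i : ℕ, Real.exp (-κ * i) ≤ 1 := fun i => by
    rw [Real.exp_le_one_iff]
    have : (0 : ℝ) ≤ i := by positivity
    nlinarith
  have hgreen : ∀ (y : BoundedContinuousFunction ℕ V) (i : ℕ),
      ‖discreteGreen U P₁ P₂ (fun k => Δ (J + k) (y k)) i‖ ≤
        G * (E * ‖y‖) * Real.exp (-κ * i) := fun y i =>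
    norm_discreteGreen_le h hK hκν (by positivity) (hf y) i
  -- Variation of constants around the stationary vector `v₀`. Its fixed point solves the perturbed
  -- recursion and approaches `v₀` at the rate given by the Green operator.
  let Φ : BoundedContinuousFunction ℕ V → BoundedContinuousFunction ℕ V := fun y =>
    BoundedContinuousFunction.ofNormedAddCommGroupDiscrete
      (fun i => v₀ + discreteGreen U P₁ P₂ (fun k => Δ (J + k) (y k)) i)
      (‖v₀‖ + G * (E * ‖y‖)) fun i => by
        refine (norm_add_le _ _).trans (add_le_add le_rfl ((hgreen y i).trans ?_))
        exact mul_le_of_le_one_right (by positivity) (hexp i)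
  have hΦ : ContractingWith (1 / 2) Φ := by
    refine ⟨by norm_num, LipschitzWith.of_dist_le_mul fun y z => ?_⟩
    rw [BoundedContinuousFunction.dist_le (by positivity)]
    intro i
    change dist (v₀ + _) (v₀ + _) ≤ _
    rw [dist_add_left, dist_eq_norm, ← discreteGreen_sub h hK hκν (hf y) (hf z)]
    have h2 := hgreen (y - z) i
    simp only [BoundedContinuousFunction.coe_sub, Pi.sub_apply, map_sub] at h2
    refine h2.trans ?_
    rw [dist_eq_norm]
    calc G * (E * ‖y - z‖) * Real.exp (-κ * i) ≤ G * (E * ‖y - z‖) :=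
          mul_le_of_le_one_right (by positivity) (hexp i)
      _ = G * E * ‖y - z‖ := by ring
      _ ≤ 1 / 2 * ‖y - z‖ := by gcongr
      _ = _ := by norm_num
  set y := ContractingWith.fixedPoint Φ hΦ
  have hy : Φ y = y := ContractingWith.fixedPoint_isFixedPt hΦ
  have hyi : ∀ i, y i = v₀ + discreteGreen U P₁ P₂ (fun k => Δ (J + k) (y k)) i := fun i => by
    conv_lhs => rw [← hy]
    rfl
  refine ⟨J, y, G * (E * ‖y‖), fun i => ?_, fun i => ?_⟩
  · have h3 : U 1 (y i) = v₀ + U 1 (discreteGreen U P₁ P₂ (fun k => Δ (J + k) (y k)) i) := by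
      rw [hyi i, map_add, hv₀]
    rw [hyi (i + 1), discreteGreen_succ h hK hκν hU0 hUadd (hf y) i, h3, add_assoc]
  · rw [hyi i, add_sub_cancel_left]
    exact hgreen y i

end DiscreteGreen

/-! ### Existence of conjugators on half-lines. -/

section Conjugator

variable {n : ℕ}

/-- Conjugation by the flow of `B`. -/
noncomputable def flowConj (B : CMat n) (x : ℝ) : Module.End ℂ (CMat n) where
  toFun Y := flow B x * Y * flow B (-x)
  map_add' Y Z := by rw [mul_add, add_mul]
  map_smul' c Y := by simp

/-- The commutator with `B`. -/
noncomputable def commutatorEnd (B : CMat n) : Module.End ℂ (CMat n) where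
  toFun Y := B * Y - Y * B
  map_add' Y Z := by noncomm_ring
  map_smul' c Y := by simp [smul_sub]

theorem hasDerivAt_flow_neg (B : CMat n) (x : ℝ) :
    HasDerivAt (fun s => flow B (-s)) (-(flow B (-x) * B)) x := by
  have h := (hasDerivAt_flow B (-x)).scomp x (hasDerivAt_neg x)
  refine h.congr_deriv ?_
  rw [neg_one_smul, (flow_commute (Commute.refl B) (-x)).eq]

theorem hasDerivAt_flowConj (B Y : CMat n) (x : ℝ) :
    HasDerivAt (fun s => flowConj B s Y) (flowConj B x (commutatorEnd B Y)) x := by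
  have h := ((hasDerivAt_flow B x).mul_const Y).mul (hasDerivAt_flow_neg B x)
  refine h.congr_deriv ?_
  change _ = flow B x * (B * Y - Y * B) * flow B (-x)
  have h1 := (flow_commute (Commute.refl B) x).eq
  have h2 := (flow_commute (Commute.refl B) (-x)).eq
  rw [h1, ← h2]
  noncomm_ring

theorem tendsto_of_norm_sub_le_exp {E : Type*} [NormedAddCommGroup E] {f : ℝ → E} {b : E}
    {C κ : ℝ} (hκ : 0 < κ) (h : ∀ x, 0 ≤ x → ‖f x - b‖ ≤ C * Real.exp (-κ * x)) :
    Filter.Tendsto f Filter.atTop (nhds b) := by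
  rw [tendsto_iff_norm_sub_tendsto_zero]
  refine squeeze_zero' (Filter.Eventually.of_forall fun _ => norm_nonneg _)
    ((Filter.eventually_ge_atTop 0).mono h) ?_
  have : Filter.Tendsto (fun x : ℝ => Real.exp (-κ * x)) Filter.atTop (nhds 0) :=
    Real.tendsto_exp_atBot.comp (Filter.tendsto_id.const_mul_atTop_of_neg (by linarith))
  simpa using this.const_mul C

theorem norm_flow_neg_le (B : CMat n) {L : ℝ} (hB : ‖B‖ ≤ L) {x : ℝ} (hx : 0 ≤ x) :
    ‖flow B (-x)‖ ≤ Real.exp (L * x) := by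
  rw [← flow_neg]
  exact norm_flow_le (-B) (by rwa [norm_neg]) hx

/-- The conjugation lemma on the half-line `x ≥ 0`. -/
theorem exists_isConjugator_Ici {a : ℝ → CMat n} {B : CMat n} (ha : Continuous a) {C ν : ℝ}
    (hν : 0 < ν) (hab : ∀ x, 0 ≤ x → ‖a x - B‖ ≤ C * Real.exp (-ν * x)) :
    ∃ P, IsConjugator a B (Set.Ici 0) P := by
  have hC : 0 ≤ C := by
    have := (norm_nonneg _).trans (hab 0 le_rfl)
    simpa using this
  have hU0 : ∀ Y, flowConj B 0 Y = Y := fun Y => by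
    change flow B 0 * Y * flow B (-0) = Y
    simp [flow_zero]
  have hUadd : ∀ s t Y, flowConj B (s + t) Y = flowConj B s (flowConj B t Y) := fun s t Y => by
    change flow B (s + t) * Y * flow B (-(s + t)) =
      flow B s * (flow B t * Y * flow B (-t)) * flow B (-s)
    rw [neg_add_rev, flow_add, flow_add]
    noncomm_ring
  obtain ⟨P₁, P₂, K, κ, hK, hκ, hκν, hsplit⟩ := exists_splitting (commutatorEnd B) (flowConj B)
    hU0 (hasDerivAt_flowConj B) hν
  set L := ‖B‖ + C + 1
  have hL : 0 < L := by positivity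
  have hBL : ‖B‖ ≤ L := by simp only [L]; linarith
  have hexp1 : ∀ x, 0 ≤ x → Real.exp (-ν * x) ≤ 1 := fun x hx => by
    rw [Real.exp_le_one_iff]; nlinarith
  have haL : ∀ x, 0 ≤ x → ‖a x‖ ≤ L := fun x hx => by
    have h1 : ‖a x‖ ≤ ‖a x - B‖ + ‖B‖ := by simpa using norm_add_le (a x - B) B
    have h2 := (hab x hx).trans (mul_le_of_le_one_right hC (hexp1 x hx))
    simp only [L]
    linarith
  have hstep : ∀ (j : ℝ), 0 ≤ j → ∀ x, j ≤ x → x ≤ j + 1 →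
      ‖propagator a x j - flow B (x - j)‖ ≤ C * Real.exp (2 * L) * Real.exp (-ν * j) := by
    intro j hj x hjx hx
    have h := norm_propagator_sub_le (b := fun _ => B) (δ := C * Real.exp (-ν * j)) ha
      continuous_const hL hjx (fun s hs => haL s (hj.trans hs.1)) (fun _ _ => hBL)
      (fun s hs => (hab s (hj.trans hs.1)).trans (by
        gcongr ?_ * Real.exp ?_
        nlinarith [hs.1]))
    rw [propagator_const] at h
    refine h.trans ?_
    have h1 : (x - j) * Real.exp (2 * L * (x - j)) ≤ 1 * Real.exp (2 * L) := by
      have : 2 * L * (x - j) ≤ 2 * L := by nlinarith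
      gcongr
      linarith
    calc C * Real.exp (-ν * j) * ((x - j) * Real.exp (2 * L * (x - j)))
        ≤ C * Real.exp (-ν * j) * (1 * Real.exp (2 * L)) := by gcongr
      _ = _ := by ring
  have hflow1 : ∀ x, 0 ≤ x → x ≤ 1 → ‖flow B (-x)‖ ≤ Real.exp L := fun x hx hx1 =>
    (norm_flow_neg_le B hBL hx).trans (Real.exp_le_exp.2 (by nlinarith))
  let Δ : ℕ → Module.End ℂ (CMat n) := fun j =>
    { toFun := fun Y => (propagator a (j + 1) j - flow B 1) * Y * flow B (-1)
      map_add' := fun Y Z => by noncomm_ring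
      map_smul' := fun c Y => by simp }
  have hΔ : ∀ (j : ℕ) Y, ‖Δ j Y‖ ≤
      C * Real.exp (2 * L) * Real.exp L * Real.exp (-ν * j) * ‖Y‖ := fun j Y => by
    have h1 := hstep j (by positivity) (j + 1) (by linarith) le_rfl
    rw [add_sub_cancel_left] at h1
    calc ‖(propagator a (j + 1) j - flow B 1) * Y * flow B (-1)‖
        ≤ ‖propagator a (j + 1) j - flow B 1‖ * ‖Y‖ * ‖flow B (-1)‖ :=
          (norm_mul_le _ _).trans (mul_le_mul_of_nonneg_right (norm_mul_le _ _) (norm_nonneg _))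
      _ ≤ C * Real.exp (2 * L) * Real.exp (-ν * j) * ‖Y‖ * Real.exp L := by
          gcongr
          exact hflow1 1 zero_le_one le_rfl
      _ = _ := by ring
  -- The identity is stationary for conjugation by the flow; the conjugator is the perturbed
  -- solution asymptotic to it.
  have hone : flowConj B 1 (1 : CMat n) = 1 := by
    change flow B 1 * 1 * flow B (-1) = 1
    rw [mul_one, flow_mul_neg]
  obtain ⟨J, y, C', hy, hyC⟩ := exists_asymptotic_sequence hsplit hK hκ (by linarith) hU0 hUadd
    hone (by positivity) hΔ
  have hC' : 0 ≤ C' := by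
    have := (norm_nonneg _).trans (hyC 0)
    simpa using this
  -- Any initial value gives a solution of `P' = a P - P B`; this one makes `P J = y 0`, after which
  -- `P` passes through the whole sequence `y`.
  set P₀ : CMat n := (solutionOperator a J)⁻¹ * y 0 * flow B J
  set P : ℝ → CMat n := fun x => solutionOperator a x * P₀ * flow B (-x)
  have hderiv : ∀ x, HasDerivAt P (a x * P x - P x * B) x := fun x => by
    have h := ((hasDerivAt_solutionOperator ha x).mul_const P₀).mul (hasDerivAt_flow_neg B x)
    refine h.congr_deriv ?_
    simp only [P]
    noncomm_ring
  have hprop : ∀ x z, P x = propagator a x z * P z * flow B (-(x - z)) := fun x z => by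
    simp only [P, propagator]
    have h1 : flow B (-x) = flow B (-z) * flow B (-(x - z)) := by rw [← flow_add]; ring_nf
    have h2 := Matrix.nonsing_inv_mul _ (isUnit_det_solutionOperator ha z)
    calc solutionOperator a x * P₀ * flow B (-x)
        = solutionOperator a x * ((solutionOperator a z)⁻¹ * solutionOperator a z) * P₀ *
            (flow B (-z) * flow B (-(x - z))) := by rw [h2, h1, mul_one]
      _ = _ := by noncomm_ring
  have hPJ : ∀ i : ℕ, P (J + i) = y i := fun i => by
    induction i with
    | zero =>
      simp only [P, P₀, Nat.cast_zero, add_zero]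
      calc solutionOperator a J * ((solutionOperator a J)⁻¹ * y 0 * flow B J) * flow B (-J)
          = (solutionOperator a J * (solutionOperator a J)⁻¹) * y 0 *
            (flow B J * flow B (-J)) := by noncomm_ring
        _ = y 0 := by
          rw [Matrix.mul_nonsing_inv _ (isUnit_det_solutionOperator ha _), flow_mul_neg, one_mul,
            mul_one]
    | succ i ih =>
      rw [hprop _ (J + i), ih, hy i]
      change _ = flow B 1 * y i * flow B (-1) +
        (propagator a ((J + i : ℕ) + 1) (J + i : ℕ) - flow B 1) * y i * flow B (-1)
      push_cast
      rw [show (J : ℝ) + (i + 1) - (J + i) = 1 by ring, ← add_assoc]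
      noncomm_ring
  -- From the last grid point below `x` the solution is carried over a time at most `1`, where
  -- propagators and inverse flows are bounded.
  have htail : ∀ x, (J : ℝ) ≤ x → ‖P x - 1‖ ≤
      (Real.exp L * C' * Real.exp L + C * Real.exp (2 * L) * Real.exp L) * Real.exp κ *
        Real.exp (κ * J) * Real.exp (-κ * x) := fun x hx => by
    set i := ⌊x - J⌋₊
    have hi1 : (i : ℝ) ≤ x - J := Nat.floor_le (by linarith)
    have hi2 : x - J < i + 1 := Nat.lt_floor_add_one _
    set z : ℝ := J + i
    have hz0 : 0 ≤ z := by positivity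
    have hzx : z ≤ x := by simp only [z]; linarith
    have hxz : x ≤ z + 1 := by simp only [z]; linarith
    have h1 : P x - 1 = propagator a x z * (y i - 1) * flow B (-(x - z)) +
        (propagator a x z - flow B (x - z)) * flow B (-(x - z)) := by
      have h0 : P x - 1 = P x - flow B (x - z) * flow B (-(x - z)) := by rw [flow_mul_neg]
      rw [h0, hprop x z, hPJ i]
      noncomm_ring
    have h2 : ‖propagator a x z‖ ≤ Real.exp L :=
      (norm_propagator_le ha hzx fun s hs => haL s (hz0.trans hs.1)).trans
        (Real.exp_le_exp.2 (by nlinarith))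
    have h3 := hflow1 (x - z) (by linarith) (by linarith)
    have h4 : Real.exp (-κ * i) ≤ Real.exp κ * Real.exp (κ * J) * Real.exp (-κ * x) := by
      rw [← Real.exp_add, ← Real.exp_add]
      apply Real.exp_le_exp.2
      nlinarith
    have h5 : Real.exp (-ν * z) ≤ Real.exp κ * Real.exp (κ * J) * Real.exp (-κ * x) := by
      refine le_trans (Real.exp_le_exp.2 ?_) h4
      have : (0 : ℝ) ≤ i := by positivity
      have : (0 : ℝ) ≤ J := by positivity
      simp only [z]
      nlinarith
    rw [h1]
    calc _ ≤ ‖propagator a x z‖ * ‖y i - 1‖ * ‖flow B (-(x - z))‖ +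
          ‖propagator a x z - flow B (x - z)‖ * ‖flow B (-(x - z))‖ := by
          refine (norm_add_le _ _).trans (add_le_add ?_ (norm_mul_le _ _))
          exact (norm_mul_le _ _).trans (mul_le_mul_of_nonneg_right (norm_mul_le _ _) (norm_nonneg _))
      _ ≤ Real.exp L * (C' * (Real.exp κ * Real.exp (κ * J) * Real.exp (-κ * x))) * Real.exp L +
          C * Real.exp (2 * L) * (Real.exp κ * Real.exp (κ * J) * Real.exp (-κ * x)) *
            Real.exp L := by
          gcongr
          · exact (hyC i).trans (by gcongr)
          · exact (hstep z hz0 x hzx hxz).trans (by gcongr)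
      _ = _ := by ring
  obtain ⟨D, hD⟩ := (isCompact_Icc (a := (0 : ℝ)) (b := J)).exists_bound_of_continuousOn
    (f := fun x => P x - 1) (fun x _ => ((hderiv x).continuousAt.sub
      continuousAt_const).continuousWithinAt)
  set C₁ := (Real.exp L * C' * Real.exp L + C * Real.exp (2 * L) * Real.exp L) * Real.exp κ *
        Real.exp (κ * J)
  have hC₁ : 0 ≤ C₁ := by positivity
  have hbound : ∀ x, 0 ≤ x → ‖P x - 1‖ ≤ (C₁ + |D| * Real.exp (κ * J)) * Real.exp (-κ * x) :=
      fun x hx => by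
    rcases le_total (J : ℝ) x with h | h
    · refine (htail x h).trans ?_
      gcongr
      have : 0 ≤ |D| * Real.exp (κ * J) := by positivity
      linarith
    · refine (hD x ⟨hx, h⟩).trans ((le_abs_self D).trans ?_)
      have h1 : 1 ≤ Real.exp (κ * J) * Real.exp (-κ * x) := by
        rw [← Real.exp_add]
        apply Real.one_le_exp
        nlinarith
      calc |D| ≤ |D| * (Real.exp (κ * J) * Real.exp (-κ * x)) :=
            le_mul_of_one_le_right (abs_nonneg _) h1
        _ ≤ C₁ * Real.exp (-κ * x) + |D| * (Real.exp (κ * J) * Real.exp (-κ * x)) := by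
            have : 0 ≤ C₁ * Real.exp (-κ * x) := by positivity
            linarith
        _ = _ := by ring
  have htend : Filter.Tendsto P Filter.atTop (nhds 1) :=
    tendsto_of_norm_sub_le_exp hκ hbound
  have hdet : Filter.Tendsto (fun x => (P x).det) Filter.atTop (nhds 1) := by
    have h := ((continuous_id (X := CMat n)).matrix_det.tendsto 1).comp htend
    simpa [Function.comp_def] using h
  -- If `P₀` were singular, `det P` would vanish identically, contradicting its limit `1`.
  have hP₀ : IsUnit P₀.det := by
    obtain ⟨x, hx⟩ := (hdet.eventually_ne one_ne_zero).exists
    rw [isUnit_iff_ne_zero]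
    intro h0
    apply hx
    simp [P, Matrix.det_mul, h0]
  refine ⟨P, fun x _ => (hderiv x).hasDerivWithinAt, fun x _ => ?_, C₁ + |D| * Real.exp (κ * J), κ,
    hκ, fun x hx => ?_⟩
  · rw [Matrix.isUnit_iff_isUnit_det]
    simp only [P, Matrix.det_mul]
    exact ((isUnit_det_solutionOperator ha x).mul hP₀).mul (isUnit_det_flow B _)
  · have hx' : |x| = x := abs_of_nonneg hx
    rw [hx']
    exact hbound x hx

/-- The conjugation lemma on the half-line `x ≤ 0`. -/
theorem exists_isConjugator_Iic {a : ℝ → CMat n} {B : CMat n} (ha : Continuous a) {C ν : ℝ}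
    (hν : 0 < ν) (hab : ∀ x, x ≤ 0 → ‖a x - B‖ ≤ C * Real.exp (-ν * |x|)) :
    ∃ P, IsConjugator a B (Set.Iic 0) P := by
  -- The reflection `x ↦ -x` changes the sign of both the coefficient and its limit.
  obtain ⟨P, h1, h2, C', κ, hκ, h3⟩ := exists_isConjugator_Ici (a := fun x => -a (-x)) (B := -B)
    (C := C) (ha.comp continuous_neg).neg hν (fun x hx => by
      have := hab (-x) (by linarith)
      rwa [abs_neg, abs_of_nonneg hx, ← norm_neg, show -(a (-x) - B) = -a (-x) - -B by abel] at this)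
  refine ⟨fun x => P (-x), fun x hx => ?_, fun x hx => h2 (-x) ?_, C', κ, hκ, fun x hx => ?_⟩
  · have hx' : -x ∈ Set.Ici (0 : ℝ) := by simpa using hx
    have h := (h1 (-x) hx').scomp x ((hasDerivAt_neg x).hasDerivWithinAt (s := Set.Iic 0))
      (fun y hy => by simpa using hy)
    refine h.congr_deriv ?_
    change (-1 : ℝ) • (-a (- -x) * P (-x) - P (-x) * -B) = a x * P (-x) - P (-x) * B
    rw [neg_neg, neg_one_smul]
    noncomm_ring
  · simpa using hx
  · have := h3 (-x) (by simpa using hx)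
    rwa [abs_neg] at this

end Conjugator

/-! ### Determinant estimates independent of the matrix size. -/

section DetEstimates

variable {ι : Type*} [Fintype ι] [DecidableEq ι]

/-- Enlarging the sum over permutations to a sum over all self-maps makes it factor. -/
theorem norm_det_le_prod_sum (A : Matrix ι ι ℂ) : ‖A.det‖ ≤ ∏ i, ∑ j, ‖A j i‖ := by
  rw [Matrix.det_apply]
  calc ‖∑ σ : Equiv.Perm ι, Equiv.Perm.sign σ • ∏ i, A (σ i) i‖
      ≤ ∑ σ : Equiv.Perm ι, ∏ i, ‖A (σ i) i‖ := by
        refine norm_sum_le_of_le _ fun σ _ => ?_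
        rcases Int.units_eq_one_or (Equiv.Perm.sign σ) with h | h <;> simp [h]
    _ = ∑ f ∈ Finset.univ.image (fun σ : Equiv.Perm ι => (σ : ι → ι)), ∏ i, ‖A (f i) i‖ := by
        rw [Finset.sum_image]
        exact fun σ _ τ _ h => DFunLike.coe_injective h
    _ ≤ ∑ f : ι → ι, ∏ i, ‖A (f i) i‖ :=
        Finset.sum_le_sum_of_subset_of_nonneg (Finset.subset_univ _)
          fun _ _ _ => Finset.prod_nonneg fun _ _ => norm_nonneg _
    _ = ∏ i, ∑ j, ‖A j i‖ := by
        rw [Finset.prod_univ_sum]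
        simp [Fintype.piFinset_univ]

theorem norm_det_one_add_le (M : Matrix ι ι ℂ) :
    ‖(1 + M).det‖ ≤ Real.exp (∑ i, ∑ j, ‖M j i‖) := by
  refine (norm_det_le_prod_sum _).trans ?_
  rw [Real.exp_sum]
  refine Finset.prod_le_prod (fun _ _ => Finset.sum_nonneg fun _ _ => norm_nonneg _) fun i _ => ?_
  calc ∑ j, ‖(1 + M) j i‖ ≤ ∑ j, (‖(1 : Matrix ι ι ℂ) j i‖ + ‖M j i‖) :=
        Finset.sum_le_sum fun j _ => norm_add_le _ _
    _ = ∑ j, ‖M j i‖ + 1 := by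
        rw [Finset.sum_add_distrib, add_comm]
        congr 1
        rw [Finset.sum_eq_single i] <;> simp +contextual
    _ ≤ _ := Real.add_one_le_exp _

/-- The Fredholm determinant is Lipschitz in the sum of the moduli of the entries. -/
theorem norm_det_one_add_sub_le (M M' : Matrix ι ι ℂ) {D δ : ℝ} (hM' : ∑ i, ∑ j, ‖M' j i‖ ≤ D)
    (hδ : ∑ i, ∑ j, ‖M j i - M' j i‖ ≤ δ) :
    ‖(1 + M).det - (1 + M').det‖ ≤ δ * Real.exp (D + δ + 1) := by
  refine le_of_forall_pos_le_add fun ε hε => ?_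
  have hδ0 : 0 ≤ δ := le_trans (Finset.sum_nonneg fun _ _ => Finset.sum_nonneg fun _ _ =>
    norm_nonneg _) hδ
  -- Passing to `d > δ` makes the radius `d⁻¹` below meaningful also when `δ = 0`.
  suffices H : ∀ d, δ < d → ‖(1 + M).det - (1 + M').det‖ ≤ d * Real.exp (D + d + 1) by
    have hc : ContinuousAt (fun d : ℝ => d * Real.exp (D + d + 1)) δ := by fun_prop
    refine le_trans (ge_of_tendsto (hc.tendsto.mono_left (nhdsWithin_le_nhds (s := Set.Ioi δ)))
      ?_) (le_add_of_nonneg_right hε.le)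
    filter_upwards [self_mem_nhdsWithin] with d hd using H d hd
  intro d hd
  have hd0 : 0 < d := hδ0.trans_lt hd
  let p : ℂ → ℂ := fun t => (1 + (M' + t • (M - M'))).det
  have hp : Differentiable ℂ p := by
    intro t
    simp only [p, Matrix.det_apply]
    refine DifferentiableAt.fun_sum fun σ _ => ?_
    refine DifferentiableAt.const_smul (c := Equiv.Perm.sign σ) ?_
    refine DifferentiableAt.fun_finsetProd fun i _ => ?_
    simp only [Matrix.add_apply, Matrix.smul_apply, Matrix.sub_apply, smul_eq_mul]
    fun_prop
  have hpb : ∀ t, ‖p t‖ ≤ Real.exp (D + ‖t‖ * d) := fun t => by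
    refine (norm_det_one_add_le _).trans (Real.exp_le_exp.2 ?_)
    calc ∑ i, ∑ j, ‖(M' + t • (M - M')) j i‖
        ≤ ∑ i, ∑ j, (‖M' j i‖ + ‖t‖ * ‖M j i - M' j i‖) := by
          gcongr with i _ j _
          refine (norm_add_le _ _).trans ?_
          simp
      _ = ∑ i, ∑ j, ‖M' j i‖ + ‖t‖ * ∑ i, ∑ j, ‖M j i - M' j i‖ := by
          simp only [Finset.sum_add_distrib, Finset.mul_sum]
      _ ≤ _ := by
          gcongr
          exact hδ.trans hd.le
  have hderiv : ∀ t ∈ Metric.closedBall (0 : ℂ) 1, ‖deriv p t‖ ≤ d * Real.exp (D + d + 1) :=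
      fun t ht => by
    -- On a circle of radius `d⁻¹` the perturbation contributes at most `d + 1` to the exponent, and
    -- Cauchy's estimate returns the factor `d`.
    have h := Complex.norm_deriv_le_of_forall_mem_sphere_norm_le (c := t) (R := d⁻¹)
      (C := Real.exp (D + d + 1)) (inv_pos.2 hd0) hp.diffContOnCl fun s hs => by
        refine (hpb s).trans (Real.exp_le_exp.2 ?_)
        have h1 : ‖s‖ ≤ 1 + d⁻¹ := by
          have h2 : ‖s‖ ≤ ‖t‖ + ‖s - t‖ := by simpa using norm_add_le t (s - t)
          rw [mem_sphere_iff_norm] at hs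
          rw [mem_closedBall_zero_iff] at ht
          linarith
        have h3 : ‖s‖ * d ≤ (1 + d⁻¹) * d := by gcongr
        rw [add_mul, inv_mul_cancel₀ hd0.ne'] at h3
        linarith
    rwa [div_inv_eq_mul, mul_comm] at h
  have h := (convex_closedBall (0 : ℂ) 1).norm_image_sub_le_of_norm_deriv_le
    (fun t _ => hp t) hderiv (x := 0) (y := 1) (by simp) (by simp)
  simpa [p] using h

end DetEstimates

/-! ### Determinants of discrete boundary value problems. -/

section Green

variable {n : ℕ}

/-- The matrix with given square blocks. -/
def blockMatrix {m : ℕ} (T : Fin m → Fin m → CMat n) :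
    Matrix (Fin m × Fin n) (Fin m × Fin n) ℂ :=
  Matrix.of fun p q => T p.1 q.1 p.2 q.2

theorem norm_entry_le (A : CMat n) (i j : Fin n) : ‖A i j‖ ≤ ‖A‖ := by
  rw [Matrix.linfty_opNorm_def]
  have h1 : ‖A i j‖₊ ≤ ∑ k, ‖A i k‖₊ :=
    Finset.single_le_sum (f := fun k => ‖A i k‖₊) (fun _ _ => bot_le) (Finset.mem_univ j)
  have h2 : ∑ k, ‖A i k‖₊ ≤ Finset.univ.sup fun i => ∑ k, ‖A i k‖₊ :=
    Finset.le_sup (f := fun i => ∑ k, ‖A i k‖₊) (Finset.mem_univ i)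
  exact_mod_cast h1.trans h2

theorem sum_norm_blockMatrix_le {m : ℕ} (T : Fin m → Fin m → CMat n) :
    ∑ q, ∑ p, ‖blockMatrix T p q‖ ≤ (n : ℝ) ^ 2 * ∑ j, ∑ i, ‖T i j‖ := by
  simp only [Fintype.sum_prod_type, blockMatrix, Matrix.of_apply]
  rw [Finset.mul_sum]
  refine Finset.sum_le_sum fun j _ => ?_
  calc ∑ β, ∑ i, ∑ α, ‖T i j α β‖ ≤ ∑ β : Fin n, ∑ i, ∑ α : Fin n, ‖T i j‖ := by
        gcongr
        exact norm_entry_le _ _ _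
    _ = (n : ℝ) ^ 2 * ∑ i, ‖T i j‖ := by
        simp [Finset.mul_sum, ← mul_assoc, sq]

theorem norm_det_blockMatrix_sub_le {m : ℕ} (T T' : Fin m → Fin m → CMat n) {D δ : ℝ}
    (hT' : ∑ j, ∑ i, ‖T' i j‖ ≤ D) (hδ : ∑ j, ∑ i, ‖T i j - T' i j‖ ≤ δ) :
    ‖(1 - blockMatrix T).det - (1 - blockMatrix T').det‖ ≤
      (n : ℝ) ^ 2 * δ * Real.exp ((n : ℝ) ^ 2 * D + (n : ℝ) ^ 2 * δ + 1) := by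
  rw [sub_eq_add_neg 1 (blockMatrix T), sub_eq_add_neg 1 (blockMatrix T')]
  refine norm_det_one_add_sub_le _ _ ?_ ?_
  · simp only [Matrix.neg_apply, norm_neg]
    exact (sum_norm_blockMatrix_le T').trans (by gcongr)
  · have h := sum_norm_blockMatrix_le fun i j => T i j - T' i j
    refine le_trans (le_of_eq ?_) (h.trans (by gcongr))
    refine Finset.sum_congr rfl fun q _ => Finset.sum_congr rfl fun p _ => ?_
    rw [← norm_neg]
    congr 1
    simp [blockMatrix]
    ring

/-- The product `Φ (k-1) ⋯ Φ 0`. -/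
def evol (Φ : ℕ → CMat n) : ℕ → CMat n
  | 0 => 1
  | k + 1 => Φ k * evol Φ k

/-- The discrete Duhamel formula comparing a variable evolution with the powers of `G`. -/
theorem sum_green_telescope (G : CMat n) (Φ : ℕ → CMat n) (i : ℕ) :
    ∑ j ∈ Finset.range i, G ^ (i - 1 - j) * (Φ j - G) * evol Φ j = evol Φ i - G ^ i := by
  induction i with
  | zero => simp [evol]
  | succ i ih =>
    rw [Finset.sum_range_succ]
    have h1 : ∀ j ∈ Finset.range i, G ^ (i + 1 - 1 - j) * (Φ j - G) * evol Φ j =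
        G * (G ^ (i - 1 - j) * (Φ j - G) * evol Φ j) := fun j hj => by
      rw [Finset.mem_range] at hj
      rw [show i + 1 - 1 - j = (i - 1 - j) + 1 by omega, pow_succ']
      noncomm_ring
    rw [Finset.sum_congr rfl h1, ← Finset.mul_sum, ih]
    simp only [evol, Nat.add_sub_cancel, Nat.sub_self, pow_zero, pow_succ']
    noncomm_ring

/-- A strictly lower block triangular matrix is a causal kernel; it does not contribute to the
determinant. -/
theorem det_one_sub_blockMatrix_of_lower {m : ℕ} (T : Fin m → Fin m → CMat n)
    (hT : ∀ i j, i ≤ j → T i j = 0) : (1 - blockMatrix T).det = 1 := by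
  have hb : (1 - blockMatrix T).BlockTriangular (fun p => OrderDual.toDual p.1) := by
    intro p q hpq
    have hlt : p.1 < q.1 := hpq
    have hne : p ≠ q := fun h => hlt.ne (by rw [h])
    simp [blockMatrix, hT _ _ hlt.le, Matrix.one_apply_ne hne]
  rw [hb.det_fintype]
  refine Finset.prod_eq_one fun k _ => ?_
  rw [← Matrix.det_one (n := {a : Fin m × Fin n // OrderDual.toDual a.1 = k}) (R := ℂ)]
  congr 1
  ext p q
  have hpq : p.1.1 = q.1.1 := OrderDual.toDual.injective (p.2.trans q.2.symm)
  simp [Matrix.toSquareBlock_def, blockMatrix, hT _ _ hpq.le, Matrix.one_apply, Subtype.ext_iff]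

/-- The determinant of a discrete boundary value problem in terms of the evolution. -/
theorem det_one_sub_green (m : ℕ) (G K : CMat n) (Φ : ℕ → CMat n) :
    (1 - blockMatrix fun i j : Fin m => ((if j < i then G ^ ((i : ℕ) - 1 - j) else 0) -
      G ^ (i : ℕ) * K * G ^ (m - 1 - j)) * (Φ j - G)).det = (1 + K * (evol Φ m - G ^ m)).det := by
  let T : Fin m → Fin m → CMat n := fun i j =>
    (if j < i then G ^ ((i : ℕ) - 1 - j) else 0) * (Φ j - G)
  let W : Matrix (Fin m × Fin n) (Fin n) ℂ := Matrix.of fun p β => evol Φ p.1 p.2 β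
  let V : Matrix (Fin n) (Fin m × Fin n) ℂ :=
    Matrix.of fun α q => (G ^ (m - 1 - (q.1 : ℕ)) * (Φ q.1 - G)) α q.2
  have hVW : V * W = evol Φ m - G ^ m := by
    rw [← sum_green_telescope, ← Fin.sum_univ_eq_sum_range
      (fun j => G ^ (m - 1 - j) * (Φ j - G) * evol Φ j)]
    ext α β
    rw [Matrix.mul_apply, Matrix.sum_apply, Fintype.sum_prod_type]
    rfl
  have hTW : ∀ i : Fin m, ∑ j, T i j * evol Φ j = evol Φ i - G ^ (i : ℕ) := fun i => by
    rw [← sum_green_telescope]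
    calc ∑ j : Fin m, T i j * evol Φ j
        = ∑ j : Fin m, (fun j : ℕ => if j < (i : ℕ) then
            G ^ ((i : ℕ) - 1 - j) * (Φ j - G) * evol Φ j else 0) j :=
          Finset.sum_congr rfl fun j _ => by
            by_cases h : j < i
            · simp [T, h]
            · simp [T, h]
      _ = ∑ j ∈ Finset.range m, if j < (i : ℕ) then
            G ^ ((i : ℕ) - 1 - j) * (Φ j - G) * evol Φ j else 0 :=
          Fin.sum_univ_eq_sum_range (fun j : ℕ => if j < (i : ℕ) then
            G ^ ((i : ℕ) - 1 - j) * (Φ j - G) * evol Φ j else 0) m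
      _ = _ := by
          rw [← Finset.sum_filter]
          congr 1
          ext j
          simp only [Finset.mem_filter, Finset.mem_range]
          have := i.2
          omega
  -- The boundary part factors through `Fin n`. By Duhamel, `1 - blockMatrix T` maps the columns of
  -- the true evolution `W` to the powers of `G`, so the causal factor splits off on the left and
  -- the remainder is reduced to size `n` by Sylvester's identity.
  have key : 1 - blockMatrix (fun i j : Fin m => ((if j < i then G ^ ((i : ℕ) - 1 - j) else 0) -
      G ^ (i : ℕ) * K * G ^ (m - 1 - j)) * (Φ j - G)) =
      (1 - blockMatrix T) * (1 + W * (K * V)) := by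
    have h1 : (1 - blockMatrix T) * W = Matrix.of fun p β => (G ^ (p.1 : ℕ)) p.2 β := by
      ext p β
      rw [Matrix.sub_mul, Matrix.one_mul, Matrix.sub_apply, Matrix.mul_apply, Fintype.sum_prod_type]
      have h2 := congr_fun (congr_fun (hTW p.1) p.2) β
      rw [Matrix.sum_apply, Matrix.sub_apply] at h2
      simp only [Matrix.mul_apply] at h2
      simp only [blockMatrix, W, Matrix.of_apply]
      rw [h2]
      ring
    rw [mul_add, mul_one, ← Matrix.mul_assoc, h1]
    ext p q
    have h3 : ((Matrix.of fun (p : Fin m × Fin n) β => (G ^ (p.1 : ℕ)) p.2 β) * (K * V)) p q =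
        (G ^ (p.1 : ℕ) * (K * (G ^ (m - 1 - (q.1 : ℕ)) * (Φ q.1 - G)))) p.2 q.2 := rfl
    rw [Matrix.add_apply, h3, Matrix.sub_apply, Matrix.sub_apply]
    simp only [blockMatrix, Matrix.of_apply, T, sub_mul, Matrix.sub_apply, mul_assoc]
    ring
  rw [key, Matrix.det_mul, det_one_sub_blockMatrix_of_lower T, one_mul,
    Matrix.det_one_add_mul_comm, Matrix.mul_assoc, hVW]
  intro i j hij
  simp [T, not_lt.2 hij]

end Green

/-! ### Exponential sums over grids. -/

section LatticeSums

/-- The sum of `exp (-α |k|)` over the integers. -/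
noncomputable def latticeSum (α : ℝ) : ℝ := ∑' k : ℤ, Real.exp (-α * |(k : ℝ)|)

theorem summable_exp_neg_abs_int {α : ℝ} (hα : 0 < α) :
    Summable fun k : ℤ => Real.exp (-α * |(k : ℝ)|) := by
  have h : Summable fun k : ℕ => Real.exp (-α * k) := by
    have := summable_geometric_of_lt_one (Real.exp_pos (-α)).le (exp_neg_lt_one hα)
    refine this.congr fun k => ?_
    rw [← Real.exp_nat_mul]
    ring_nf
  refine Summable.of_nat_of_neg ?_ ?_
  · simpa using h
  · simpa using h

theorem latticeSum_nonneg (α : ℝ) : 0 ≤ latticeSum α := tsum_nonneg fun _ => (Real.exp_pos _).le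

theorem sum_exp_le_latticeSum {ι : Type*} [Fintype ι] {α : ℝ} (hα : 0 < α) {φ : ι → ℤ}
    (hφ : Function.Injective φ) : ∑ i, Real.exp (-α * |(φ i : ℝ)|) ≤ latticeSum α := by
  classical
  have h := (summable_exp_neg_abs_int hα).sum_le_tsum (Finset.univ.image φ)
    fun _ _ => (Real.exp_pos _).le
  rwa [Finset.sum_image hφ.injOn] at h

/-- The shifted grid injects into the integers, so the bound depends neither on the number of points
nor on the center. -/
theorem sum_fin_exp_le {α : ℝ} (hα : 0 < α) (m : ℕ) (t : ℤ) :
    ∑ i : Fin m, Real.exp (-α * |(i : ℝ) - t|) ≤ latticeSum α := by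
  have h := sum_exp_le_latticeSum hα (φ := fun i : Fin m => (i : ℤ) - t) fun i j hij => by
    simp only at hij
    exact Fin.ext (by omega)
  simpa using h

end LatticeSums

/-! ### Green's functions on the line and on a period. -/

section Kernels

variable {n : ℕ} {B Qs Qu : CMat n} {c g : ℝ}

namespace IsDichotomy

theorem c_nonneg (hd : IsDichotomy B Qs Qu c g) : 0 ≤ c := by
  have := (norm_nonneg _).trans (hd.bound_s 0 le_rfl)
  simpa using this

theorem idem_s (hd : IsDichotomy B Qs Qu c g) : Qs * Qs = Qs := by
  have := congrArg (Qs * ·) hd.add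
  simpa [mul_add, hd.mul_su] using this

theorem idem_u (hd : IsDichotomy B Qs Qu c g) : Qu * Qu = Qu := by
  have := congrArg (Qu * ·) hd.add
  simpa [mul_add, hd.mul_us] using this

theorem norm_s_le (hd : IsDichotomy B Qs Qu c g) : ‖Qs‖ ≤ c := by
  simpa [flow_zero] using hd.bound_s 0 le_rfl

theorem norm_u_le (hd : IsDichotomy B Qs Qu c g) : ‖Qu‖ ≤ c := by
  simpa [flow_zero] using hd.bound_u 0 le_rfl

theorem flow_comm_s (hd : IsDichotomy B Qs Qu c g) (x : ℝ) : flow B x * Qs = Qs * flow B x :=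
  (flow_commute hd.comm_s x).eq.symm

theorem flow_comm_u (hd : IsDichotomy B Qs Qu c g) (x : ℝ) : flow B x * Qu = Qu * flow B x :=
  (flow_commute hd.comm_u x).eq.symm

end IsDichotomy

/-- The lower triangular part of a discrete Green's function with boundary operator `K`. -/
noncomputable def greenKernel (B K : CMat n) (h : ℝ) (m : ℕ) (i j : Fin m) : CMat n :=
  (if j < i then flow B h ^ ((i : ℕ) - 1 - j) else 0) - flow B h ^ (i : ℕ) * K *
    flow B h ^ (m - 1 - (j : ℕ))

/-- When the boundary operator commutes with `B` the two powers of the flow merge. The natural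
subtraction does not truncate because `j < m`. -/
theorem greenKernel_boundary (hK : Commute K B) (h : ℝ) (m : ℕ) (i j : Fin m) :
    flow B h ^ (i : ℕ) * K * flow B h ^ (m - 1 - (j : ℕ)) =
      flow B (((i : ℝ) + m - 1 - j) * h) * K := by
  rw [flow_nat_mul, flow_nat_mul, mul_assoc, (flow_commute hK _).eq, ← mul_assoc, ← flow_add]
  have hj := j.2
  rw [Nat.cast_sub (by omega), Nat.cast_sub (by omega)]
  push_cast
  ring_nf

/-- For this boundary operator the kernel is the flow over `(i - 1 - j) h` restricted to the stable
part when `j < i`, and minus its restriction to the unstable part otherwise; both decay away from `i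
= j + 1`. -/
theorem norm_greenKernel_infinite_le (hd : IsDichotomy B Qs Qu c g) (hg : 0 < g) {h : ℝ}
    (hh : 1 ≤ h) (m : ℕ) (i j : Fin m) :
    ‖greenKernel B (flow B (-(m * h)) * Qu) h m i j‖ ≤
      c * Real.exp (-g * |(i : ℝ) - ((j : ℤ) + 1 : ℤ)|) := by
  have hK : Commute (flow B (-(m * h)) * Qu) B :=
    ((flow_commute (Commute.refl B) _).symm).mul_left hd.comm_u
  have hc := hd.c_nonneg
  have hb : flow B (((i : ℝ) + m - 1 - j) * h) * (flow B (-(m * h)) * Qu) =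
      flow B (((i : ℝ) - 1 - j) * h) * Qu := by
    rw [← mul_assoc, ← flow_add]
    ring_nf
  rw [greenKernel, greenKernel_boundary hK, hb]
  push_cast
  split_ifs with hij
  · have hij' : (j : ℝ) + 1 ≤ i := by exact_mod_cast Nat.succ_le_of_lt (Fin.lt_def.1 hij)
    have h1 : flow B h ^ ((i : ℕ) - 1 - j) = flow B (((i : ℝ) - 1 - j) * h) := by
      have := Fin.lt_def.1 hij
      rw [flow_nat_mul, Nat.cast_sub (by omega), Nat.cast_sub (by omega)]
      push_cast
      rfl
    have h2 : flow B (((i : ℝ) - 1 - j) * h) - flow B (((i : ℝ) - 1 - j) * h) * Qu =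
        flow B (((i : ℝ) - 1 - j) * h) * Qs := by
      rw [eq_sub_of_add_eq hd.add, mul_sub, mul_one]
    rw [h1, h2, abs_of_nonneg (by linarith)]
    refine (hd.bound_s _ (mul_nonneg (by linarith) (by linarith))).trans ?_
    gcongr ?_ * Real.exp ?_
    nlinarith [mul_nonneg (sub_nonneg.2 hij') (sub_nonneg.2 hh)]
  · have hij' : (i : ℝ) ≤ j := by exact_mod_cast Fin.le_def.1 (not_lt.1 hij)
    rw [zero_sub, norm_neg, abs_of_nonpos (by linarith),
      show ((i : ℝ) - 1 - j) * h = -(((j : ℝ) + 1 - i) * h) by ring]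
    refine (hd.bound_u _ (mul_nonneg (by linarith) (by linarith))).trans ?_
    gcongr ?_ * Real.exp ?_
    nlinarith [mul_nonneg (sub_nonneg.2 hij') (sub_nonneg.2 hh)]

/-- An eigenvector for a multiplier of modulus one would have stable and unstable components that
are each at most half their own length. -/
theorem det_flow_sub_ne_zero (hd : IsDichotomy B Qs Qu c g) {X : ℝ} (hX : 0 ≤ X)
    (hs : c * Real.exp (-g * X) ≤ 1 / 2) {γ : ℂ} (hγ : ‖γ‖ = 1) :
    (flow B X - γ • (1 : CMat n)).det ≠ 0 := by
  intro h0
  obtain ⟨v, hv, hv0⟩ := Matrix.exists_mulVec_eq_zero_iff.2 h0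
  have h1 : (flow B X).mulVec v = γ • v := by
    rw [Matrix.sub_mulVec, Matrix.smul_mulVec, Matrix.one_mulVec, sub_eq_zero] at hv0
    exact hv0
  have hsv : (flow B X * Qs).mulVec (Qs.mulVec v) = γ • Qs.mulVec v := by
    rw [Matrix.mulVec_mulVec, mul_assoc, hd.idem_s, hd.flow_comm_s, ← Matrix.mulVec_mulVec, h1,
      Matrix.mulVec_smul]
  have huv : (flow B (-X) * Qu).mulVec (γ • Qu.mulVec v) = Qu.mulVec v := by
    rw [← Matrix.mulVec_smul, ← h1, Matrix.mulVec_mulVec, Matrix.mulVec_mulVec]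
    congr 1
    calc flow B (-X) * Qu * Qu * flow B X = flow B (-X) * (Qu * Qu) * flow B X := by
          noncomm_ring
      _ = Qu * (flow B (-X) * flow B X) := by rw [hd.idem_u, hd.flow_comm_u, mul_assoc]
      _ = Qu := by rw [flow_neg_mul, mul_one]
  have e1 : ‖Qs.mulVec v‖ ≤ 1 / 2 * ‖Qs.mulVec v‖ := by
    calc ‖Qs.mulVec v‖ = ‖γ • Qs.mulVec v‖ := by rw [norm_smul, hγ, one_mul]
      _ ≤ ‖flow B X * Qs‖ * ‖Qs.mulVec v‖ := by
          rw [← hsv]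
          exact Matrix.linfty_opNorm_mulVec _ _
      _ ≤ _ := by
          gcongr
          exact (hd.bound_s X hX).trans hs
  have e2 : ‖Qu.mulVec v‖ ≤ 1 / 2 * ‖Qu.mulVec v‖ := by
    calc ‖Qu.mulVec v‖ ≤ ‖flow B (-X) * Qu‖ * ‖γ • Qu.mulVec v‖ := by
          conv_lhs => rw [← huv]
          exact Matrix.linfty_opNorm_mulVec _ _
      _ ≤ 1 / 2 * ‖Qu.mulVec v‖ := by
          rw [norm_smul, hγ, one_mul]
          gcongr
          exact (hd.bound_u X hX).trans hs
  have z1 : Qs.mulVec v = 0 := norm_eq_zero.1 (by linarith [norm_nonneg (Qs.mulVec v)])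
  have z2 : Qu.mulVec v = 0 := norm_eq_zero.1 (by linarith [norm_nonneg (Qu.mulVec v)])
  apply hv
  rw [← Matrix.one_mulVec v, ← hd.add, Matrix.add_mulVec, z1, z2, add_zero]

/-- The periodic Green's function differs from the one on the line by reflections at the ends. -/
theorem norm_greenKernel_periodic_sub_le (hd : IsDichotomy B Qs Qu c g) {h : ℝ}
    (hh : 1 ≤ h) (m : ℕ) (hs : c * Real.exp (-g * (m * h)) ≤ 1 / 2) {γ : ℂ} (hγ : ‖γ‖ = 1)
    (i j : Fin m) :
    ‖greenKernel B (flow B (m * h) - γ • (1 : CMat n))⁻¹ h m i j -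
        greenKernel B (flow B (-(m * h)) * Qu) h m i j‖ ≤
      2 * c ^ 2 * Real.exp (-g * (((i : ℝ) + m - 1 - j) * h)) +
        2 * c ^ 2 * Real.exp (-g * (((m : ℝ) + 1 + j - i) * h)) := by
  have hc := hd.c_nonneg
  set X := (m : ℝ) * h with hX
  have hX0 : 0 ≤ X := by positivity
  set Y : CMat n := flow B X - γ • (1 : CMat n)
  have hY : IsUnit Y.det := isUnit_iff_ne_zero.2 (det_flow_sub_ne_zero hd hX0 hs hγ)
  set K := Y⁻¹
  have hYK : Y * K = 1 := Matrix.mul_nonsing_inv _ hY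
  have hKY : K * Y = 1 := Matrix.nonsing_inv_mul _ hY
  have hcomm : ∀ Q, Commute Q Y → Q * K = K * Q := fun Q hQ => by
    calc Q * K = K * (Y * Q) * K := by rw [← mul_assoc, hKY, one_mul]
      _ = K * (Q * Y) * K := by rw [hQ.eq]
      _ = K * Q := by rw [mul_assoc, mul_assoc, hYK, mul_one]
  have hcommY : ∀ Q, Commute Q B → Commute Q Y := fun Q hQ =>
    (flow_commute hQ X).sub_right ((Commute.one_right Q).smul_right γ)
  have hKB : Commute K B := (hcomm B (hcommY B (Commute.refl B))).symm
  have hKs : K * Qs = Qs * K := (hcomm _ (hcommY _ hd.comm_s)).symm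
  have hKu : K * Qu = Qu * K := (hcomm _ (hcommY _ hd.comm_u)).symm
  have hFK : flow B X * K = 1 + γ • K := by
    have : Y * K = flow B X * K - γ • K := by simp [Y, sub_mul]
    rw [← hYK, this, sub_add_cancel]
  -- On the stable part the flow over a period has norm at most `1/2`, so the equation for `K * Qs`
  -- bounds it in terms of half of itself.
  have bs : ‖K * Qs‖ ≤ 2 * c := by
    have e : γ • (K * Qs) = flow B X * Qs * (K * Qs) - Qs := by
      calc γ • (K * Qs) = (1 + γ • K) * Qs - Qs := by simp [add_mul]
        _ = flow B X * K * (Qs * Qs) - Qs := by rw [← hFK, hd.idem_s]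
        _ = flow B X * (K * Qs) * Qs - Qs := by noncomm_ring
        _ = flow B X * (Qs * K) * Qs - Qs := by rw [hKs]
        _ = _ := by noncomm_ring
    have h1 : ‖K * Qs‖ ≤ 1 / 2 * ‖K * Qs‖ + c := by
      calc ‖K * Qs‖ = ‖γ • (K * Qs)‖ := by rw [norm_smul, hγ, one_mul]
        _ ≤ ‖flow B X * Qs‖ * ‖K * Qs‖ + ‖Qs‖ := by
          rw [e]
          exact (norm_sub_le _ _).trans (by gcongr; exact norm_mul_le _ _)
        _ ≤ _ := by
          gcongr
          · exact (hd.bound_s X hX0).trans hs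
          · exact hd.norm_s_le
    linarith
  -- On the unstable part `K` itself is small; multiplying by the flow over a period gives a
  -- quantity of order one, bounded by the same self-improving argument.
  set Z := flow B X * K * Qu
  have hZ : Z = Qu + γ • (flow B (-X) * Qu * Z) := by
    have h1 : flow B (-X) * Qu * Z = K * Qu := by
      calc flow B (-X) * Qu * (flow B X * K * Qu)
          = flow B (-X) * (Qu * flow B X) * K * Qu := by noncomm_ring
        _ = flow B (-X) * flow B X * (Qu * K) * Qu := by rw [← hd.flow_comm_u]; noncomm_ring
        _ = K * (Qu * Qu) := by rw [flow_neg_mul, ← hKu, one_mul, mul_assoc]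
        _ = _ := by rw [hd.idem_u]
    rw [h1]
    simp only [Z]
    rw [hFK, add_mul, one_mul, smul_mul_assoc]
  have bu : ‖Z‖ ≤ 2 * c := by
    have h1 : ‖Z‖ ≤ c + 1 / 2 * ‖Z‖ := by
      calc ‖Z‖ = ‖Qu + γ • (flow B (-X) * Qu * Z)‖ := by rw [← hZ]
        _ ≤ ‖Qu‖ + ‖flow B (-X) * Qu‖ * ‖Z‖ := by
          refine (norm_add_le _ _).trans ?_
          rw [norm_smul, hγ, one_mul]
          gcongr
          exact norm_mul_le _ _
        _ ≤ _ := by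
          gcongr
          · exact hd.norm_u_le
          · exact (hd.bound_u X hX0).trans hs
    linarith
  have hK2 : Commute (flow B (-X) * Qu) B :=
    ((flow_commute (Commute.refl B) _).symm).mul_left hd.comm_u
  -- The leading term is the boundary operator of the line, and the correction has gone around the
  -- period once more.
  have hKu2 : K * Qu = flow B (-X) * Qu + γ • (flow B (-X) * (flow B (-X) * Qu) * Z) := by
    calc K * Qu = flow B (-X) * flow B X * (K * Qu) := by rw [flow_neg_mul, one_mul]
      _ = flow B (-X) * Z := by simp only [Z]; noncomm_ring
      _ = _ := by
        conv_lhs => rw [hZ]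
        rw [mul_add, mul_smul_comm]
        noncomm_ring
  set e := ((i : ℝ) + m - 1 - j) * h
  have key : greenKernel B K h m i j - greenKernel B (flow B (-X) * Qu) h m i j =
      -(flow B e * Qs * (K * Qs)) - γ • (flow B (-(((m : ℝ) + 1 + j - i) * h)) * Qu * Z) := by
    rw [greenKernel, greenKernel, greenKernel_boundary hKB, greenKernel_boundary hK2]
    have h1 : flow B (-(((m : ℝ) + 1 + j - i) * h)) =
        flow B e * flow B (-X) * flow B (-X) := by
      rw [← flow_add, ← flow_add]
      simp only [e, X]
      ring_nf
    have h2 : flow B e * K = flow B e * Qs * (K * Qs) + flow B e * (K * Qu) := by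
      calc flow B e * K = flow B e * (K * (Qs + Qu)) := by rw [hd.add, mul_one]
        _ = flow B e * (K * (Qs * Qs)) + flow B e * (K * Qu) := by
          rw [hd.idem_s, mul_add, mul_add]
        _ = flow B e * ((K * Qs) * Qs) + flow B e * (K * Qu) := by rw [mul_assoc K]
        _ = flow B e * (Qs * K * Qs) + flow B e * (K * Qu) := by rw [hKs]
        _ = _ := by noncomm_ring
    rw [h2, hKu2, h1, mul_add, mul_smul_comm]
    have aux : ∀ L P R S T : CMat n, R = T → L - (P + (S + R)) - (L - S) = -P - T := by
      intro L P R S T hRT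
      rw [hRT]
      abel
    exact aux _ _ _ _ _ (by congr 1; noncomm_ring)
  rw [key]
  have hi : (i : ℝ) + 1 ≤ m := by exact_mod_cast i.2
  have hj : (j : ℝ) + 1 ≤ m := by exact_mod_cast j.2
  have hi0 : (0 : ℝ) ≤ i := by positivity
  have hj0 : (0 : ℝ) ≤ j := by positivity
  calc _ ≤ ‖flow B e * Qs‖ * ‖K * Qs‖ +
        ‖flow B (-(((m : ℝ) + 1 + j - i) * h)) * Qu‖ * ‖Z‖ := by
        refine (norm_sub_le _ _).trans ?_
        rw [norm_neg, norm_smul, hγ, one_mul]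
        exact add_le_add (norm_mul_le _ _) (norm_mul_le _ _)
    _ ≤ c * Real.exp (-g * e) * (2 * c) +
        c * Real.exp (-g * (((m : ℝ) + 1 + j - i) * h)) * (2 * c) := by
        gcongr
        · exact hd.bound_s _ (mul_nonneg (by linarith) (by linarith))
        · exact hd.bound_u _ (mul_nonneg (by linarith) (by linarith))
    _ = _ := by ring

end Kernels

/-! ### Comparison of the periodic determinant with that of the line. -/

section Grid

variable {n : ℕ}

/-- A system on the line whose coefficient converges exponentially to `B` at both ends. -/
structure IsLimitSystem (a : ℝ → CMat n) (B : CMat n) (L C ν : ℝ) : Prop where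
  cont : Continuous a
  norm_B : ‖B‖ ≤ L
  bound : ∀ x, ‖a x - B‖ ≤ C * Real.exp (-ν * |x|)

/-- The transition matrices of a system over the steps of a grid. -/
noncomputable def gridStep (a : ℝ → CMat n) (x₀ h : ℝ) (j : ℕ) : CMat n :=
  propagator a (x₀ + (j + 1) * h) (x₀ + j * h)

theorem evol_gridStep {a : ℝ → CMat n} (ha : Continuous a) (x₀ h : ℝ) (k : ℕ) :
    evol (gridStep a x₀ h) k = propagator a (x₀ + k * h) x₀ := by
  induction k with
  | zero => simp [evol, propagator_self ha]
  | succ k ih =>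
    rw [evol, ih, gridStep, propagator_mul ha]
    push_cast
    rfl

variable {a b : ℝ → CMat n} {B : CMat n} {L C ν : ℝ}

namespace IsLimitSystem

theorem C_nonneg (ha : IsLimitSystem a B L C ν) : 0 ≤ C := by
  have := (norm_nonneg _).trans (ha.bound 0)
  simpa using this

theorem L_nonneg (ha : IsLimitSystem a B L C ν) : 0 ≤ L := (norm_nonneg _).trans ha.norm_B

theorem norm_sub_le (ha : IsLimitSystem a B L C ν) (hν : 0 < ν) (x : ℝ) : ‖a x - B‖ ≤ C := by
  refine (ha.bound x).trans (mul_le_of_le_one_right ha.C_nonneg ?_)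
  rw [Real.exp_le_one_iff]
  nlinarith [abs_nonneg x]

theorem norm_le (ha : IsLimitSystem a B L C ν) (hν : 0 < ν) (x : ℝ) : ‖a x‖ ≤ L + C + 1 := by
  have h1 : ‖a x‖ ≤ ‖a x - B‖ + ‖B‖ := by simpa using norm_add_le (a x - B) B
  have := ha.norm_sub_le hν x
  have := ha.norm_B
  linarith

end IsLimitSystem

/-- The constant in the estimate of one step. -/
noncomputable def stepConst (L C ν : ℝ) : ℝ :=
  C * Real.exp (2 * ν) * (2 * Real.exp (4 * (L + 2 * C + 1)))

theorem stepConst_nonneg (hC : 0 ≤ C) : 0 ≤ stepConst L C ν := by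
  unfold stepConst
  positivity

/-- A step has length at most `2`, so the weight inside it differs from that at its left end by at
most `e^{2ν}`. -/
theorem norm_gridStep_sub_flow_le (ha : IsLimitSystem a B L C ν) (hν : 0 < ν) {h : ℝ}
    (hh : 1 ≤ h) (hh2 : h ≤ 2) (x₀ : ℝ) (j : ℕ) :
    ‖gridStep a x₀ h j - flow B h‖ ≤ stepConst L C ν * Real.exp (-ν * |x₀ + j * h|) := by
  have hC := ha.C_nonneg
  have hL := ha.L_nonneg
  have h1 := norm_propagator_sub_le (a := a) (b := fun _ => B) ha.cont continuous_const
    (x := x₀ + (j + 1) * h) (y := x₀ + j * h) (L := L + 2 * C + 1)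
    (δ := C * (Real.exp (2 * ν) * Real.exp (-ν * |x₀ + j * h|))) (by linarith) (by linarith)
    (fun s _ => (ha.norm_le hν s).trans (by linarith)) (fun s _ => ha.norm_B.trans (by linarith))
    (fun s hs => (ha.bound s).trans (by
      rw [← Real.exp_add]
      gcongr
      have h2 : |x₀ + j * h| ≤ |s| + 2 := by
        have h3 : |x₀ + j * h| ≤ |s| + |x₀ + j * h - s| := by
          simpa using abs_add_le s (x₀ + j * h - s)
        have h4 : |x₀ + j * h - s| ≤ 2 := abs_le.2 ⟨by linarith [hs.2], by linarith [hs.1]⟩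
        linarith
      nlinarith))
  rw [propagator_const, show x₀ + (j + 1) * h - (x₀ + j * h) = h by ring] at h1
  refine h1.trans ?_
  have h5 : h * Real.exp (2 * (L + 2 * C + 1) * h) ≤ 2 * Real.exp (4 * (L + 2 * C + 1)) := by
    have : 2 * (L + 2 * C + 1) * h ≤ 4 * (L + 2 * C + 1) := by nlinarith
    gcongr
  calc _ ≤ C * (Real.exp (2 * ν) * Real.exp (-ν * |x₀ + j * h|)) *
        (2 * Real.exp (4 * (L + 2 * C + 1))) := by gcongr
    _ = _ := by
        unfold stepConst
        ring

theorem norm_gridStep_sub_le (ha : IsLimitSystem a B L C ν) (hν : 0 < ν) (hb : Continuous b)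
    {h δ x₀ : ℝ} {j : ℕ} (hh : 1 ≤ h) (hh2 : h ≤ 2) (hδ : δ ≤ 1)
    (hab : ∀ s ∈ Set.Icc (x₀ + j * h) (x₀ + (j + 1) * h), ‖b s - a s‖ ≤ C * δ) :
    ‖gridStep b x₀ h j - gridStep a x₀ h j‖ ≤ stepConst L C ν * δ := by
  have hC := ha.C_nonneg
  have hL := ha.L_nonneg
  have hle : x₀ + j * h ≤ x₀ + (j + 1) * h := by linarith
  have hδ0 : 0 ≤ C * δ := (norm_nonneg _).trans (hab _ (Set.left_mem_Icc.2 hle))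
  have h1 := norm_propagator_sub_le hb ha.cont
    (x := x₀ + (j + 1) * h) (y := x₀ + j * h) (L := L + 2 * C + 1)
    (δ := C * δ) (by linarith) hle
    (fun s hs => by
      have e : ‖b s‖ ≤ ‖b s - a s‖ + ‖a s‖ := by simpa using norm_add_le (b s - a s) (a s)
      have := hab s hs
      have := ha.norm_le hν s
      nlinarith) (fun s _ => (ha.norm_le hν s).trans (by linarith)) hab
  rw [show x₀ + (j + 1) * h - (x₀ + j * h) = h by ring] at h1
  refine h1.trans ?_
  have h5 : h * Real.exp (2 * (L + 2 * C + 1) * h) ≤ 2 * Real.exp (4 * (L + 2 * C + 1)) := by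
    have : 2 * (L + 2 * C + 1) * h ≤ 4 * (L + 2 * C + 1) := by nlinarith
    gcongr
  calc _ ≤ (C * δ) * (2 * Real.exp (4 * (L + 2 * C + 1))) := by gcongr
    _ ≤ (C * δ) * (2 * Real.exp (4 * (L + 2 * C + 1))) * Real.exp (2 * ν) :=
        le_mul_of_one_le_right (by positivity) (Real.one_le_exp (by linarith))
    _ = _ := by
        unfold stepConst
        ring

/-- The kernel reflected at one end decays with the distance of `j` from the last grid point, the
defect with its distance from the center; the two distances add up to about `N`. Spending the rate
`η` on this gives `e^{-η N h}`, and what remains is summable in both `i` and `j`. -/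
theorem end_weight_right_le {g η ν h : ℝ} {N i j : ℕ} (hη : 0 < η) (hην : η ≤ ν) (hηg : η ≤ g)
    (hh : 1 ≤ h) (hh2 : h ≤ 2) (hj : j < 2 * N) :
    Real.exp (-g * (((i : ℝ) + (2 * N : ℕ) - 1 - j) * h)) * Real.exp (-ν * |-(N * h) + j * h|) ≤
      Real.exp (2 * η) * Real.exp (-η * (N * h)) * (Real.exp (-g * |(i : ℝ) - (0 : ℤ)|) *
        Real.exp (-(g - η) * |(j : ℝ) - (2 * N - 1 : ℤ)|)) := by
  rw [← Real.exp_add, ← Real.exp_add, ← Real.exp_add, ← Real.exp_add]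
  apply Real.exp_le_exp.2
  push_cast
  have hj' : (j : ℝ) + 1 ≤ 2 * N := by exact_mod_cast hj
  have hi : (0 : ℝ) ≤ i := by positivity
  rw [show -((N : ℝ) * h) + j * h = ((j : ℝ) - N) * h by ring, abs_mul,
    abs_of_nonneg (show 0 ≤ h by linarith), sub_zero, abs_of_nonneg hi,
    abs_of_nonpos (show (j : ℝ) - (2 * N - 1) ≤ 0 by linarith)]
  set k : ℝ := 2 * N - 1 - j with hk
  have hk0 : 0 ≤ k := by linarith
  have e1 : g * i ≤ g * i * h := le_mul_of_one_le_right (by nlinarith) hh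
  have e2 : (g - η) * k ≤ (g - η) * k * h := le_mul_of_one_le_right (by nlinarith) hh
  -- The last index is `2 N - 1`, so one step is lost; as `h ≤ 2`, the factor `e^{2η}` pays for it.
  have e3 : (N : ℝ) - 1 ≤ k + |(j : ℝ) - N| := by
    have := neg_le_abs ((j : ℝ) - N)
    have := le_abs_self ((j : ℝ) - N)
    simp only [k]
    linarith
  have e4 : η * |(j : ℝ) - N| ≤ ν * |(j : ℝ) - N| := by gcongr
  have e5 : η * ((N : ℝ) - 1) * h ≤ (η * k + ν * |(j : ℝ) - N|) * h := by
    gcongr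
    nlinarith
  have e6 : η * h ≤ η * 2 := by gcongr
  have e7 : (i : ℝ) + 2 * N - 1 - j = i + k := by rw [hk]; ring
  rw [e7, show (j : ℝ) - (2 * N - 1) = -k by rw [hk]; ring]
  nlinarith

/-- The mirror image: here the kernel decays with the distance of `j` from the first grid point, and
no step is lost. -/
theorem end_weight_left_le {g η ν h : ℝ} {N i j : ℕ} (hη : 0 < η) (hην : η ≤ ν) (hηg : η ≤ g)
    (hh : 1 ≤ h) (hi : i < 2 * N) :
    Real.exp (-g * ((((2 * N : ℕ) : ℝ) + 1 + j - i) * h)) * Real.exp (-ν * |-(N * h) + j * h|) ≤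
      Real.exp (-η * (N * h)) * (Real.exp (-g * |(i : ℝ) - (2 * N : ℤ)|) *
        Real.exp (-(g - η) * |(j : ℝ) - (0 : ℤ)|)) := by
  rw [← Real.exp_add, ← Real.exp_add, ← Real.exp_add]
  apply Real.exp_le_exp.2
  push_cast
  have hi' : (i : ℝ) + 1 ≤ 2 * N := by exact_mod_cast hi
  have hj : (0 : ℝ) ≤ j := by positivity
  rw [show -((N : ℝ) * h) + j * h = ((j : ℝ) - N) * h by ring, abs_mul,
    abs_of_nonneg (show 0 ≤ h by linarith), sub_zero, abs_of_nonneg hj,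
    abs_of_nonpos (show (i : ℝ) - 2 * N ≤ 0 by linarith)]
  set k : ℝ := 2 * N - i with hk
  have hk0 : 0 ≤ k := by linarith
  have hg : 0 < g := by linarith
  have e1 : g * (k + 1) ≤ g * (k + 1) * h := le_mul_of_one_le_right (by positivity) hh
  have e2 : (g - η) * j ≤ (g - η) * j * h := le_mul_of_one_le_right (by nlinarith) hh
  have e3 : (N : ℝ) ≤ j + |(j : ℝ) - N| := by
    have := neg_le_abs ((j : ℝ) - N)
    linarith
  have e4 : η * |(j : ℝ) - N| ≤ ν * |(j : ℝ) - N| := by gcongr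
  have e5 : η * (N : ℝ) * h ≤ (η * j + ν * |(j : ℝ) - N|) * h := by
    gcongr
    nlinarith
  have e7 : 2 * (N : ℝ) + 1 + j - i = k + 1 + j := by rw [hk]; ring
  rw [e7, show (i : ℝ) - 2 * N = -k by rw [hk]; ring]
  nlinarith

theorem sum_mul_fin_exp_le {α β : ℝ} (hα : 0 < α) (hβ : 0 < β) (m : ℕ) (s t : ℤ) :
    ∑ j : Fin m, ∑ i : Fin m, Real.exp (-α * |(i : ℝ) - s|) * Real.exp (-β * |(j : ℝ) - t|) ≤
      latticeSum α * latticeSum β := by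
  simp only [← Finset.sum_mul, ← Finset.mul_sum]
  exact mul_le_mul (sum_fin_exp_le hα m s) (sum_fin_exp_le hβ m t)
    (Finset.sum_nonneg fun _ _ => (Real.exp_pos _).le) (latticeSum_nonneg _)

theorem sum_norm_green_mul_le {m : ℕ} (T : Fin m → Fin m → CMat n) (Δ : Fin m → CMat n)
    {c S : ℝ} (hT : ∀ j, ∑ i, ‖T i j‖ ≤ c) (hΔ : ∑ j, ‖Δ j‖ ≤ S) (hc : 0 ≤ c) :
    ∑ j, ∑ i, ‖T i j * Δ j‖ ≤ c * S := by
  calc ∑ j, ∑ i, ‖T i j * Δ j‖ ≤ ∑ j, (∑ i, ‖T i j‖) * ‖Δ j‖ := by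
        refine Finset.sum_le_sum fun j _ => ?_
        rw [Finset.sum_mul]
        exact Finset.sum_le_sum fun i _ => norm_mul_le _ _
    _ ≤ ∑ j, c * ‖Δ j‖ := by
        gcongr
        exact hT _
    _ ≤ _ := by
        rw [← Finset.mul_sum]
        gcongr

theorem sum_norm_step_le (ha : IsLimitSystem a B L C ν) (hν : 0 < ν) {h : ℝ}
    (hh : 1 ≤ h) (hh2 : h ≤ 2) (N m : ℕ) :
    ∑ j : Fin m, ‖gridStep a (-(N * h)) h j - flow B h‖ ≤ stepConst L C ν * latticeSum ν := by
  calc _ ≤ ∑ j : Fin m, stepConst L C ν * Real.exp (-ν * |(j : ℝ) - (N : ℤ)|) := by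
        refine Finset.sum_le_sum fun j _ =>
          (norm_gridStep_sub_flow_le ha hν hh hh2 _ _).trans ?_
        have := stepConst_nonneg (L := L) (ν := ν) ha.C_nonneg
        gcongr ?_ * Real.exp ?_
        rw [show -((N : ℝ) * h) + (j : ℕ) * h = ((j : ℝ) - N) * h by ring, abs_mul,
          abs_of_nonneg (show 0 ≤ h by linarith)]
        push_cast
        have : |(j : ℝ) - N| ≤ |(j : ℝ) - N| * h := le_mul_of_one_le_right (abs_nonneg _) hh
        nlinarith
    _ ≤ _ := by
        rw [← Finset.mul_sum]
        exact mul_le_mul_of_nonneg_left (sum_fin_exp_le hν m N) (stepConst_nonneg ha.C_nonneg)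

theorem sum_norm_greenKernel_infinite_le {Qs Qu : CMat n} {c g : ℝ}
    (hd : IsDichotomy B Qs Qu c g) (hg : 0 < g) {h : ℝ} (hh : 1 ≤ h) (m : ℕ) (j : Fin m) :
    ∑ i, ‖greenKernel B (flow B (-(m * h)) * Qu) h m i j‖ ≤ c * latticeSum g := by
  calc _ ≤ ∑ i : Fin m, c * Real.exp (-g * |(i : ℝ) - ((j : ℤ) + 1 : ℤ)|) :=
        Finset.sum_le_sum fun i _ => norm_greenKernel_infinite_le hd hg hh m i j
    _ ≤ _ := by
        rw [← Finset.mul_sum]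
        exact mul_le_mul_of_nonneg_left (sum_fin_exp_le hg m _) hd.c_nonneg

set_option maxHeartbeats 1600000 in
/-- The determinant of the periodic problem is exponentially close to the one on the line. -/
theorem exists_norm_det_periodic_sub_le (n : ℕ) {L C ν θ g η c : ℝ} (hη : 0 < η) (hην : η < ν)
    (hηθ : η < θ) (hηg : η < g) :
    ∃ K, ∀ (a b : ℝ → CMat n) (B Qs Qu : CMat n) (N : ℕ) (h : ℝ) (γ : ℂ),
      IsLimitSystem a B L C ν → IsDichotomy B Qs Qu c g → Continuous b → 1 ≤ h → h ≤ 2 →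
      ‖γ‖ = 1 → c * Real.exp (-g * ((2 * N : ℕ) * h)) ≤ 1 / 2 →
      (∀ x, |x| ≤ N * h → ‖b x - a x‖ ≤ C * Real.exp (-θ * (N * h))) →
      ‖(1 + (flow B ((2 * N : ℕ) * h) - γ • (1 : CMat n))⁻¹ *
          (propagator b (N * h) (-(N * h)) - flow B ((2 * N : ℕ) * h))).det -
        (1 + (flow B (-((2 * N : ℕ) * h)) * Qu) *
          (propagator a (N * h) (-(N * h)) - flow B ((2 * N : ℕ) * h))).det‖ ≤
        K * Real.exp (-η * (N * h)) := by
  have hν : 0 < ν := hη.trans hην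
  have hg : 0 < g := hη.trans hηg
  set C₁ := stepConst L C ν
  set D := c * latticeSum g * (C₁ * latticeSum ν)
  -- The first two terms come from the reflections at the two ends, the third from the difference of
  -- the coefficients `a` and `b`.
  set E := 2 * c ^ 2 * C₁ * (Real.exp (2 * η) * (latticeSum g * latticeSum (g - η))) +
    2 * c ^ 2 * C₁ * (latticeSum g * latticeSum (g - η)) +
    (c * latticeSum g + 2 * c ^ 2 * latticeSum g + 2 * c ^ 2 * latticeSum g) *
      (2 * C₁ / (θ - η))
  refine ⟨(n : ℝ) ^ 2 * E * Real.exp ((n : ℝ) ^ 2 * D + (n : ℝ) ^ 2 * E + 1), ?_⟩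
  intro a b B Qs Qu N h γ ha hd hb hh hh2 hγ hs hab
  have hC := ha.C_nonneg
  have hc := hd.c_nonneg
  have hC₁ : 0 ≤ C₁ := stepConst_nonneg hC
  have hlg := latticeSum_nonneg g
  have hlgη := latticeSum_nonneg (g - η)
  have hθη : 0 < θ - η := by linarith
  have hE : 0 ≤ E := by positivity
  set x₀ : ℝ := -(N * h) with hx₀
  set m := 2 * N with hm
  set Kp := (flow B (m * h) - γ • (1 : CMat n))⁻¹
  set Ki := flow B (-(m * h)) * Qu
  have hev : ∀ d : ℝ → CMat n, Continuous d →
      propagator d (N * h) (-(N * h)) - flow B (m * h) =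
        evol (gridStep d x₀ h) m - flow B h ^ m := fun d hdc => by
    rw [evol_gridStep hdc, flow_nat_mul]
    congr 2
    rw [hx₀, hm]
    push_cast
    ring
  rw [hev b hb, hev a ha.cont, ← det_one_sub_green, ← det_one_sub_green]
  set Δa : Fin m → CMat n := fun j => gridStep a x₀ h j - flow B h
  set Δb : Fin m → CMat n := fun j => gridStep b x₀ h j - flow B h
  have hsumT : ∀ j : Fin m, ∑ i, ‖greenKernel B Ki h m i j‖ ≤ c * latticeSum g :=
    fun j => sum_norm_greenKernel_infinite_le hd hg hh m j
  have hD : ∑ j, ∑ i, ‖greenKernel B Ki h m i j * Δa j‖ ≤ D :=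
    sum_norm_green_mul_le _ _ hsumT (sum_norm_step_le ha hν hh hh2 N m) (by positivity)
  have hper : ∀ j i : Fin m, ‖greenKernel B Kp h m i j - greenKernel B Ki h m i j‖ ≤ _ :=
    fun j i => norm_greenKernel_periodic_sub_le hd hh m hs hγ i j
  have hdiff : ∑ j, ∑ i, ‖(greenKernel B Kp h m i j - greenKernel B Ki h m i j) * Δa j‖ ≤
      (2 * c ^ 2 * C₁ * (Real.exp (2 * η) * (latticeSum g * latticeSum (g - η))) +
        2 * c ^ 2 * C₁ * (latticeSum g * latticeSum (g - η))) * Real.exp (-η * (N * h)) := by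
    calc _ ≤ ∑ j : Fin m, ∑ i : Fin m, (2 * c ^ 2 * C₁ * (Real.exp (2 * η) *
            Real.exp (-η * (N * h))) * (Real.exp (-g * |(i : ℝ) - (0 : ℤ)|) *
              Real.exp (-(g - η) * |(j : ℝ) - (2 * N - 1 : ℤ)|)) +
          2 * c ^ 2 * C₁ * Real.exp (-η * (N * h)) * (Real.exp (-g * |(i : ℝ) - (2 * N : ℤ)|) *
            Real.exp (-(g - η) * |(j : ℝ) - (0 : ℤ)|))) := by
          refine Finset.sum_le_sum fun j _ => Finset.sum_le_sum fun i _ => ?_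
          have w1 := end_weight_right_le (i := i) hη hην.le hηg.le hh hh2 j.2
          have w2 := end_weight_left_le (j := j) hη hην.le hηg.le hh i.2
          calc _ ≤ ‖greenKernel B Kp h m i j - greenKernel B Ki h m i j‖ * ‖Δa j‖ :=
                norm_mul_le _ _
            _ ≤ (2 * c ^ 2 * Real.exp (-g * (((i : ℝ) + m - 1 - j) * h)) +
                2 * c ^ 2 * Real.exp (-g * (((m : ℝ) + 1 + j - i) * h))) *
                (C₁ * Real.exp (-ν * |x₀ + (j : ℕ) * h|)) := by
                gcongr
                · exact hper j i
                · exact norm_gridStep_sub_flow_le ha hν hh hh2 _ _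
            _ = 2 * c ^ 2 * C₁ * (Real.exp (-g * (((i : ℝ) + m - 1 - j) * h)) *
                  Real.exp (-ν * |x₀ + (j : ℕ) * h|)) +
                2 * c ^ 2 * C₁ * (Real.exp (-g * (((m : ℝ) + 1 + j - i) * h)) *
                  Real.exp (-ν * |x₀ + (j : ℕ) * h|)) := by ring
            _ ≤ _ := by
                rw [mul_assoc (2 * c ^ 2 * C₁), mul_assoc (2 * c ^ 2 * C₁)]
                gcongr
      _ ≤ _ := by
          simp only [Finset.sum_add_distrib, ← Finset.mul_sum]
          have s1 := sum_mul_fin_exp_le hg (sub_pos.2 hηg) m 0 (2 * N - 1)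
          have s2 := sum_mul_fin_exp_le hg (sub_pos.2 hηg) m (2 * N) 0
          calc _ ≤ 2 * c ^ 2 * C₁ * (Real.exp (2 * η) * Real.exp (-η * (N * h))) *
                (latticeSum g * latticeSum (g - η)) +
              2 * c ^ 2 * C₁ * Real.exp (-η * (N * h)) *
                (latticeSum g * latticeSum (g - η)) :=
                add_le_add (mul_le_mul_of_nonneg_left s1 (by positivity))
                  (mul_le_mul_of_nonneg_left s2 (by positivity))
            _ = _ := by ring
  have hTp : ∀ j : Fin m, ∑ i, ‖greenKernel B Kp h m i j‖ ≤
      c * latticeSum g + 2 * c ^ 2 * latticeSum g + 2 * c ^ 2 * latticeSum g := fun j => by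
    have hj : (j : ℝ) + 1 ≤ m := by exact_mod_cast j.2
    calc _ ≤ ∑ i : Fin m, (‖greenKernel B Ki h m i j‖ +
          2 * c ^ 2 * Real.exp (-g * |(i : ℝ) - (0 : ℤ)|) +
          2 * c ^ 2 * Real.exp (-g * |(i : ℝ) - (m : ℤ)|)) := by
          refine Finset.sum_le_sum fun i _ => ?_
          have hi : (i : ℝ) + 1 ≤ m := by exact_mod_cast i.2
          have hi0 : (0 : ℝ) ≤ i := by positivity
          have hj0 : (0 : ℝ) ≤ j := by positivity
          have h1 : ‖greenKernel B Kp h m i j‖ ≤ ‖greenKernel B Ki h m i j‖ +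
              ‖greenKernel B Kp h m i j - greenKernel B Ki h m i j‖ := by
            simpa using norm_add_le (greenKernel B Ki h m i j)
              (greenKernel B Kp h m i j - greenKernel B Ki h m i j)
          refine h1.trans ?_
          rw [add_assoc]
          gcongr
          refine (hper j i).trans ?_
          gcongr 2 * c ^ 2 * Real.exp ?_ + 2 * c ^ 2 * Real.exp ?_
          · push_cast
            rw [sub_zero, abs_of_nonneg hi0]
            have : (i : ℝ) ≤ ((i : ℝ) + m - 1 - j) * h :=
              le_trans (by linarith) (le_mul_of_one_le_right (by linarith) hh)
            nlinarith
          · push_cast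
            rw [abs_of_nonpos (by linarith)]
            have : (m : ℝ) - i ≤ ((m : ℝ) + 1 + j - i) * h :=
              le_trans (by linarith) (le_mul_of_one_le_right (by linarith) hh)
            nlinarith
      _ ≤ _ := by
          simp only [Finset.sum_add_distrib, ← Finset.mul_sum]
          have s1 := sum_fin_exp_le hg m 0
          have s2 := sum_fin_exp_le hg m m
          gcongr
          exact hsumT j
  have hΔ : ∑ j, ‖Δb j - Δa j‖ ≤ 2 * C₁ / (θ - η) * Real.exp (-η * (N * h)) := by
    have hstep : ∀ j : Fin m, ‖Δb j - Δa j‖ ≤ C₁ * Real.exp (-θ * (N * h)) := fun j => by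
      simp only [Δa, Δb, sub_sub_sub_cancel_right]
      refine norm_gridStep_sub_le ha hν hb hh hh2 ?_ fun s hs => hab s ?_
      · rw [Real.exp_le_one_iff]
        have : 0 ≤ (N : ℝ) * h := by positivity
        nlinarith
      · have hj : ((j : ℕ) : ℝ) + 1 ≤ 2 * N := by exact_mod_cast j.2
        have hj0 : (0 : ℝ) ≤ (j : ℕ) := by positivity
        rw [abs_le]
        constructor
        · nlinarith [hs.1]
        · nlinarith [hs.2]
    refine (Finset.sum_le_sum fun j _ => hstep j).trans ?_
    rw [Finset.sum_const, Finset.card_univ, Fintype.card_fin, nsmul_eq_mul, hm]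
    -- The one-step errors are merely uniform over the grid; the number of steps is absorbed by the
    -- spare exponent `θ - η`.
    have h1 : (θ - η) * (N : ℝ) ≤ Real.exp ((θ - η) * (N * h)) := by
      have : (θ - η) * (N : ℝ) ≤ (θ - η) * (N * h) := by
        gcongr
        exact le_mul_of_one_le_right (by positivity) hh
      linarith [Real.add_one_le_exp ((θ - η) * (N * h))]
    have h2 : Real.exp ((θ - η) * (N * h)) * Real.exp (-θ * (N * h)) =
        Real.exp (-η * (N * h)) := by
      rw [← Real.exp_add]
      ring_nf
    push_cast
    rw [← h2]
    calc 2 * (N : ℝ) * (C₁ * Real.exp (-θ * (N * h)))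
        = 2 * C₁ / (θ - η) * (((θ - η) * N) * Real.exp (-θ * (N * h))) := by
          field_simp
      _ ≤ _ := by gcongr
  -- The kernels are exchanged against the localized defect `Δa`, where the weights help; the
  -- defects are exchanged against the periodic kernel, whose column sums are bounded.
  have hδ : ∑ j, ∑ i, ‖greenKernel B Kp h m i j * Δb j - greenKernel B Ki h m i j * Δa j‖ ≤
      E * Real.exp (-η * (N * h)) := by
    calc _ ≤ ∑ j, ∑ i, (‖(greenKernel B Kp h m i j - greenKernel B Ki h m i j) * Δa j‖ +
          ‖greenKernel B Kp h m i j * (Δb j - Δa j)‖) := by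
          refine Finset.sum_le_sum fun j _ => Finset.sum_le_sum fun i _ => ?_
          refine le_trans (le_of_eq ?_) (norm_add_le _ _)
          congr 1
          noncomm_ring
      _ ≤ _ := by
          simp only [Finset.sum_add_distrib]
          have h3 := sum_norm_green_mul_le _ _ hTp hΔ (by positivity)
          refine (add_le_add hdiff h3).trans (le_of_eq ?_)
          simp only [E]
          ring
  refine (norm_det_blockMatrix_sub_le _ _ hD hδ).trans ?_
  have he1 : Real.exp (-η * (N * h)) ≤ 1 := by
    rw [Real.exp_le_one_iff]
    have : 0 ≤ (N : ℝ) * h := by positivity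
    nlinarith
  calc _ ≤ (n : ℝ) ^ 2 * (E * Real.exp (-η * (N * h))) *
        Real.exp ((n : ℝ) ^ 2 * D + (n : ℝ) ^ 2 * (E * 1) + 1) := by gcongr
    _ = _ := by ring_nf

end Grid

/-! ### The determinant on the line and its convergence in the window. -/

section LineDeterminant

variable {n : ℕ} {a : ℝ → CMat n} {B Qs Qu : CMat n} {L C ν c g : ℝ}

/-- The determinant of the discretized problem on the line, with the coefficient cut off outside
`[-N h, N h]`. -/
noncomputable def lineDet (a : ℝ → CMat n) (B Qu : CMat n) (h : ℝ) (N : ℕ) : ℂ :=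
  (1 + (flow B (-((2 * N : ℕ) * h)) * Qu) *
    (propagator a (N * h) (-(N * h)) - flow B ((2 * N : ℕ) * h))).det

theorem evol_add (Φ : ℕ → CMat n) (k l : ℕ) :
    evol Φ (k + l) = evol (fun j => Φ (k + j)) l * evol Φ k := by
  induction l with
  | zero => simp [evol]
  | succ l ih => rw [← add_assoc, evol, ih, evol, mul_assoc]

theorem evol_congr {Φ Φ' : ℕ → CMat n} {k : ℕ} (h : ∀ j < k, Φ j = Φ' j) :
    evol Φ k = evol Φ' k := by
  induction k with
  | zero => rfl
  | succ k ih => rw [evol, evol, ih fun j hj => h j (by omega), h k (by omega)]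

theorem evol_const (G : CMat n) (k : ℕ) : evol (fun _ => G) k = G ^ k := by
  induction k with
  | zero => simp [evol]
  | succ k ih => rw [evol, ih, pow_succ']

/-- The grid transition matrices, replaced by `G` outside a window. -/
noncomputable def cutoffStep (a : ℝ → CMat n) (B : CMat n) (h : ℝ) (N r : ℕ) (j : ℕ) : CMat n :=
  if r ≤ j ∧ j < r + 2 * N then gridStep a (-((N + r : ℕ) * h)) h j else flow B h

theorem evol_cutoffStep (ha : Continuous a) (h : ℝ) (N r : ℕ) :
    evol (cutoffStep a B h N r) (2 * (N + r)) =
      flow B (r * h) * propagator a (N * h) (-(N * h)) * flow B (r * h) := by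
  rw [show 2 * (N + r) = r + (2 * N + r) by ring, evol_add, evol_add]
  have h1 : evol (cutoffStep a B h N r) r = flow B (r * h) := by
    have e : ∀ j < r, cutoffStep a B h N r j = (fun _ => flow B h) j := fun j hj =>
      if_neg (by omega)
    rw [evol_congr e, evol_const, flow_nat_mul]
  have h3 : evol (fun j => cutoffStep a B h N r (r + (2 * N + j))) r = flow B (r * h) := by
    have e : ∀ j < r, cutoffStep a B h N r (r + (2 * N + j)) = (fun _ => flow B h) j :=
      fun j hj => if_neg (by omega)
    rw [evol_congr e, evol_const, flow_nat_mul]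
  have h2 : evol (fun j => cutoffStep a B h N r (r + j)) (2 * N) =
      propagator a (N * h) (-(N * h)) := by
    rw [evol_congr (Φ' := gridStep a (-(N * h)) h) fun j hj => by
      rw [cutoffStep, if_pos (by omega), gridStep, gridStep]
      push_cast
      ring_nf, evol_gridStep ha]
    congr 1
    push_cast
    ring
  rw [h1, h2, h3]

theorem lineDet_eq_blockMatrix (ha : Continuous a) (h : ℝ) (N : ℕ) :
    lineDet a B Qu h N = (1 - blockMatrix fun i j : Fin (2 * N) =>
      greenKernel B (flow B (-((2 * N : ℕ) * h)) * Qu) h (2 * N) i j *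
        (gridStep a (-(N * h)) h j - flow B h)).det := by
  unfold greenKernel
  rw [det_one_sub_green, evol_gridStep ha, flow_nat_mul, lineDet]
  congr 4
  push_cast
  ring_nf

/-- Padding the window with free flow conjugates the small determinant by `flow B (r * h)`, hence
does not change it. Determinants for different windows can thus be compared on one grid with one
kernel. -/
theorem lineDet_eq_cutoff (hd : IsDichotomy B Qs Qu c g) (ha : Continuous a) (h : ℝ) (N r : ℕ) :
    lineDet a B Qu h N = (1 - blockMatrix fun i j : Fin (2 * (N + r)) =>
      greenKernel B (flow B (-((2 * (N + r) : ℕ) * h)) * Qu) h (2 * (N + r)) i j *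
        (cutoffStep a B h N r j - flow B h)).det := by
  unfold greenKernel
  rw [det_one_sub_green, evol_cutoffStep ha, flow_nat_mul, lineDet]
  set F := propagator a (N * h) (-(N * h))
  have h1 : flow B ((2 * (N + r) : ℕ) * h) =
      flow B (r * h) * flow B ((2 * N : ℕ) * h) * flow B (r * h) := by
    rw [← flow_add, ← flow_add]
    congr 1
    push_cast
    ring
  have h2 : flow B (-((2 * (N + r) : ℕ) * h)) * Qu * flow B (r * h) =
      flow B (-(r * h)) * (flow B (-((2 * N : ℕ) * h)) * Qu) := by
    rw [mul_assoc, ← hd.flow_comm_u, ← mul_assoc, ← mul_assoc, ← flow_add, ← flow_add]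
    congr 2
    push_cast
    ring
  have h3 : (flow B (-((2 * (N + r) : ℕ) * h)) * Qu) *
      (flow B (r * h) * F * flow B (r * h) - flow B ((2 * (N + r) : ℕ) * h)) =
      flow B (-(r * h)) * ((flow B (-((2 * N : ℕ) * h)) * Qu) *
        (F - flow B ((2 * N : ℕ) * h)) * flow B (r * h)) := by
    rw [h1]
    calc _ = (flow B (-((2 * (N + r) : ℕ) * h)) * Qu * flow B (r * h)) *
          (F - flow B ((2 * N : ℕ) * h)) * flow B (r * h) := by noncomm_ring
      _ = _ := by rw [h2]; noncomm_ring
  rw [h3, Matrix.det_one_add_mul_comm (flow B (-(r * h))), mul_assoc _ (flow B (r * h)), flow_mul_neg, mul_one]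

theorem norm_lineDet_le (ha : IsLimitSystem a B L C ν) (hd : IsDichotomy B Qs Qu c g)
    (hν : 0 < ν) (hg : 0 < g) {h : ℝ} (hh : 1 ≤ h) (hh2 : h ≤ 2) (N : ℕ) :
    ‖lineDet a B Qu h N‖ ≤
      Real.exp ((n : ℝ) ^ 2 * (c * latticeSum g * (stepConst L C ν * latticeSum ν))) := by
  rw [lineDet_eq_blockMatrix ha.cont, sub_eq_add_neg]
  refine (norm_det_one_add_le _).trans (Real.exp_le_exp.2 ?_)
  simp only [Matrix.neg_apply, norm_neg]
  refine (sum_norm_blockMatrix_le _).trans ?_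
  gcongr
  exact sum_norm_green_mul_le _ _ (fun j => sum_norm_greenKernel_infinite_le hd hg hh _ j)
    (sum_norm_step_le ha hν hh hh2 N _) (mul_nonneg hd.c_nonneg (latticeSum_nonneg _))

/-- The steps differ only outside the window, at index distance at least `N` from the center. The
part `η` of the decay rate yields the exponential and the part `ν - η` the convergent sum. -/
theorem sum_norm_cutoff_sub_le (ha : IsLimitSystem a B L C ν) {η : ℝ} (hη : 0 < η) (hην : η < ν)
    {h : ℝ} (hh : 1 ≤ h) (hh2 : h ≤ 2) (N r : ℕ) :
    ∑ j : Fin (2 * (N + r)), ‖(gridStep a (-((N + r : ℕ) * h)) h j - flow B h) -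
        (cutoffStep a B h N r j - flow B h)‖ ≤
      stepConst L C ν * latticeSum (ν - η) * Real.exp (-η * (N * h)) := by
  have hC₁ := stepConst_nonneg (L := L) (ν := ν) ha.C_nonneg
  calc _ ≤ ∑ j : Fin (2 * (N + r)), stepConst L C ν * Real.exp (-η * (N * h)) *
        Real.exp (-(ν - η) * |(j : ℝ) - (N + r : ℤ)|) := by
        refine Finset.sum_le_sum fun j _ => ?_
        rw [cutoffStep]
        split_ifs with hj
        · simp only [sub_self, norm_zero]
          positivity
        · rw [sub_self, sub_zero]
          refine (norm_gridStep_sub_flow_le ha (hη.trans hην) hh hh2 _ _).trans ?_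
          rw [mul_assoc, ← Real.exp_add]
          gcongr ?_ * Real.exp ?_
          have hN : (N : ℝ) ≤ |(j : ℝ) - (N + r)| := by
            rcases lt_or_ge (j : ℕ) r with h1 | h1
            · have h2 : (j : ℝ) ≤ r := by exact_mod_cast h1.le
              refine le_trans ?_ (neg_le_abs _)
              linarith
            · have h2 : (r : ℝ) + 2 * N ≤ j := by
                have : r + 2 * N ≤ (j : ℕ) := by omega
                exact_mod_cast this
              refine le_trans ?_ (le_abs_self _)
              linarith
          push_cast
          rw [show -(((N : ℝ) + r) * h) + (j : ℕ) * h = ((j : ℝ) - (N + r)) * h by ring, abs_mul,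
            abs_of_nonneg (show 0 ≤ h by linarith)]
          set d := |(j : ℝ) - (N + r)|
          have hd : 0 ≤ d := abs_nonneg _
          have e1 : (ν - η) * d ≤ (ν - η) * d * h :=
            le_mul_of_one_le_right (mul_nonneg (by linarith) hd) hh
          have e2 : η * N * h ≤ η * d * h := by gcongr
          nlinarith
    _ ≤ _ := by
        rw [← Finset.mul_sum]
        calc _ ≤ stepConst L C ν * Real.exp (-η * (N * h)) * latticeSum (ν - η) :=
              mul_le_mul_of_nonneg_left (by
                simpa using sum_fin_exp_le (sub_pos.2 hην) (2 * (N + r)) (N + r : ℤ))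
                (by positivity)
          _ = _ := by ring

/-- The bound is uniform in `r`, which makes the determinants a Cauchy sequence with an explicit
rate. -/
theorem exists_norm_lineDet_sub_le (n : ℕ) {L C ν g η c : ℝ} (hη : 0 < η) (hην : η < ν)
    (hg : 0 < g) :
    ∃ K, ∀ (a : ℝ → CMat n) (B Qs Qu : CMat n) (N r : ℕ) (h : ℝ),
      IsLimitSystem a B L C ν → IsDichotomy B Qs Qu c g → 1 ≤ h → h ≤ 2 →
      ‖lineDet a B Qu h (N + r) - lineDet a B Qu h N‖ ≤ K * Real.exp (-η * (N * h)) := by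
  have hν : 0 < ν := hη.trans hην
  set D := c * latticeSum g * (stepConst L C ν * (latticeSum ν + latticeSum (ν - η)))
  set E := c * latticeSum g * (stepConst L C ν * latticeSum (ν - η))
  refine ⟨(n : ℝ) ^ 2 * E * Real.exp ((n : ℝ) ^ 2 * D + (n : ℝ) ^ 2 * E + 1), ?_⟩
  intro a B Qs Qu N r h ha hd hh hh2
  have hC₁ := stepConst_nonneg (L := L) (ν := ν) ha.C_nonneg
  have hc := hd.c_nonneg
  have hlg := latticeSum_nonneg g
  have hlν := latticeSum_nonneg (ν - η)
  have hE : 0 ≤ E := by positivity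
  have he1 : Real.exp (-η * (N * h)) ≤ 1 := by
    rw [Real.exp_le_one_iff]
    have : 0 ≤ (N : ℝ) * h := by positivity
    nlinarith
  rw [lineDet_eq_blockMatrix ha.cont, lineDet_eq_cutoff hd ha.cont h N r]
  have hT := fun j => sum_norm_greenKernel_infinite_le hd hg hh (2 * (N + r)) j
  have hδ : ∑ j : Fin (2 * (N + r)), ∑ i : Fin (2 * (N + r)),
      ‖greenKernel B (flow B (-((2 * (N + r) : ℕ) * h)) * Qu) h (2 * (N + r)) i j *
          (gridStep a (-((N + r : ℕ) * h)) h j - flow B h) -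
        greenKernel B (flow B (-((2 * (N + r) : ℕ) * h)) * Qu) h (2 * (N + r)) i j *
          (cutoffStep a B h N r j - flow B h)‖ ≤ E * Real.exp (-η * (N * h)) := by
    simp only [← mul_sub]
    refine (sum_norm_green_mul_le _ _ hT (sum_norm_cutoff_sub_le ha hη hην hh hh2 N r)
      (by positivity)).trans (le_of_eq ?_)
    simp only [E]
    ring
  have hD : ∑ j : Fin (2 * (N + r)), ∑ i : Fin (2 * (N + r)),
      ‖greenKernel B (flow B (-((2 * (N + r) : ℕ) * h)) * Qu) h (2 * (N + r)) i j *
          (cutoffStep a B h N r j - flow B h)‖ ≤ D := by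
    refine sum_norm_green_mul_le _ _ hT ?_ (by positivity)
    rw [mul_add (stepConst L C ν)]
    calc _ ≤ ∑ j : Fin (2 * (N + r)), (‖gridStep a (-((N + r : ℕ) * h)) h j - flow B h‖ +
          ‖(gridStep a (-((N + r : ℕ) * h)) h j - flow B h) -
            (cutoffStep a B h N r j - flow B h)‖) :=
          Finset.sum_le_sum fun j _ => by
            refine (norm_le_norm_add_norm_sub' _ (gridStep a (-((N + r : ℕ) * h)) h j -
              flow B h)).trans ?_
            rw [norm_sub_rev (cutoffStep a B h N r j - flow B h)]
      _ ≤ _ := by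
          rw [Finset.sum_add_distrib]
          refine add_le_add (sum_norm_step_le ha hν hh hh2 (N + r) _)
            ((sum_norm_cutoff_sub_le ha hη hην hh hh2 N r).trans
              (mul_le_of_le_one_right (by positivity) he1))
  refine (norm_det_blockMatrix_sub_le _ _ hD hδ).trans ?_
  have h5 : (n : ℝ) ^ 2 * D + (n : ℝ) ^ 2 * (E * Real.exp (-η * (N * h))) + 1 ≤
      (n : ℝ) ^ 2 * D + (n : ℝ) ^ 2 * E + 1 := by
    have : E * Real.exp (-η * (N * h)) ≤ E := mul_le_of_le_one_right hE he1
    gcongr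
  calc _ ≤ (n : ℝ) ^ 2 * (E * Real.exp (-η * (N * h))) *
        Real.exp ((n : ℝ) ^ 2 * D + (n : ℝ) ^ 2 * E + 1) :=
        mul_le_mul_of_nonneg_left (Real.exp_le_exp.2 h5) (by positivity)
    _ = _ := by ring

end LineDeterminant

/-! ### Convergence of the ratio of Wronskians. -/

section Normalization

variable {n : ℕ} {a : ℝ → CMat n} {B : CMat n} {L C ν : ℝ}

theorem norm_propagator_backward_le (ha : Continuous a) {x y : ℝ} (hxy : y ≤ x)
    (hL : ∀ s ∈ Set.Icc y x, ‖a s‖ ≤ L) : ‖propagator a y x‖ ≤ Real.exp (L * (x - y)) := by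
  have hder : ∀ s, HasDerivAt (fun s => propagator a (-s) x) (-a (-s) * propagator a (-s) x) s :=
    fun s => by
      have h := (hasDerivAt_propagator ha (-s) x).scomp s (hasDerivAt_neg s)
      refine h.congr_deriv ?_
      rw [neg_one_smul, neg_mul]
  have h := norm_solution_le (a := fun s => -a (-s)) (Y := fun s => propagator a (-s) x)
    (x := -y) (y := -x) (L := L) (by linarith) hder (fun s hs => by
      rw [norm_neg]
      exact hL _ ⟨by linarith [hs.2], by linarith [hs.1]⟩)
  simp only [neg_neg, propagator_self ha] at h
  refine (h.trans (mul_le_of_le_one_left (Real.exp_pos _).le (norm_one_matrix_le n))).trans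
    (le_of_eq ?_)
  ring_nf

/-- The ratio of the Wronskians of the limiting and of the full system. -/
noncomputable def wronskianRatio (a : ℝ → CMat n) (B : CMat n) (x : ℝ) : ℂ :=
  (flow B x).det / (solutionOperator a x).det

theorem det_evol (Φ : ℕ → CMat n) (k : ℕ) : (evol Φ k).det = ∏ j ∈ Finset.range k, (Φ j).det := by
  induction k with
  | zero => simp [evol]
  | succ k ih => rw [evol, Matrix.det_mul, ih, Finset.prod_range_succ, mul_comm]

/-- The determinants of the steps telescope; each factor is one up to an error that decays along the
grid. -/
theorem wronskianRatio_eq_prod (ha : Continuous a) (h : ℝ) (N : ℕ) :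
    wronskianRatio a B (N * h) =
      ∏ j ∈ Finset.range N, (1 + (((gridStep a 0 h j)⁻¹ * flow B h).det - 1)) := by
  simp only [add_sub_cancel, Matrix.det_mul, Matrix.det_nonsing_inv, Ring.inverse_eq_inv']
  rw [Finset.prod_mul_distrib, Finset.prod_inv_distrib, ← det_evol, evol_gridStep ha,
    Finset.prod_const, Finset.card_range, ← Matrix.det_pow, flow_nat_mul, wronskianRatio, zero_add,
    propagator_zero ha, div_eq_inv_mul]

theorem norm_det_sub_one_le (M : CMat n) {δ : ℝ} (hM : ‖M - 1‖ ≤ δ) :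
    ‖M.det - 1‖ ≤ (n : ℝ) ^ 2 * δ * Real.exp ((n : ℝ) ^ 2 * δ + 1) := by
  have h := norm_det_one_add_sub_le (M - 1) 0 (D := 0) (δ := (n : ℝ) ^ 2 * δ) (by simp) (by
    calc ∑ i, ∑ j, ‖(M - 1) j i - (0 : CMat n) j i‖ ≤ ∑ _i : Fin n, ∑ _j : Fin n, δ := by
          gcongr
          rw [Matrix.zero_apply, sub_zero]
          exact (norm_entry_le _ _ _).trans hM
      _ = _ := by simp [sq, mul_assoc])
  simpa using h

/-- The constant in the estimate of the Wronskian over one step. -/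
noncomputable def wronskianConst (n : ℕ) (L C ν : ℝ) : ℝ :=
  (n : ℝ) ^ 2 * (Real.exp (2 * (L + C + 1)) * stepConst L C ν) *
    Real.exp ((n : ℝ) ^ 2 * (Real.exp (2 * (L + C + 1)) * stepConst L C ν) + 1)

theorem norm_det_gridStep_ratio_sub_one_le (ha : IsLimitSystem a B L C ν) (hν : 0 < ν) {h : ℝ}
    (hh : 1 ≤ h) (hh2 : h ≤ 2) (j : ℕ) :
    ‖((gridStep a 0 h j)⁻¹ * flow B h).det - 1‖ ≤
      wronskianConst n L C ν * Real.exp (-ν * (j * h)) := by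
  have hC := ha.C_nonneg
  have hL := ha.L_nonneg
  have hC₁ := stepConst_nonneg (L := L) (ν := ν) hC
  have hjh : 0 ≤ (j : ℝ) * h := by positivity
  have h1 : gridStep a 0 h j * propagator a (0 + j * h) (0 + (j + 1) * h) = 1 := by
    rw [gridStep, propagator_mul ha.cont, propagator_self ha.cont]
  rw [Matrix.inv_eq_right_inv h1]
  set R := propagator a (0 + j * h) (0 + (j + 1) * h)
  have h2 : R * gridStep a 0 h j = 1 := by
    rw [gridStep, propagator_mul ha.cont, propagator_self ha.cont]
  have hR : ‖R‖ ≤ Real.exp (2 * (L + C + 1)) := by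
    refine (norm_propagator_backward_le ha.cont (by linarith)
      fun s _ => ha.norm_le hν s).trans (Real.exp_le_exp.2 ?_)
    nlinarith
  have h3 : ‖R * flow B h - 1‖ ≤
      Real.exp (2 * (L + C + 1)) * stepConst L C ν * Real.exp (-ν * (j * h)) := by
    have e : R * flow B h - 1 = -(R * (gridStep a 0 h j - flow B h)) := by
      rw [mul_sub, h2, neg_sub]
    have h4 := norm_gridStep_sub_flow_le ha hν hh hh2 0 j
    rw [zero_add, abs_of_nonneg hjh] at h4
    rw [e, norm_neg, mul_assoc]
    exact (norm_mul_le _ _).trans (mul_le_mul hR h4 (norm_nonneg _) (Real.exp_pos _).le)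
  refine (norm_det_sub_one_le _ h3).trans ?_
  have h5 : Real.exp (-ν * (j * h)) ≤ 1 := by
    rw [Real.exp_le_one_iff]
    nlinarith
  have h6 : Real.exp (2 * (L + C + 1)) * stepConst L C ν * Real.exp (-ν * (j * h)) ≤
      Real.exp (2 * (L + C + 1)) * stepConst L C ν := mul_le_of_le_one_right (by positivity) h5
  calc _ ≤ (n : ℝ) ^ 2 * (Real.exp (2 * (L + C + 1)) * stepConst L C ν *
        Real.exp (-ν * (j * h))) *
        Real.exp ((n : ℝ) ^ 2 * (Real.exp (2 * (L + C + 1)) * stepConst L C ν) + 1) := by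
        gcongr
    _ = _ := by
        unfold wronskianConst
        ring

/-- Enlarging the window multiplies the ratio by a tail product, which is `1` up to the sum of the
remaining errors. -/
theorem exists_norm_wronskianRatio_le (n : ℕ) {L C ν η : ℝ} (hη : 0 < η) (hην : η < ν) :
    ∃ K, ∀ (a : ℝ → CMat n) (B : CMat n) (N r : ℕ) (h : ℝ),
      IsLimitSystem a B L C ν → 1 ≤ h → h ≤ 2 →
      ‖wronskianRatio a B (N * h)‖ ≤ K ∧
      ‖wronskianRatio a B ((N + r : ℕ) * h) - wronskianRatio a B (N * h)‖ ≤
        K * Real.exp (-η * (N * h)) := by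
  have hν : 0 < ν := hη.trans hην
  set W := wronskianConst n L C ν
  set S := W * latticeSum (ν - η)
  refine ⟨Real.exp S + Real.exp S * (S * Real.exp S), ?_⟩
  intro a B N r h ha hh hh2
  have hC₁ := stepConst_nonneg (L := L) (ν := ν) ha.C_nonneg
  have hW : 0 ≤ W := by
    simp only [W, wronskianConst]
    positivity
  have hS : 0 ≤ S := mul_nonneg hW (latticeSum_nonneg _)
  set ρ : ℕ → ℂ := fun j => ((gridStep a 0 h j)⁻¹ * flow B h).det - 1
  have hρ : ∀ k j : ℕ, ‖ρ (k + j)‖ ≤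
      W * Real.exp (-η * (k * h)) * Real.exp (-(ν - η) * |(j : ℝ) - (0 : ℤ)|) := fun k j => by
    refine (norm_det_gridStep_ratio_sub_one_le ha hν hh hh2 _).trans ?_
    rw [mul_assoc, ← Real.exp_add]
    gcongr W * Real.exp ?_
    push_cast
    rw [sub_zero, abs_of_nonneg (by positivity : (0 : ℝ) ≤ j)]
    have hk : (0 : ℝ) ≤ k * h := by positivity
    have e1 : (j : ℝ) ≤ j * h := le_mul_of_one_le_right (by positivity) hh
    have e2 : η * (k * h) ≤ ν * (k * h) := by gcongr
    have hj0 : (0 : ℝ) ≤ j := by positivity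
    nlinarith [mul_le_mul_of_nonneg_left e1 hν.le, mul_nonneg hη.le hj0]
  have hsum : ∀ k l : ℕ, ∑ j ∈ Finset.range l, ‖ρ (k + j)‖ ≤ S * Real.exp (-η * (k * h)) :=
    fun k l => by
      calc _ ≤ ∑ j ∈ Finset.range l, W * Real.exp (-η * (k * h)) *
            Real.exp (-(ν - η) * |(j : ℝ) - (0 : ℤ)|) := Finset.sum_le_sum fun j _ => hρ k j
        _ = W * Real.exp (-η * (k * h)) *
            ∑ j : Fin l, Real.exp (-(ν - η) * |(j : ℝ) - (0 : ℤ)|) := by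
            rw [← Finset.mul_sum, ← Fin.sum_univ_eq_sum_range
              (fun j : ℕ => Real.exp (-(ν - η) * |(j : ℝ) - (0 : ℤ)|))]
        _ ≤ W * Real.exp (-η * (k * h)) * latticeSum (ν - η) :=
            mul_le_mul_of_nonneg_left (sum_fin_exp_le (sub_pos.2 hην) l 0) (by positivity)
        _ = _ := by
            simp only [S]
            ring
  have hb1 : ‖wronskianRatio a B (N * h)‖ ≤ Real.exp S := by
    rw [wronskianRatio_eq_prod ha.cont]
    have h1 := hsum 0 N
    simp only [zero_add, Nat.cast_zero, zero_mul, mul_zero, Real.exp_zero, mul_one] at h1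
    calc ‖∏ j ∈ Finset.range N, (1 + ρ j)‖ ≤ ∏ j ∈ Finset.range N, (1 + ‖ρ j‖) := by
          rw [norm_prod]
          gcongr with j
          exact (norm_add_le _ _).trans (by rw [norm_one])
      _ ≤ Real.exp (∑ j ∈ Finset.range N, ‖ρ j‖) :=
          Real.prod_one_add_le_exp_sum _ fun _ => norm_nonneg _
      _ ≤ _ := Real.exp_le_exp.2 h1
  have he1 : Real.exp (-η * (N * h)) ≤ 1 := by
    rw [Real.exp_le_one_iff]
    have : 0 ≤ (N : ℝ) * h := by positivity
    nlinarith
  refine ⟨hb1.trans (le_add_of_nonneg_right (by positivity)), ?_⟩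
  have e : wronskianRatio a B ((N + r : ℕ) * h) - wronskianRatio a B (N * h) =
      wronskianRatio a B (N * h) * (∏ j ∈ Finset.range r, (1 + ρ (N + j)) - 1) := by
    rw [wronskianRatio_eq_prod ha.cont, Finset.prod_range_add, ← wronskianRatio_eq_prod ha.cont]
    ring
  rw [e]
  set y := ∑ j ∈ Finset.range r, ‖ρ (N + j)‖
  have hy0 : 0 ≤ y := Finset.sum_nonneg fun _ _ => norm_nonneg _
  have hyS : y ≤ S * Real.exp (-η * (N * h)) := hsum N r
  have hyS' : y ≤ S := hyS.trans (mul_le_of_le_one_right hS he1)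
  have hexp : Real.exp y - 1 ≤ y * Real.exp y := by
    have h2 := Real.add_one_le_exp (-y)
    have h3 : Real.exp (-y) * Real.exp y = 1 := by rw [← Real.exp_add]; simp
    nlinarith [Real.exp_pos y]
  calc _ ≤ Real.exp S * (S * Real.exp (-η * (N * h)) * Real.exp S) := by
        rw [norm_mul]
        gcongr
        refine (Finset.norm_prod_one_add_sub_one_le _ _).trans (hexp.trans ?_)
        gcongr
    _ ≤ _ := by
        have := Real.exp_pos S
        have := Real.exp_pos (-η * (N * h))
        nlinarith [mul_pos (Real.exp_pos S) (Real.exp_pos (-η * (N * h)))]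

end Normalization

/-! ### Determinant identities relative to complementary projections. -/

section BlockAlgebra

variable {n : ℕ}

/-- Relative to the splitting the matrix is block triangular with identity on the stable block; the
off-diagonal part is a unipotent factor. -/
theorem det_add_proj_mul {Qs Qu : CMat n} (hsu : Qs * Qu = 0) (huu : Qu * Qu = Qu)
    (hus : Qu * Qs = 0) (hss : Qs * Qs = Qs) (hadd : Qs + Qu = 1) (Y : CMat n) :
    (Qs + Qu * Y).det = (Qs + Qu * Y * Qu).det := by
  have h : Qs + Qu * Y = (1 + Qu * Y * Qs) * (Qs + Qu * Y * Qu) := by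
    have h1 : Qu * Y * Qs + Qu * Y * Qu = Qu * Y := by rw [← mul_add, hadd, mul_one]
    rw [← h1]
    simp only [mul_add, add_mul, mul_assoc, hss, hsu, one_mul, mul_zero, zero_add]
    have h2 : ∀ x, Qs * (Qu * x) = 0 := fun x => by rw [← mul_assoc, hsu, zero_mul]
    simp only [h2, hus, huu, mul_zero, add_zero]
    abel
  rw [h, Matrix.det_mul, Matrix.det_one_add_mul_comm, ← mul_assoc, hsu, zero_mul, add_zero,
    Matrix.det_one, one_mul]

theorem det_add_mul_proj {Qs Qu : CMat n} (hsu : Qs * Qu = 0)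
    (hus : Qu * Qs = 0) (hss : Qs * Qs = Qs) (hadd : Qs + Qu = 1) (Y : CMat n) :
    (Qs + Y * Qu).det = (Qs + Qu * Y * Qu).det := by
  have h : Qs + Y * Qu = (Qs + Qu * Y * Qu) * (1 + Qs * (Y * Qu)) := by
    have h1 : Qs * (Y * Qu) + Qu * (Y * Qu) = Y * Qu := by rw [← add_mul, hadd, one_mul]
    rw [← h1]
    have h2 : ∀ x, Qu * (Qs * x) = 0 := fun x => by rw [← mul_assoc, hus, zero_mul]
    have h3 : ∀ x, Qs * (Qs * x) = Qs * x := fun x => by rw [← mul_assoc, hss]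
    have h4 : ∀ x, Qs * (Qu * x) = 0 := fun x => by rw [← mul_assoc, hsu, zero_mul]
    simp only [mul_add, add_mul, mul_assoc, mul_one, h2, h3, h4, mul_zero, add_zero]
    abel
  rw [h, Matrix.det_mul, Matrix.det_one_add_mul_comm, mul_assoc Y, hus, mul_zero, add_zero,
    Matrix.det_one, mul_one]

/-- The determinant of the cut-off problem on the line, factored so that each factor converges. -/
theorem det_proj_add_sandwich {Qs Qu U V : CMat n} (hsu : Qs * Qu = 0) (hus : Qu * Qs = 0)
    (huu : Qu * Qu = Qu) (hss : Qs * Qs = Qs) (hadd : Qs + Qu = 1) (hUV : U * V = 1)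
    (hVU : V * U = 1) (hUs : U * Qs = Qs * U) (hUu : U * Qu = Qu * U) (hVu : V * Qu = Qu * V)
    {p q p' q' : CMat n} (C : CMat n) (hp : (Qs + Qu * p * Qu) * p' = 1)
    (hq : q' * (Qs + Qu * q * Qu) = 1) :
    (Qs + V * V * Qu * (p * U * C * U * q)).det =
      (Qs + Qu * p * Qu).det * (Qs + Qu * q * Qu).det *
        (Qs + (Qu + V * Qu * p' * Qu * p * Qs * U) * C *
          (Qu + U * Qs * q * Qu * q' * Qu * V)).det := by
  have hVs : V * Qs = Qs * V := by
    rw [eq_sub_of_add_eq hadd, mul_sub, sub_mul, hVu, mul_one, one_mul]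
  have a1 : ∀ x, Qs * (Qu * x) = 0 := fun x => by rw [← mul_assoc, hsu, zero_mul]
  have a2 : ∀ x, Qu * (Qs * x) = 0 := fun x => by rw [← mul_assoc, hus, zero_mul]
  have a3 : ∀ x, Qu * (Qu * x) = Qu * x := fun x => by rw [← mul_assoc, huu]
  have a5 : ∀ x, U * (V * x) = x := fun x => by rw [← mul_assoc, hUV, one_mul]
  have a6 : ∀ x, V * (U * x) = x := fun x => by rw [← mul_assoc, hVU, one_mul]
  have a7 : ∀ x, Qs * (U * x) = U * (Qs * x) := fun x => by rw [← mul_assoc, ← hUs, mul_assoc]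
  have a8 : ∀ x, Qu * (U * x) = U * (Qu * x) := fun x => by rw [← mul_assoc, ← hUu, mul_assoc]
  have a9 : ∀ x, Qu * (V * x) = V * (Qu * x) := fun x => by rw [← mul_assoc, ← hVu, mul_assoc]
  have a10 : ∀ x, Qs * (V * x) = V * (Qs * x) := fun x => by rw [← mul_assoc, ← hVs, mul_assoc]
  have hp1 : Qu * (p * (Qu * p')) = Qu := by
    have h := congrArg (Qu * ·) hp
    simp only [mul_add, add_mul, mul_assoc, a2, a3, zero_add, mul_one] at h
    exact h
  have hp2 : ∀ x, Qu * (p * (Qu * (p' * x))) = Qu * x := fun x => by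
    have h := congrArg (· * x) hp1
    simpa only [mul_assoc] using h
  have hq1 : q' * (Qu * (q * Qu)) = Qu := by
    have h := congrArg (· * Qu) hq
    simpa only [mul_add, add_mul, mul_assoc, hsu, huu, mul_zero, zero_add, one_mul] using h
  have e1 : V * V * Qu * (p * U * C * U * q) = Qu * (V * V * p * U * C * U * q) := by
    simp only [mul_assoc, a9]
  -- Inserting `Qs + Qu = 1` beside each `U` isolates the growing exponentials in block diagonal
  -- factors. In the central factor only `V * Qu` and `Qs * U`, which decay when `U`, `V` are the
  -- forward and backward flows, surround `p` and `q`.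
  have e2 : Qs + Qu * (V * V * p * U * C * U * q) * Qu =
      (Qs + V * V * Qu) * (Qs + Qu * p * Qu) * (Qs + U * Qu) *
        (Qs + (Qu + V * Qu * p' * Qu * p * Qs * U) * C *
          (Qu + U * Qs * q * Qu * q' * Qu * V)) * (Qs + U * Qu) * (Qs + Qu * q * Qu) := by
    have h1 : p * U * C * U * q = p * (U * (Qs + Qu)) * C * ((Qs + Qu) * U) * q := by
      rw [hadd, mul_one, one_mul]
    have h2 : Qu * (V * V * p * U * C * U * q) * Qu =
        V * V * Qu * (p * (U * (Qs + Qu)) * C * ((Qs + Qu) * U) * q) * Qu := by rw [← e1, h1]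
    rw [h2]
    simp only [mul_add, add_mul, mul_assoc, a1, a3, a5, a6, a7, a8, a9, a10, hsu, hus, huu,
      hss, ← hUs, ← hUu, hp2, hq1, mul_zero, add_zero, zero_add]
    abel
  -- The isolated exponentials cancel exactly, so their determinants drop out.
  have e3 : (Qs + V * V * Qu) * (Qs + U * Qu) * (Qs + U * Qu) = 1 := by
    simp only [mul_add, add_mul, mul_assoc, a6, a7, a8, hsu, hus, huu, hss, mul_zero, add_zero, zero_add]
    exact hadd
  have e4 := congrArg Matrix.det e3
  simp only [Matrix.det_mul, Matrix.det_one] at e4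
  rw [e1, det_add_proj_mul hsu huu hus hss hadd, e2]
  simp only [Matrix.det_mul]
  linear_combination ((Qs + Qu * p * Qu).det * (Qs + Qu * q * Qu).det *
        (Qs + (Qu + V * Qu * p' * Qu * p * Qs * U) * C *
          (Qu + U * Qs * q * Qu * q' * Qu * V)).det) * e4

end BlockAlgebra

/-! ### Uniqueness on a half-line. -/

section Uniqueness

variable {𝔸 : Type*} [NormedRing 𝔸] [NormedAlgebra ℝ 𝔸]

/-- One-sided derivatives are needed because a conjugator is differentiable only within its
half-line. -/
theorem eq_of_hasDerivWithinAt_Ici {a Y V : ℝ → 𝔸} (ha : Continuous a)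
    (hY : ∀ x, 0 ≤ x → HasDerivWithinAt Y (a x * Y x) (Set.Ici 0) x)
    (hV : ∀ x, 0 ≤ x → HasDerivWithinAt V (a x * V x) (Set.Ici 0) x) (h0 : Y 0 = V 0)
    {x : ℝ} (hx : 0 ≤ x) : Y x = V x := by
  obtain ⟨K, hK⟩ := (isCompact_Icc (a := (0 : ℝ)) (b := x)).exists_bound_of_continuousOn
    ha.continuousOn
  have h := norm_le_gronwallBound_of_norm_deriv_right_le (f := fun s => Y s - V s)
    (f' := fun s => a s * Y s - a s * V s) (δ := 0) (K := K) (ε := 0) (a := 0) (b := x)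
    (fun s hs => ((hY s hs.1).sub (hV s hs.1)).continuousWithinAt.mono Set.Icc_subset_Ici_self)
    (fun s hs => ((hY s hs.1).sub (hV s hs.1)).mono (Set.Ici_subset_Ici.2 hs.1))
    (by simp [h0])
    (fun s hs => by
      rw [add_zero, ← mul_sub]
      exact (norm_mul_le _ _).trans
        (mul_le_mul_of_nonneg_right (hK s (Set.Ico_subset_Icc_self hs)) (norm_nonneg _)))
    x (Set.right_mem_Icc.2 hx)
  rw [gronwallBound_ε0, zero_mul] at h
  exact sub_eq_zero.1 (norm_le_zero_iff.1 h)

end Uniqueness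

/-! ### The limit of the line determinants in terms of conjugators. -/

section Conjugators

variable {n : ℕ} {a : ℝ → CMat n} {B Qs Qu : CMat n} {P Pm Pp : ℝ → CMat n} {c g : ℝ}

/-- Both sides solve `Y' = a Y` with the same initial value. -/
theorem IsConjugator.solutionOperator_mul_of_nonneg (ha : Continuous a)
    (hP : IsConjugator a B (Set.Ici 0) P) {x : ℝ} (hx : 0 ≤ x) :
    solutionOperator a x * P 0 = P x * flow B x := by
  refine eq_of_hasDerivWithinAt_Ici (a := a) (Y := fun s => solutionOperator a s * P 0)
    (V := fun s => P s * flow B s) ha (fun s _ => ?_) (fun s hs => ?_) ?_ hx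
  · refine (((hasDerivAt_solutionOperator ha s).mul_const (P 0)).congr_deriv ?_).hasDerivWithinAt
    noncomm_ring
  · refine ((hP.1 s hs).mul (hasDerivAt_flow B s).hasDerivWithinAt).congr_deriv ?_
    noncomm_ring
  · simp [solutionOperator_zero ha, flow_zero]

theorem IsConjugator.solutionOperator_mul_of_nonpos (ha : Continuous a)
    (hP : IsConjugator a B (Set.Iic 0) P) {x : ℝ} (hx : x ≤ 0) :
    solutionOperator a x * P 0 = P x * flow B x := by
  have hx' : 0 ≤ -x := by linarith
  have hmaps : Set.MapsTo (fun s : ℝ => -s) (Set.Ici 0) (Set.Iic 0) := fun s hs => by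
    simpa using hs
  have h := eq_of_hasDerivWithinAt_Ici (a := fun s => -a (-s))
    (Y := fun s => solutionOperator a (-s) * P 0) (V := fun s => P (-s) * flow B (-s))
    (ha.comp continuous_neg).neg (fun s _ => ?_) (fun s hs => ?_) ?_ hx'
  · simpa using h
  · have h := ((hasDerivAt_solutionOperator ha (-s)).mul_const (P 0)).scomp s (hasDerivAt_neg s)
    refine (h.congr_deriv ?_).hasDerivWithinAt
    rw [neg_one_smul]
    noncomm_ring
  · have h1 := (hP.1 (-s) (hmaps hs)).scomp s ((hasDerivAt_neg s).hasDerivWithinAt (s := Set.Ici 0))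
      hmaps
    refine (h1.mul (hasDerivAt_flow_neg B s).hasDerivWithinAt).congr_deriv ?_
    have aux : ∀ A Q F : CMat n, (-1 : ℝ) • (A * Q - Q * B) * F + Q * -(F * B) =
        -(A * (Q * F)) + Q * (B * F - F * B) := fun A Q F => by
      rw [neg_one_smul]
      noncomm_ring
    refine (aux (a (-s)) (P (-s)) (flow B (-s))).trans ?_
    rw [(flow_commute (Commute.refl B) (-s)).eq, sub_self, mul_zero, add_zero, neg_mul]
  · simp [solutionOperator_zero ha, flow_zero]

theorem IsConjugator.isUnit_det {s : Set ℝ} (hP : IsConjugator a B s P) {x : ℝ} (hx : x ∈ s) :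
    IsUnit (P x).det := (Matrix.isUnit_iff_isUnit_det _).1 (hP.2.1 x hx)

theorem IsConjugator.tendsto_atTop (hP : IsConjugator a B (Set.Ici 0) P) :
    Filter.Tendsto P Filter.atTop (nhds 1) := by
  obtain ⟨C, κ, hκ, h⟩ := hP.2.2
  exact tendsto_of_norm_sub_le_exp hκ fun x hx => by
    have := h x hx
    rwa [abs_of_nonneg hx] at this

theorem IsConjugator.tendsto_atBot (hP : IsConjugator a B (Set.Iic 0) P) :
    Filter.Tendsto (fun x => P (-x)) Filter.atTop (nhds 1) := by
  obtain ⟨C, κ, hκ, h⟩ := hP.2.2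
  exact tendsto_of_norm_sub_le_exp (f := fun x => P (-x)) hκ fun x hx => by
    have := h (-x) (by simpa using hx)
    rwa [abs_neg, abs_of_nonneg hx] at this

theorem tendsto_matrix_inv {ι : Type*} {l : Filter ι} {f : ι → CMat n}
    (hf : Filter.Tendsto f l (nhds 1)) : Filter.Tendsto (fun x => (f x)⁻¹) l (nhds 1) := by
  have h1 : Filter.Tendsto (fun x => (f x).det) l (nhds 1) := by
    have := ((continuous_id (X := CMat n)).matrix_det.tendsto 1).comp hf
    simpa [Function.comp_def] using this
  have h2 : Filter.Tendsto (fun x => (f x).adjugate) l (nhds 1) := by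
    have := ((continuous_id (X := CMat n)).matrix_adjugate.tendsto 1).comp hf
    simpa [Function.comp_def] using this
  have h3 := (h1.inv₀ one_ne_zero).smul h2
  simp only [inv_one, one_smul] at h3
  refine h3.congr fun x => ?_
  rw [Matrix.inv_def, Ring.inverse_eq_inv']

theorem IsDichotomy.tendsto_flow_mul_s (hd : IsDichotomy B Qs Qu c g) (hg : 0 < g) :
    Filter.Tendsto (fun x => flow B x * Qs) Filter.atTop (nhds 0) :=
  tendsto_of_norm_sub_le_exp (f := fun x => flow B x * Qs) (b := 0) hg fun x hx => by
    rw [sub_zero]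
    exact hd.bound_s x hx

theorem IsDichotomy.tendsto_flow_mul_u (hd : IsDichotomy B Qs Qu c g) (hg : 0 < g) :
    Filter.Tendsto (fun x => flow B (-x) * Qu) Filter.atTop (nhds 0) :=
  tendsto_of_norm_sub_le_exp (f := fun x => flow B (-x) * Qu) (b := 0) hg fun x hx => by
    rw [sub_zero]
    exact hd.bound_u x hx

theorem tendsto_det {ι : Type*} {l : Filter ι} {f : ι → CMat n} {A : CMat n}
    (hf : Filter.Tendsto f l (nhds A)) : Filter.Tendsto (fun x => (f x).det) l (nhds A.det) :=
  ((continuous_id (X := CMat n)).matrix_det.tendsto A).comp hf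

/-- The propagator is routed through `x = 0`, where the two conjugators meet in the transition
matrix `(Pp 0)⁻¹ * Pm 0`; the outer factors tend to `1`. -/
theorem propagator_eq_sandwich (ha : Continuous a) (hm : IsConjugator a B (Set.Iic 0) Pm)
    (hp : IsConjugator a B (Set.Ici 0) Pp) {x : ℝ} (hx : 0 ≤ x) :
    propagator a x (-x) =
      Pp x * flow B x * ((Pp 0)⁻¹ * Pm 0) * flow B x * (Pm (-x))⁻¹ := by
  have hx' : -x ≤ 0 := by linarith
  have h1 : solutionOperator a x = Pp x * flow B x * (Pp 0)⁻¹ := by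
    rw [← hp.solutionOperator_mul_of_nonneg ha hx, mul_assoc,
      Matrix.mul_nonsing_inv _ (hp.isUnit_det (Set.self_mem_Ici)), mul_one]
  have h2 : (solutionOperator a (-x))⁻¹ = Pm 0 * flow B x * (Pm (-x))⁻¹ := by
    have h3 := hm.solutionOperator_mul_of_nonpos ha hx'
    refine Matrix.inv_eq_right_inv ?_
    calc solutionOperator a (-x) * (Pm 0 * flow B x * (Pm (-x))⁻¹)
        = solutionOperator a (-x) * Pm 0 * flow B x * (Pm (-x))⁻¹ := by noncomm_ring
      _ = Pm (-x) * (flow B (-x) * flow B x) * (Pm (-x))⁻¹ := by rw [h3]; noncomm_ring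
      _ = 1 := by
        rw [flow_neg_mul, mul_one, Matrix.mul_nonsing_inv _ (hm.isUnit_det hx')]
  rw [propagator, h1, h2]
  noncomm_ring

/-- By `det_proj_add_sandwich` the line determinant is a product of three convergent factors with
limit `det (Qs + Qu * C * Qu)`. The ratio of Wronskians tends to `det (Pp 0)`, which is exactly the
factor that turns this limit into the Evans determinant. -/
theorem tendsto_lineDet (ha : Continuous a) (hd : IsDichotomy B Qs Qu c g) (hg : 0 < g)
    (hm : IsConjugator a B (Set.Iic 0) Pm) (hp : IsConjugator a B (Set.Ici 0) Pp) {h : ℝ}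
    (hh : 0 < h) :
    Filter.Tendsto (fun N : ℕ => wronskianRatio a B (N * h) * lineDet a B Qu h N) Filter.atTop
      (nhds (Pm 0 * Qu + Pp 0 * Qs).det) := by
  set C := (Pp 0)⁻¹ * Pm 0
  set q : ℝ → CMat n := fun x => (Pm (-x))⁻¹
  have hpt := hp.tendsto_atTop
  have hqt : Filter.Tendsto q Filter.atTop (nhds 1) := tendsto_matrix_inv hm.tendsto_atBot
  have hcomp : ∀ f : ℝ → CMat n, Filter.Tendsto f Filter.atTop (nhds 1) →
      Filter.Tendsto (fun x => Qs + Qu * f x * Qu) Filter.atTop (nhds 1) := fun f hf => by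
    have h1 := ((hf.const_mul Qu).mul_const Qu).const_add Qs
    rwa [mul_one, hd.idem_u, hd.add] at h1
  have hpu := hcomp _ hpt
  have hqu := hcomp _ hqt
  set p' : ℝ → CMat n := fun x => (Qs + Qu * Pp x * Qu)⁻¹
  set q' : ℝ → CMat n := fun x => (Qs + Qu * q x * Qu)⁻¹
  have hp't : Filter.Tendsto p' Filter.atTop (nhds 1) := tendsto_matrix_inv hpu
  have hq't : Filter.Tendsto q' Filter.atTop (nhds 1) := tendsto_matrix_inv hqu
  have hS := hd.tendsto_flow_mul_s hg
  have hU := hd.tendsto_flow_mul_u hg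
  have hlim1 : Filter.Tendsto (fun x => Qu + flow B (-x) * Qu * p' x * Qu * Pp x * Qs * flow B x)
      Filter.atTop (nhds Qu) := by
    have h1 := (((((hU.mul hp't).mul_const Qu).mul hpt).mul hS)).const_add Qu
    simp only [zero_mul, add_zero] at h1
    refine h1.congr fun x => ?_
    rw [hd.flow_comm_s]
    noncomm_ring
  have hlim2 : Filter.Tendsto (fun x => Qu + flow B x * Qs * q x * Qu * q' x * Qu * flow B (-x))
      Filter.atTop (nhds Qu) := by
    have h1 := (((((hS.mul hqt).mul_const Qu).mul hq't).mul hU)).const_add Qu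
    simp only [zero_mul, add_zero] at h1
    refine h1.congr fun x => ?_
    rw [hd.flow_comm_u]
    noncomm_ring
  have hmain := tendsto_det (((hlim1.mul_const C).mul hlim2).const_add Qs)
  have hprod : Filter.Tendsto (fun x => wronskianRatio a B x *
      (Qs + flow B (-x) * flow B (-x) * Qu * (propagator a x (-x))).det) Filter.atTop
      (nhds ((Pp 0).det * (Qs + Qu * C * Qu).det)) := by
    have hdet : ∀ f : ℝ → CMat n, Filter.Tendsto f Filter.atTop (nhds 1) →
        Filter.Tendsto (fun x => (f x).det) Filter.atTop (nhds 1) := fun f hf => by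
      simpa using tendsto_det hf
    have hw : Filter.Tendsto (fun x => (Pp 0).det / (Pp x).det) Filter.atTop
        (nhds (Pp 0).det) := by
      simpa [Pi.div_def] using (tendsto_const_nhds (x := (Pp 0).det)).div (hdet _ hpt) one_ne_zero
    have h1 := hw.mul (((hdet _ hpu).mul (hdet _ hqu)).mul hmain)
    rw [one_mul, one_mul] at h1
    refine h1.congr' ?_
    filter_upwards [Filter.eventually_ge_atTop 0, (hdet _ hpu).eventually_ne one_ne_zero,
      (hdet _ hqu).eventually_ne one_ne_zero] with x hx hpx hqx
    have h2 : (solutionOperator a x).det * (Pp 0).det = (Pp x).det * (flow B x).det := by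
      rw [← Matrix.det_mul, ← Matrix.det_mul, hp.solutionOperator_mul_of_nonneg ha hx]
    have h3 : wronskianRatio a B x = (Pp 0).det / (Pp x).det := by
      rw [wronskianRatio, div_eq_div_iff (isUnit_det_solutionOperator ha x).ne_zero
        (hp.isUnit_det hx).ne_zero, mul_comm, ← h2, mul_comm]
    rw [h3, propagator_eq_sandwich ha hm hp hx,
      det_proj_add_sandwich (p' := p' x) (q' := q' x) hd.mul_su hd.mul_us hd.idem_u hd.idem_s
        hd.add (flow_mul_neg B x) (flow_neg_mul B x) (hd.flow_comm_s x) (hd.flow_comm_u x)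
        (hd.flow_comm_u (-x)) C (Matrix.mul_nonsing_inv _ (isUnit_iff_ne_zero.2 hpx))
        (Matrix.nonsing_inv_mul _ (isUnit_iff_ne_zero.2 hqx))]
  have hgoal : (Pp 0).det * (Qs + Qu * C * Qu).det = (Pm 0 * Qu + Pp 0 * Qs).det := by
    rw [← det_add_mul_proj hd.mul_su hd.mul_us hd.idem_s hd.add, ← Matrix.det_mul, mul_add,
      ← mul_assoc, ← mul_assoc, Matrix.mul_nonsing_inv _ (hp.isUnit_det Set.self_mem_Ici), one_mul,
      add_comm]
  rw [← hgoal]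
  have hseq : Filter.Tendsto (fun N : ℕ => (N : ℝ) * h) Filter.atTop Filter.atTop :=
    tendsto_natCast_atTop_atTop.atTop_mul_const hh
  refine (hprod.comp hseq).congr fun N => ?_
  simp only [Function.comp]
  congr 1
  rw [lineDet]
  have h4 : flow B (-((2 * N : ℕ) * h)) = flow B (-(N * h)) * flow B (-(N * h)) := by
    rw [← flow_add]
    push_cast
    ring_nf
  have h5 : flow B (-((2 * N : ℕ) * h)) * Qu * flow B ((2 * N : ℕ) * h) = Qu := by
    rw [mul_assoc, ← hd.flow_comm_u, ← mul_assoc, flow_neg_mul, one_mul]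
  rw [mul_sub, h5, ← h4]
  congr 1
  rw [← hd.add]
  abel

end Conjugators

/-! ### The homoclinic Evans function and decaying solutions. -/

section EvansValue

variable {n : ℕ} {a : ℝ → CMat n} {B Qs Qu : CMat n} {P Pm Pp : ℝ → CMat n} {c g : ℝ}

theorem IsDichotomy.isCompl (hd : IsDichotomy B Qs Qu c g) :
    IsCompl (unstableSubspace B) (stableSubspace B) := by
  constructor
  · rw [Submodule.disjoint_def]
    intro v hu hs
    rw [← hd.eq_u v hu, ← hd.eq_s v hs, Matrix.mulVec_mulVec, hd.mul_us, Matrix.zero_mulVec]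
  · rw [codisjoint_iff_le_sup]
    intro v _
    have h : v = Qu.mulVec v + Qs.mulVec v := by
      rw [← Matrix.add_mulVec, add_comm Qu, hd.add, Matrix.one_mulVec]
    rw [h]
    exact Submodule.add_mem_sup (hd.mem_u v) (hd.mem_s v)

theorem mul_eq_self_of_col {p : ℕ} {Q : CMat n} {R : Matrix (Fin n) (Fin p) ℂ}
    {S : Submodule ℂ (Fin n → ℂ)} (hR : Submodule.span ℂ (Set.range R.col) = S)
    (hQ : ∀ v ∈ S, Q.mulVec v = v) : Q * R = R := by
  ext i j
  have h := congr_fun (hQ (R.col j) (hR ▸ Submodule.subset_span ⟨j, rfl⟩)) i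
  exact h

theorem exists_linearIndependent_col (S : Submodule ℂ (Fin n → ℂ)) :
    ∃ (p : ℕ) (R : Matrix (Fin n) (Fin p) ℂ), p = Module.finrank ℂ S ∧
      LinearIndependent ℂ R.col ∧ Submodule.span ℂ (Set.range R.col) = S := by
  let b := Module.finBasis ℂ S
  refine ⟨_, Matrix.of fun i j => (b j : Fin n → ℂ) i, rfl, ?_, ?_⟩
  · exact b.linearIndependent.map' S.subtype (Submodule.ker_subtype S)
  · have h : (Set.range (Matrix.of fun i j => (b j : Fin n → ℂ) i).col) =
        S.subtype '' Set.range b := by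
      rw [← Set.range_comp]
      rfl
    rw [h, Submodule.span_image, b.span_eq, Submodule.map_top, Submodule.range_subtype]

theorem det_fromCols_ne_zero (hd : IsDichotomy B Qs Qu c g) {p q : ℕ} (e : Fin n ≃ Fin p ⊕ Fin q)
    {Rm : Matrix (Fin n) (Fin p) ℂ} {Rp : Matrix (Fin n) (Fin q) ℂ}
    (hRm : LinearIndependent ℂ Rm.col) (hm : Qu * Rm = Rm) (hRp : LinearIndependent ℂ Rp.col)
    (hp : Qs * Rp = Rp) : ((Matrix.fromCols Rm Rp).submatrix id e).det ≠ 0 := by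
  intro h0
  obtain ⟨v, hv, hv0⟩ := Matrix.exists_mulVec_eq_zero_iff.2 h0
  set w := v ∘ e.symm
  have h1 : Rm.mulVec (w ∘ Sum.inl) + Rp.mulVec (w ∘ Sum.inr) = 0 := by
    rw [← Matrix.fromCols_mulVec, ← hv0]
    ext i
    simp only [Matrix.mulVec, dotProduct, Matrix.submatrix_apply, id, w, Function.comp]
    exact (Fintype.sum_equiv e _ _ fun j => by simp).symm
  have hmz : Qs * Rm = 0 := by rw [← hm, ← Matrix.mul_assoc, hd.mul_su, Matrix.zero_mul]
  have hpz : Qu * Rp = 0 := by rw [← hp, ← Matrix.mul_assoc, hd.mul_us, Matrix.zero_mul]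
  have h2 := congrArg Qu.mulVec h1
  have h3 := congrArg Qs.mulVec h1
  rw [Matrix.mulVec_add, Matrix.mulVec_mulVec, Matrix.mulVec_mulVec, hm, hpz, Matrix.zero_mulVec,
    add_zero, Matrix.mulVec_zero] at h2
  rw [Matrix.mulVec_add, Matrix.mulVec_mulVec, Matrix.mulVec_mulVec, hp, hmz, Matrix.zero_mulVec,
    zero_add, Matrix.mulVec_zero] at h3
  have h4 : w ∘ Sum.inl = 0 := Matrix.mulVec_injective_iff.2 hRm (by rw [h2, Matrix.mulVec_zero])
  have h5 : w ∘ Sum.inr = 0 := Matrix.mulVec_injective_iff.2 hRp (by rw [h3, Matrix.mulVec_zero])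
  apply hv
  ext i
  have h6 : w (e i) = v i := by simp [w]
  rw [← h6]
  rcases e i with j | j
  · exact congr_fun h4 j
  · exact congr_fun h5 j

/-- The projections fix the columns of the respective bases and kill the others, so the matrix of
bases factors out on the right. In particular the quotient does not depend on the bases. -/
theorem evans_quotient_eq (hd : IsDichotomy B Qs Qu c g) {p q : ℕ} (e : Fin n ≃ Fin p ⊕ Fin q)
    {Rm : Matrix (Fin n) (Fin p) ℂ} {Rp : Matrix (Fin n) (Fin q) ℂ}
    (hRm : LinearIndependent ℂ Rm.col) (hm : Qu * Rm = Rm) (hRp : LinearIndependent ℂ Rp.col)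
    (hp : Qs * Rp = Rp) (A A' : CMat n) :
    ((Matrix.fromCols (A * Rm) (A' * Rp)).submatrix id e).det /
        ((Matrix.fromCols Rm Rp).submatrix id e).det = (A * Qu + A' * Qs).det := by
  have hmz : Qs * Rm = 0 := by rw [← hm, ← Matrix.mul_assoc, hd.mul_su, Matrix.zero_mul]
  have hpz : Qu * Rp = 0 := by rw [← hp, ← Matrix.mul_assoc, hd.mul_us, Matrix.zero_mul]
  have h : (Matrix.fromCols (A * Rm) (A' * Rp)).submatrix id e =
      (A * Qu + A' * Qs) * (Matrix.fromCols Rm Rp).submatrix id e := by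
    have h1 : Matrix.fromCols (A * Rm) (A' * Rp) = (A * Qu + A' * Qs) * Matrix.fromCols Rm Rp := by
      rw [Matrix.mul_fromCols, Matrix.add_mul, Matrix.add_mul, Matrix.mul_assoc, Matrix.mul_assoc,
        Matrix.mul_assoc, Matrix.mul_assoc, hm, hp, hmz, hpz, Matrix.mul_zero, Matrix.mul_zero,
        add_zero, zero_add]
    rw [h1]
    rfl
  rw [h, Matrix.det_mul, mul_div_cancel_right₀ _ (det_fromCols_ne_zero hd e hRm hm hRp hp)]

theorem IsEvansValue.exists_conjugators {d : ℂ} (hd : IsDichotomy B Qs Qu c g)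
    (h : IsEvansValue a B d) : ∃ Pm Pp, IsConjugator a B (Set.Iic 0) Pm ∧
      IsConjugator a B (Set.Ici 0) Pp ∧ d = (Pm 0 * Qu + Pp 0 * Qs).det := by
  obtain ⟨p, q, e, Rm, Rp, Pm, Pp, hRm, hsm, hRp, hsp, hPm, hPp, rfl⟩ := h
  exact ⟨Pm, Pp, hPm, hPp, evans_quotient_eq hd e hRm (mul_eq_self_of_col hsm hd.eq_u) hRp
    (mul_eq_self_of_col hsp hd.eq_s) _ _⟩

theorem exists_isEvansValue (hd : IsDichotomy B Qs Qu c g)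
    (hPm : IsConjugator a B (Set.Iic 0) Pm) (hPp : IsConjugator a B (Set.Ici 0) Pp) :
    ∃ d, IsEvansValue a B d := by
  obtain ⟨p, Rm, hp, hRm, hsm⟩ := exists_linearIndependent_col (unstableSubspace B)
  obtain ⟨q, Rp, hq, hRp, hsp⟩ := exists_linearIndependent_col (stableSubspace B)
  have h := Submodule.finrank_add_eq_of_isCompl hd.isCompl
  rw [Module.finrank_fin_fun, ← hp, ← hq] at h
  let e : Fin n ≃ Fin p ⊕ Fin q := (finCongr h.symm).trans finSumFinEquiv.symm
  exact ⟨((Matrix.fromCols (Pm 0 * Rm) (Pp 0 * Rp)).submatrix id e).det /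
    ((Matrix.fromCols Rm Rp).submatrix id e).det, p, q, e, Rm, Rp, Pm, Pp, hRm, hsm, hRp, hsp,
    hPm, hPp, rfl⟩

theorem tendsto_mulVec {ι : Type*} {l : Filter ι} {f : ι → CMat n} {v : ι → Fin n → ℂ}
    {A : CMat n} {w : Fin n → ℂ} (hf : Filter.Tendsto f l (nhds A))
    (hv : Filter.Tendsto v l (nhds w)) :
    Filter.Tendsto (fun x => (f x).mulVec (v x)) l (nhds (A.mulVec w)) := by
  refine tendsto_pi_nhds.2 fun i => ?_
  have hf' : ∀ j, Filter.Tendsto (fun x => f x i j) l (nhds (A i j)) := fun j =>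
    ((continuous_id (X := CMat n)).matrix_elem i j).tendsto A |>.comp hf
  simp only [Matrix.mulVec, dotProduct]
  exact tendsto_finsetSum _ fun j _ => (hf' j).mul (tendsto_pi_nhds.1 hv j)

/-- The conjugator tends to `1`, so the solution decays exactly when `flow B x w` does; the unstable
part of `w` is recovered from the latter by the decaying operator `flow B (-x) * Qu`. -/
theorem conjugator_solution_decays_atTop_iff (ha : Continuous a) (hd : IsDichotomy B Qs Qu c g)
    (hg : 0 < g) (hp : IsConjugator a B (Set.Ici 0) Pp) (w : Fin n → ℂ) :
    Filter.Tendsto (fun x => (solutionOperator a x).mulVec ((Pp 0).mulVec w)) Filter.atTop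
      (nhds 0) ↔ Qu.mulVec w = 0 := by
  have heq : ∀ x, 0 ≤ x → (solutionOperator a x).mulVec ((Pp 0).mulVec w) =
      (Pp x).mulVec ((flow B x).mulVec w) := fun x hx => by
    rw [Matrix.mulVec_mulVec, hp.solutionOperator_mul_of_nonneg ha hx, Matrix.mulVec_mulVec]
  constructor
  · intro h
    have h1 : Filter.Tendsto (fun x => (flow B x).mulVec w) Filter.atTop (nhds 0) := by
      have h2 := tendsto_mulVec (tendsto_matrix_inv hp.tendsto_atTop) h
      rw [Matrix.mulVec_zero] at h2
      refine h2.congr' ?_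
      filter_upwards [Filter.eventually_ge_atTop 0] with x hx
      rw [heq x hx, Matrix.mulVec_mulVec, Matrix.nonsing_inv_mul _ (hp.isUnit_det hx),
        Matrix.one_mulVec]
    have h3 := tendsto_mulVec (hd.tendsto_flow_mul_u hg) h1
    rw [Matrix.zero_mulVec] at h3
    refine tendsto_nhds_unique (tendsto_const_nhds.congr fun x => ?_) h3
    rw [Matrix.mulVec_mulVec, mul_assoc, ← hd.flow_comm_u, ← mul_assoc, flow_neg_mul, one_mul]
  · intro h
    have hw : Qs.mulVec w = w := by
      have : (Qs + Qu).mulVec w = w := by rw [hd.add, Matrix.one_mulVec]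
      rwa [Matrix.add_mulVec, h, add_zero] at this
    have h1 := tendsto_mulVec (hd.tendsto_flow_mul_s hg) (tendsto_const_nhds (x := w))
    have h2 := tendsto_mulVec hp.tendsto_atTop h1
    rw [Matrix.zero_mulVec, Matrix.mulVec_zero] at h2
    refine h2.congr' ?_
    filter_upwards [Filter.eventually_ge_atTop 0] with x hx
    rw [heq x hx, ← Matrix.mulVec_mulVec, hw]

theorem conjugator_solution_decays_atBot_iff (ha : Continuous a) (hd : IsDichotomy B Qs Qu c g)
    (hg : 0 < g) (hm : IsConjugator a B (Set.Iic 0) Pm) (w : Fin n → ℂ) :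
    Filter.Tendsto (fun x => (solutionOperator a (-x)).mulVec ((Pm 0).mulVec w)) Filter.atTop
      (nhds 0) ↔ Qs.mulVec w = 0 := by
  have heq : ∀ x, 0 ≤ x → (solutionOperator a (-x)).mulVec ((Pm 0).mulVec w) =
      (Pm (-x)).mulVec ((flow B (-x)).mulVec w) := fun x hx => by
    rw [Matrix.mulVec_mulVec, hm.solutionOperator_mul_of_nonpos ha (by linarith),
      Matrix.mulVec_mulVec]
  constructor
  · intro h
    have h1 : Filter.Tendsto (fun x => (flow B (-x)).mulVec w) Filter.atTop (nhds 0) := by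
      have h2 := tendsto_mulVec (tendsto_matrix_inv hm.tendsto_atBot) h
      rw [Matrix.mulVec_zero] at h2
      refine h2.congr' ?_
      filter_upwards [Filter.eventually_ge_atTop 0] with x hx
      rw [heq x hx, Matrix.mulVec_mulVec,
        Matrix.nonsing_inv_mul _ (hm.isUnit_det (by simpa using hx)), Matrix.one_mulVec]
    have h3 := tendsto_mulVec (hd.tendsto_flow_mul_s hg) h1
    rw [Matrix.zero_mulVec] at h3
    refine tendsto_nhds_unique (tendsto_const_nhds.congr fun x => ?_) h3
    rw [Matrix.mulVec_mulVec, mul_assoc, ← hd.flow_comm_s, ← mul_assoc, flow_mul_neg, one_mul]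
  · intro h
    have hw : Qu.mulVec w = w := by
      have : (Qs + Qu).mulVec w = w := by rw [hd.add, Matrix.one_mulVec]
      rwa [Matrix.add_mulVec, h, zero_add] at this
    have h1 := tendsto_mulVec (hd.tendsto_flow_mul_u hg) (tendsto_const_nhds (x := w))
    have h2 := tendsto_mulVec hm.tendsto_atBot h1
    rw [Matrix.zero_mulVec, Matrix.mulVec_zero] at h2
    refine h2.congr' ?_
    filter_upwards [Filter.eventually_ge_atTop 0] with x hx
    rw [heq x hx, ← Matrix.mulVec_mulVec, hw]

/-- Decaying solutions on the line exist exactly when the Evans determinant vanishes. -/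
theorem exists_decaying_solution_iff (ha : Continuous a) (hd : IsDichotomy B Qs Qu c g)
    (hg : 0 < g) (hm : IsConjugator a B (Set.Iic 0) Pm) (hp : IsConjugator a B (Set.Ici 0) Pp) :
    (∃ W : ℝ → (Fin n → ℂ), W ≠ 0 ∧ (∀ x : ℝ, HasDerivAt W ((a x).mulVec (W x)) x) ∧
      Filter.Tendsto W Filter.atBot (nhds 0) ∧ Filter.Tendsto W Filter.atTop (nhds 0)) ↔
    (Pm 0 * Qu + Pp 0 * Qs).det = 0 := by
  have hPp := hp.isUnit_det (x := 0) Set.self_mem_Ici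
  have hPm := hm.isUnit_det (x := 0) Set.self_mem_Iic
  constructor
  · rintro ⟨W, hW, hder, hbot, htop⟩
    have hWx := eq_solutionOperator_mulVec ha hder
    set w := (Pp 0)⁻¹.mulVec (W 0)
    set w' := (Pm 0)⁻¹.mulVec (W 0)
    have h1 : (Pp 0).mulVec w = W 0 := by
      simp only [w]
      rw [Matrix.mulVec_mulVec, Matrix.mul_nonsing_inv _ hPp, Matrix.one_mulVec]
    have h2 : (Pm 0).mulVec w' = W 0 := by
      simp only [w']
      rw [Matrix.mulVec_mulVec, Matrix.mul_nonsing_inv _ hPm, Matrix.one_mulVec]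
    have h3 : Qu.mulVec w = 0 := by
      rw [← conjugator_solution_decays_atTop_iff ha hd hg hp, h1]
      exact htop.congr hWx
    have h4 : Qs.mulVec w' = 0 := by
      rw [← conjugator_solution_decays_atBot_iff ha hd hg hm, h2]
      exact (hbot.comp Filter.tendsto_neg_atTop_atBot).congr fun x => hWx (-x)
    have hw : Qs.mulVec w = w := by
      have : (Qs + Qu).mulVec w = w := by rw [hd.add, Matrix.one_mulVec]
      rwa [Matrix.add_mulVec, h3, add_zero] at this
    have hw' : Qu.mulVec w' = w' := by
      have : (Qs + Qu).mulVec w' = w' := by rw [hd.add, Matrix.one_mulVec]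
      rwa [Matrix.add_mulVec, h4, zero_add] at this
    -- `w` is stable, `w'` is unstable, and both conjugators map them to `W 0`; so the difference
    -- lies in the kernel, and it is nonzero since the subspaces meet only in `0`.
    refine Matrix.exists_mulVec_eq_zero_iff.1 ⟨w - w', fun h0 => hW ?_, ?_⟩
    · have h5 : w = w' := sub_eq_zero.1 h0
      have h6 : w = 0 := by rw [← hw, h5, h4]
      funext x
      rw [hWx, ← h1, h6, Matrix.mulVec_zero, Matrix.mulVec_zero, Pi.zero_apply]
    · rw [Matrix.add_mulVec, Matrix.mulVec_sub, Matrix.mulVec_sub, ← Matrix.mulVec_mulVec,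
        ← Matrix.mulVec_mulVec, ← Matrix.mulVec_mulVec, ← Matrix.mulVec_mulVec, h3, h4, hw, hw',
        h1, h2, Matrix.mulVec_zero, Matrix.mulVec_zero, zero_sub, sub_zero, neg_add_cancel]
  · intro h0
    obtain ⟨v, hv, hv0⟩ := Matrix.exists_mulVec_eq_zero_iff.2 h0
    rw [Matrix.add_mulVec, ← Matrix.mulVec_mulVec, ← Matrix.mulVec_mulVec] at hv0
    -- A kernel vector provides one initial value that is stable seen from the right and unstable
    -- seen from the left.
    set y := (Pp 0).mulVec (Qs.mulVec v)
    have hy : y = (Pm 0).mulVec (-Qu.mulVec v) := by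
      rw [Matrix.mulVec_neg]
      exact eq_neg_of_add_eq_zero_right hv0
    refine ⟨fun x => (solutionOperator a x).mulVec y, fun hW => hv ?_, fun x => ?_, ?_, ?_⟩
    · have hy0 : y = 0 := by
        have := congr_fun hW 0
        simpa [solutionOperator_zero ha] using this
      have h1 : Qs.mulVec v = 0 := by
        have := congrArg (Pp 0)⁻¹.mulVec hy0
        simp only [y] at this
        rwa [Matrix.mulVec_mulVec, Matrix.nonsing_inv_mul _ hPp, Matrix.one_mulVec,
          Matrix.mulVec_zero] at this
      have h2 : Qu.mulVec v = 0 := by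
        have := congrArg (Pm 0)⁻¹.mulVec (hy.symm.trans hy0)
        rwa [Matrix.mulVec_mulVec, Matrix.nonsing_inv_mul _ hPm, Matrix.one_mulVec,
          Matrix.mulVec_zero, neg_eq_zero] at this
      rw [← Matrix.one_mulVec v, ← hd.add, Matrix.add_mulVec, h1, h2, add_zero]
    · exact hasDerivAt_solutionOperator_mulVec ha y x
    · have h3 := (conjugator_solution_decays_atBot_iff ha hd hg hm (-Qu.mulVec v)).2 (by
        rw [Matrix.mulVec_neg, Matrix.mulVec_mulVec, hd.mul_su, Matrix.zero_mulVec, neg_zero])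
      rw [← hy] at h3
      refine (h3.comp Filter.tendsto_neg_atBot_atTop).congr fun x => ?_
      simp
    · exact (conjugator_solution_decays_atTop_iff ha hd hg hp (Qs.mulVec v)).2 (by
        rw [Matrix.mulVec_mulVec, hd.mul_us, Matrix.zero_mulVec])

end EvansValue

/-! ### Exponential closeness of the periodic and homoclinic Evans functions. -/

section EvansEstimate

variable {n : ℕ} {a b : ℝ → CMat n} {B Qs Qu : CMat n} {c g L C ν : ℝ}

theorem wronskianRatio_ne_zero (ha : Continuous a) (x : ℝ) : wronskianRatio a B x ≠ 0 :=
  div_ne_zero (isUnit_det_flow B x).ne_zero (isUnit_det_solutionOperator ha x).ne_zero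

/-- The Evans function of the line is the limit of the cut-off determinants, with a rate. -/
theorem exists_norm_lineDet_sub_evans_le (n : ℕ) {L C ν g η c : ℝ} (hη : 0 < η) (hην : η < ν)
    (hg : 0 < g) :
    ∃ K, ∀ (a : ℝ → CMat n) (B Qs Qu : CMat n) (N : ℕ) (h : ℝ) (d : ℂ),
      IsLimitSystem a B L C ν → IsDichotomy B Qs Qu c g → 1 ≤ h → h ≤ 2 → IsEvansValue a B d →
      ‖wronskianRatio a B (N * h) * lineDet a B Qu h N - d‖ ≤ K * Real.exp (-η * (N * h)) := by
  have hν : 0 < ν := hη.trans hην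
  obtain ⟨K₁, hK₁⟩ := exists_norm_lineDet_sub_le n (L := L) (C := C) (c := c) hη hην hg
  obtain ⟨K₂, hK₂⟩ := exists_norm_wronskianRatio_le n (L := L) (C := C) hη hην
  set D := Real.exp ((n : ℝ) ^ 2 * (c * latticeSum g * (stepConst L C ν * latticeSum ν)))
  refine ⟨K₂ * K₁ + K₂ * D, ?_⟩
  intro a B Qs Qu N h d ha hd hh hh2 hval
  obtain ⟨Pm, Pp, hm, hp, rfl⟩ := hval.exists_conjugators hd
  -- The conjugators give the limit but no usable rate; the rate follows by letting `r → ∞` in the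
  -- Cauchy estimates.
  have hlim := tendsto_lineDet ha.cont hd hg hm hp (show 0 < h by linarith)
  have hlim' := (hlim.comp (Filter.tendsto_add_atTop_nat N)).sub_const
    (wronskianRatio a B (N * h) * lineDet a B Qu h N)
  rw [norm_sub_rev]
  refine le_of_tendsto hlim'.norm (Filter.Eventually.of_forall fun r => ?_)
  simp only [Function.comp]
  rw [add_comm r N]
  have h1 := hK₁ a B Qs Qu N r h ha hd hh hh2
  obtain ⟨-, h2⟩ := hK₂ a B N r h ha hh hh2
  obtain ⟨h3, -⟩ := hK₂ a B (N + r) 0 h ha hh hh2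
  have h4 := norm_lineDet_le ha hd hν hg hh hh2 N
  set w := wronskianRatio a B (N * h)
  set w' := wronskianRatio a B ((N + r : ℕ) * h)
  set f := lineDet a B Qu h N
  set f' := lineDet a B Qu h (N + r)
  have hK₂0 : 0 ≤ K₂ := (norm_nonneg _).trans h3
  calc ‖w' * f' - w * f‖ = ‖w' * (f' - f) + (w' - w) * f‖ := by ring_nf
    _ ≤ ‖w'‖ * ‖f' - f‖ + ‖w' - w‖ * ‖f‖ := by
        rw [← norm_mul, ← norm_mul]
        exact norm_add_le _ _
    _ ≤ K₂ * (K₁ * Real.exp (-η * (N * h))) + K₂ * Real.exp (-η * (N * h)) * D := by gcongr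
    _ = _ := by ring

/-- Monodromy matrices with different base points are similar, so the period may be centered at the
pulse. -/
theorem det_propagator_sub (hb : Continuous b) {X : ℝ} (hX : Function.Periodic b X) {y : ℝ}
    (γ : ℂ) : (propagator b (y + X) y - γ • (1 : CMat n)).det =
      (solutionOperator b X - γ • (1 : CMat n)).det := by
  have hS := isUnit_det_solutionOperator hb y
  have h : propagator b (y + X) y - γ • (1 : CMat n) =
      solutionOperator b y * (solutionOperator b X - γ • (1 : CMat n)) *
        (solutionOperator b y)⁻¹ := by
    rw [propagator, solutionOperator_add_period hb hX, mul_sub, sub_mul, mul_smul_comm, mul_one,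
      smul_mul_assoc, Matrix.mul_nonsing_inv _ hS]
  rw [h, Matrix.det_mul, Matrix.det_mul, mul_right_comm, ← Matrix.det_mul,
    Matrix.mul_nonsing_inv _ hS, Matrix.det_one, one_mul]

/-- The periodic Evans function, suitably normalized, is exponentially close to the Evans function
of the line. -/
theorem exists_norm_periodic_sub_evans_le (n : ℕ) {L C ν θ g η c : ℝ} (hη : 0 < η) (hην : η < ν)
    (hηθ : η < θ) (hηg : η < g) :
    ∃ K X₀, ∀ (a b : ℝ → CMat n) (B Qs Qu : CMat n) (X : ℝ) (γ d : ℂ),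
      IsLimitSystem a B L C ν → IsDichotomy B Qs Qu c g → Continuous b → Function.Periodic b X →
      ‖γ‖ = 1 → X₀ ≤ X →
      (∀ x, |x| ≤ X / 2 → ‖b x - a x‖ ≤ C * Real.exp (-θ * (X / 2))) → IsEvansValue a B d →
      (flow B X - γ • (1 : CMat n)).det ≠ 0 ∧
      ‖wronskianRatio a B (X / 2) * ((solutionOperator b X - γ • (1 : CMat n)).det /
        (flow B X - γ • (1 : CMat n)).det) - d‖ ≤ K * Real.exp (-η * (X / 2)) := by
  have hν : 0 < ν := hη.trans hην
  have hg : 0 < g := hη.trans hηg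
  obtain ⟨K₁, hK₁⟩ := exists_norm_det_periodic_sub_le n (L := L) (C := C) (c := c) hη hην hηθ hηg
  obtain ⟨K₂, hK₂⟩ := exists_norm_wronskianRatio_le n (L := L) (C := C) hη hην
  obtain ⟨K₃, hK₃⟩ := exists_norm_lineDet_sub_evans_le n (L := L) (C := C) (c := c) hη hην hg
  -- The threshold gives `X ≥ 2`, so that the half period contains a step, and `c * e^{-gX} ≤ 1/2`
  -- through `e^{gX} ≥ gX + 1`.
  refine ⟨K₂ * K₁ + K₃, 2 + 2 * |c| / g, ?_⟩
  intro a b B Qs Qu X γ d ha hd hb hper hγ hX hab hval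
  have hX2 : 2 ≤ X := by
    have : 0 ≤ 2 * |c| / g := by positivity
    linarith
  -- Rounding down the half period makes the step length `h = X / 2 / N` lie between `1` and `2`
  -- while `N * h` is the half period exactly.
  set N := ⌊X / 2⌋₊
  have hN1 : (N : ℝ) ≤ X / 2 := Nat.floor_le (by linarith)
  have hN2 : X / 2 < N + 1 := Nat.lt_floor_add_one _
  have hN0 : 1 ≤ N := Nat.one_le_floor_iff _ |>.2 (by linarith)
  have hN0' : (1 : ℝ) ≤ N := by exact_mod_cast hN0
  set h := X / 2 / N
  have hNh : (N : ℝ) * h = X / 2 := by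
    simp only [h]
    field_simp
  have hh : 1 ≤ h := by
    rw [le_div_iff₀ (by linarith)]
    linarith
  have hh2 : h ≤ 2 := by
    rw [div_le_iff₀ (by linarith)]
    linarith
  have hmh : ((2 * N : ℕ) : ℝ) * h = X := by
    push_cast
    linarith
  have hs : c * Real.exp (-g * X) ≤ 1 / 2 := by
    have h1 : 2 * c ≤ Real.exp (g * X) := by
      have h2 : 2 * |c| ≤ g * X := by
        have : g * (2 + 2 * |c| / g) ≤ g * X := by gcongr
        rw [mul_add, mul_div_cancel₀ _ hg.ne'] at this
        linarith
      linarith [Real.add_one_le_exp (g * X), le_abs_self c]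
    rw [neg_mul, Real.exp_neg, ← div_eq_mul_inv, div_le_iff₀ (Real.exp_pos _)]
    linarith
  have hdet := det_flow_sub_ne_zero hd (by linarith) hs hγ
  refine ⟨hdet, ?_⟩
  have e1 := hK₁ a b B Qs Qu N h γ ha hd hb hh hh2 hγ (by rwa [hmh]) (by rwa [hNh])
  obtain ⟨e2, -⟩ := hK₂ a B N 0 h ha hh hh2
  have e3 := hK₃ a B Qs Qu N h d ha hd hh hh2 hval
  have hline : (1 + flow B (-((2 * N : ℕ) * h)) * Qu *
      (propagator a (N * h) (-(N * h)) - flow B ((2 * N : ℕ) * h))).det = lineDet a B Qu h N := rfl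
  rw [hline, hmh] at e1
  have hf : (1 + (flow B X - γ • (1 : CMat n))⁻¹ *
      (propagator b (N * h) (-(N * h)) - flow B X)).det =
      (solutionOperator b X - γ • (1 : CMat n)).det / (flow B X - γ • (1 : CMat n)).det := by
    set Y := flow B X - γ • (1 : CMat n)
    set F := propagator b (N * h) (-(N * h))
    have h1 : 1 + Y⁻¹ * (F - flow B X) = Y⁻¹ * (F - γ • (1 : CMat n)) := by
      have h2 : F - γ • (1 : CMat n) = (F - flow B X) + Y := by simp only [Y]; abel
      rw [h2, mul_add, Matrix.nonsing_inv_mul _ (isUnit_iff_ne_zero.2 hdet), add_comm]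
    have h3 := det_propagator_sub hb hper (y := -(N * h)) γ
    rw [show -((N : ℝ) * h) + X = N * h by linarith] at h3
    rw [h1, Matrix.det_mul, Matrix.det_nonsing_inv, Ring.inverse_eq_inv', h3, div_eq_inv_mul]
  rw [hf] at e1
  rw [hNh] at e1 e2 e3
  set w := wronskianRatio a B (X / 2)
  set f := (solutionOperator b X - γ • (1 : CMat n)).det / (flow B X - γ • (1 : CMat n)).det
  have hK₂0 : 0 ≤ K₂ := (norm_nonneg _).trans e2
  calc ‖w * f - d‖ = ‖w * (f - lineDet a B Qu h N) + (w * lineDet a B Qu h N - d)‖ := by ring_nf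
    _ ≤ ‖w‖ * ‖f - lineDet a B Qu h N‖ + ‖w * lineDet a B Qu h N - d‖ := by
        rw [← norm_mul]
        exact norm_add_le _ _
    _ ≤ K₂ * (K₁ * Real.exp (-η * (X / 2))) + K₃ * Real.exp (-η * (X / 2)) := by gcongr
    _ = _ := by ring

end EvansEstimate

/-! ### Factorization of zeros, the argument principle and Rouché's theorem. -/

section ZeroFactorization

/-- Dividing by the power and correcting the value at the one point `a` gives a global quotient, so
the factorization holds at every `z`, also off `V`. -/
theorem exists_factor_zero {V : Set ℂ} (hV : IsOpen V) {F : ℂ → ℂ} (hF : DifferentiableOn ℂ F V)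
    {a : ℂ} (ha : a ∈ V) (htop : analyticOrderAt F a ≠ ⊤) :
    ∃ (k : ℕ) (g : ℂ → ℂ), DifferentiableOn ℂ g V ∧ g a ≠ 0 ∧ ∀ z, F z = (z - a) ^ k * g z := by
  have hFa : AnalyticAt ℂ F a := hF.analyticAt (hV.mem_nhds ha)
  obtain ⟨g₀, hg₀, hg₀a, hFg⟩ := hFa.analyticOrderAt_ne_top.1 htop
  set k := analyticOrderNatAt F a
  refine ⟨k, fun z => if z = a then g₀ a else F z / (z - a) ^ k, ?_, by simpa using hg₀a,
    fun z => ?_⟩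
  · intro z hz
    by_cases h : z = a
    · subst h
      have he : (fun x => if x = z then g₀ z else F x / (x - z) ^ k) =ᶠ[nhds z] g₀ := by
        filter_upwards [hFg] with x hx
        split_ifs with h
        · rw [h]
        · rw [hx, smul_eq_mul, mul_div_cancel_left₀ _ (pow_ne_zero _ (sub_ne_zero.2 h))]
      exact (hg₀.differentiableAt.congr_of_eventuallyEq he).differentiableWithinAt
    · have he : (fun x => if x = a then g₀ a else F x / (x - a) ^ k) =ᶠ[nhds z]
          fun x => F x / (x - a) ^ k := by
        filter_upwards [isOpen_ne.mem_nhds h] with x hx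
        rw [if_neg hx]
      have hd : DifferentiableAt ℂ (fun x => F x / (x - a) ^ k) z :=
        (hF.differentiableAt (hV.mem_nhds hz)).div (by fun_prop)
          (pow_ne_zero _ (sub_ne_zero.2 h))
      exact (hd.congr_of_eventuallyEq he).differentiableWithinAt
  · by_cases h : z = a
    · subst h
      simpa using hFg.self_of_nhds
    · simp only [if_neg h]
      rw [mul_div_cancel₀ _ (pow_ne_zero _ (sub_ne_zero.2 h))]

theorem exists_prod_factorization {V S : Set ℂ} (hV : IsOpen V) (hS : S ⊆ V) (s : Finset ℂ) :
    ∀ F : ℂ → ℂ, DifferentiableOn ℂ F V → (∀ z ∈ S, F z = 0 → z ∈ s) → (↑s ⊆ S) →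
      (∀ z ∈ s, analyticOrderAt F z ≠ ⊤) →
      ∃ (ι : Type) (_ : Fintype ι) (ρ : ι → ℂ) (h : ℂ → ℂ), DifferentiableOn ℂ h V ∧
        (∀ k, ρ k ∈ s) ∧ (∀ z ∈ S, h z ≠ 0) ∧ ∀ z, F z = (∏ k, (z - ρ k)) * h z := by
  classical
  induction s using Finset.induction_on with
  | empty =>
    intro F hF h0 _ _
    exact ⟨Empty, inferInstance, Empty.elim, F, hF, fun k => k.elim,
      fun z hz hz0 => by simpa using h0 z hz hz0, fun z => by simp⟩
  | insert a s has ih =>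
    intro F hF h0 hsS htop
    have haS : a ∈ S := hsS (by simp)
    obtain ⟨k, g, hg, hga, hFg⟩ := exists_factor_zero hV hF (hS haS) (htop a (by simp))
    obtain ⟨ι, hι, ρ, h, hh, hρ, hh0, hgρ⟩ := ih g hg (fun z hz hz0 => by
        have h1 := h0 z hz (by rw [hFg, hz0, mul_zero])
        rcases Finset.mem_insert.1 h1 with rfl | h2
        · exact absurd hz0 hga
        · exact h2) (fun z hz => hsS (by simp [Finset.mem_coe.1 hz])) (fun z hz hzt => by
        refine htop z (Finset.mem_insert_of_mem hz) (analyticOrderAt_eq_top.2 ?_)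
        filter_upwards [analyticOrderAt_eq_top.1 hzt] with x hx
        rw [hFg, hx, mul_zero])
    refine ⟨ι ⊕ Fin k, inferInstance, Sum.elim ρ fun _ => a, h, hh, ?_, hh0, fun z => ?_⟩
    · rintro (j | j)
      · exact Finset.mem_insert_of_mem (hρ j)
      · exact Finset.mem_insert_self _ _
    · rw [hFg, hgρ, Fintype.prod_sum_type]
      simp only [Sum.elim_inl, Sum.elim_inr, Finset.prod_const, Finset.card_univ, Fintype.card_fin]
      ring

/-- A compact set contains finitely many zeros of a holomorphic function if none has infinite order. -/
theorem finite_zeros_of_order_ne_top {V S : Set ℂ} (hV : IsOpen V) (hS : S ⊆ V)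
    (hSc : IsCompact S) {F : ℂ → ℂ} (hF : DifferentiableOn ℂ F V)
    (htop : ∀ z ∈ S, analyticOrderAt F z ≠ ⊤) : {z ∈ S | F z = 0}.Finite := by
  by_contra hinf
  obtain ⟨x, hx, hacc⟩ := Set.Infinite.exists_accPt_of_subset_isCompact
    (K := S) hinf hSc (fun z hz => hz.1)
  have hfreq : ∃ᶠ z in nhdsWithin x {x}ᶜ, F z = 0 := by
    rw [accPt_iff_frequently_nhdsNE] at hacc
    exact hacc.mono fun z hz => hz.2
  exact htop x hx (analyticOrderAt_eq_top.2
    ((hF.analyticAt (hV.mem_nhds (hS hx))).frequently_zero_iff_eventually_zero.1 hfreq))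

/-- A holomorphic function without zeros on a circle is a product of linear factors and a
nonvanishing function in the disk. -/
theorem exists_disk_factorization {V : Set ℂ} (hV : IsOpen V) {w : ℂ} {r : ℝ} (hr : 0 < r)
    (hS : Metric.closedBall w r ⊆ V) {F : ℂ → ℂ} (hF : DifferentiableOn ℂ F V)
    (h0 : ∀ z ∈ Metric.sphere w r, F z ≠ 0) :
    ∃ (m : ℕ) (ρ : Fin m → ℂ) (h : ℂ → ℂ), DifferentiableOn ℂ h V ∧
      (∀ k, ρ k ∈ Metric.ball w r) ∧ (∀ z ∈ Metric.closedBall w r, h z ≠ 0) ∧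
      ∀ z, F z = (∏ k, (z - ρ k)) * h z := by
  -- A zero of infinite order would force `F` to vanish on the whole disk, including this point of
  -- the circle.
  obtain ⟨y, hy⟩ := NormedSpace.sphere_nonempty (E := ℂ) (x := w).2 hr.le
  have hFan : AnalyticOnNhd ℂ F (Metric.closedBall w r) := fun z hz =>
    hF.analyticAt (hV.mem_nhds (hS hz))
  have htop : ∀ z ∈ Metric.closedBall w r, analyticOrderAt F z ≠ ⊤ := fun z hz hzt =>
    h0 y hy (hFan.eqOn_zero_of_preconnected_of_eventuallyEq_zero
      (convex_closedBall w r).isPreconnected hz (analyticOrderAt_eq_top.1 hzt)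
      (Metric.sphere_subset_closedBall hy))
  have hfin := finite_zeros_of_order_ne_top hV hS (isCompact_closedBall w r) hF htop
  obtain ⟨ι, hι, ρ, h, hh, hρ, hh0, hFρ⟩ := exists_prod_factorization hV hS hfin.toFinset F hF
    (fun z hz hz0 => by simpa using ⟨hz, hz0⟩) (fun z hz => by
      have := hfin.mem_toFinset.1 hz
      exact this.1) (fun z hz => htop z (hfin.mem_toFinset.1 hz).1)
  let e := Fintype.equivFin ι
  refine ⟨Fintype.card ι, ρ ∘ e.symm, h, hh, fun k => ?_, hh0, fun z => ?_⟩
  · have h1 := hfin.mem_toFinset.1 (hρ (e.symm k))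
    have h2 : ρ (e.symm k) ∉ Metric.sphere w r := fun hs => h0 _ hs h1.2
    exact lt_of_le_of_ne h1.1 h2
  · rw [hFρ]
    congr 1
    exact Fintype.prod_equiv e _ _ fun k => by simp

theorem analyticOrderAt_prod_sub_mul {V : Set ℂ} (hV : IsOpen V) {m : ℕ} {ρ : Fin m → ℂ}
    {h F : ℂ → ℂ} (hh : DifferentiableOn ℂ h V) (hF : ∀ z, F z = (∏ k, (z - ρ k)) * h z) {z : ℂ}
    (hz : z ∈ V) (hz0 : h z ≠ 0) :
    analyticOrderAt F z = ((Finset.univ.filter fun k => ρ k = z).card : ℕ∞) := by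
  have hha : AnalyticAt ℂ h z := hh.analyticAt (hV.mem_nhds hz)
  have key : ∀ s : Finset (Fin m), AnalyticAt ℂ (fun x => ∏ k ∈ s, (x - ρ k)) z ∧
      analyticOrderAt (fun x => ∏ k ∈ s, (x - ρ k)) z =
        ((s.filter fun k => ρ k = z).card : ℕ∞) := fun s => by
    induction s using Finset.induction_on with
    | empty =>
      refine ⟨by simpa using analyticAt_const, ?_⟩
      simp only [Finset.prod_empty, Finset.filter_empty, Finset.card_empty, Nat.cast_zero]
      exact analyticOrderAt_eq_zero.2 (Or.inr one_ne_zero)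
    | insert a s has ih =>
      have hlin : AnalyticAt ℂ (fun x : ℂ => x - ρ a) z := analyticAt_id.sub analyticAt_const
      have hfun : (fun x => ∏ k ∈ insert a s, (x - ρ k)) =
          (fun x => x - ρ a) * fun x => ∏ k ∈ s, (x - ρ k) := by
        funext x
        simp [Finset.prod_insert has]
      rw [hfun]
      refine ⟨hlin.mul ih.1, ?_⟩
      rw [analyticOrderAt_mul hlin ih.1, ih.2, Finset.filter_insert]
      split_ifs with h1
      · rw [Finset.card_insert_of_notMem (by simp [has]), ← h1]
        have : analyticOrderAt (fun x : ℂ => x - ρ a) (ρ a) = 1 := analyticOrderAt_id_sub_const_self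
        rw [this]
        push_cast
        ring
      · have : analyticOrderAt (fun x : ℂ => x - ρ a) z = 0 :=
          analyticOrderAt_eq_zero.2 (Or.inr (sub_ne_zero.2 (Ne.symm h1)))
        rw [this, zero_add]
  have hF' : F = (fun x => ∏ k, (x - ρ k)) * h := funext fun x => hF x
  rw [hF', analyticOrderAt_mul (key _).1 hha, (key _).2, hha.analyticOrderAt_eq_zero.2 hz0,
    add_zero]

theorem circleIntegral_inv_sub_of_notMem_closedBall {ζ a : ℂ} {r : ℝ} (hr : 0 ≤ r)
    (ha : a ∉ Metric.closedBall ζ r) : (∮ z in C(ζ, r), (z - a)⁻¹) = 0 := by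
  have hd : DifferentiableOn ℂ (fun z => (z - a)⁻¹) (Metric.closedBall ζ r) :=
    fun z hz => (DifferentiableAt.inv (by fun_prop)
      (sub_ne_zero.2 fun he => ha (by rwa [← he]))).differentiableWithinAt
  exact (hd.diffContOnCl_ball le_rfl).circleIntegral_eq_zero hr

open scoped Classical in
theorem circleIntegral_sum_inv_sub {m : ℕ} {ρ : Fin m → ℂ} {ζ : ℂ} {r : ℝ} (hr : 0 < r)
    (hρ : ∀ k, ρ k ∉ Metric.sphere ζ r) :
    (∮ z in C(ζ, r), ∑ k, (z - ρ k)⁻¹) =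
      2 * Real.pi * Complex.I * (Finset.univ.filter fun k => ρ k ∈ Metric.ball ζ r).card := by
  have hI1 : ∀ k, CircleIntegrable (fun z => (z - ρ k)⁻¹) ζ r := fun k => by
    refine ContinuousOn.circleIntegrable hr.le fun z hz => ?_
    have hz0 : z - ρ k ≠ 0 := sub_ne_zero.2 fun hk => hρ k (by rwa [← hk])
    have hc : ContinuousAt (fun z => z - ρ k) z := by fun_prop
    exact (hc.inv₀ hz0).continuousWithinAt
  have h4 : ∀ k, (∮ z in C(ζ, r), (z - ρ k)⁻¹) =
      if ρ k ∈ Metric.ball ζ r then 2 * Real.pi * Complex.I else 0 := fun k => by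
    split_ifs with hk
    · exact circleIntegral.integral_sub_inv_of_mem_ball hk
    · refine circleIntegral_inv_sub_of_notMem_closedBall hr.le fun hc => ?_
      rcases (Metric.mem_closedBall.1 hc).lt_or_eq with h5 | h5
      · exact hk h5
      · exact hρ k h5
  rw [circleIntegral.integral_fun_sum fun k _ => hI1 k, Finset.sum_congr rfl fun k _ => h4 k,
    ← Finset.sum_filter, Finset.sum_const, nsmul_eq_mul, mul_comm]

theorem differentiableOn_logDeriv {V : Set ℂ} (hV : IsOpen V) {h : ℂ → ℂ}
    (hh : DifferentiableOn ℂ h V) {S : Set ℂ} (hS : S ⊆ V) (h0 : ∀ z ∈ S, h z ≠ 0) :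
    DifferentiableOn ℂ (logDeriv h) S := fun z hz => by
  have hz' := hV.mem_nhds (hS hz)
  exact (((hh.deriv hV).differentiableAt hz').div (hh.differentiableAt hz')
    (h0 z hz)).differentiableWithinAt

theorem logDeriv_prod_sub_mul {m : ℕ} {ρ : Fin m → ℂ} {h : ℂ → ℂ} {z : ℂ}
    (hne : ∀ k, z ≠ ρ k) (hz : h z ≠ 0) (hd : DifferentiableAt ℂ h z) :
    logDeriv (fun z => (∏ k, (z - ρ k)) * h z) z = (∑ k, (z - ρ k)⁻¹) + logDeriv h z := by
  have hne' : ∀ k, z - ρ k ≠ 0 := fun k => sub_ne_zero.2 (hne k)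
  rw [logDeriv_mul z (Finset.prod_ne_zero_iff.2 fun k _ => hne' k) hz (by fun_prop) hd]
  congr 1
  have h2 := logDeriv_prod (s := Finset.univ) (f := fun k z => z - ρ k) (x := z)
    (fun k _ => hne' k) (fun k _ => by fun_prop)
  refine h2.trans (Finset.sum_congr rfl fun k _ => ?_)
  simp [logDeriv_apply]

open scoped Classical in
/-- The argument principle for a factored function. -/
theorem circleIntegral_logDeriv_of_factorization {V : Set ℂ} (hV : IsOpen V) {m : ℕ}
    {ρ : Fin m → ℂ} {h F : ℂ → ℂ} (hh : DifferentiableOn ℂ h V)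
    (hF : ∀ z, F z = (∏ k, (z - ρ k)) * h z) {ζ : ℂ} {r : ℝ} (hr : 0 < r)
    (hS : Metric.closedBall ζ r ⊆ V) (h0 : ∀ z ∈ Metric.closedBall ζ r, h z ≠ 0)
    (hρ : ∀ k, ρ k ∉ Metric.sphere ζ r) :
    (∮ z in C(ζ, r), logDeriv F z) =
      2 * Real.pi * Complex.I * (Finset.univ.filter fun k => ρ k ∈ Metric.ball ζ r).card := by
  have hFe : F = fun z => (∏ k, (z - ρ k)) * h z := funext hF
  have hsph : Set.EqOn (logDeriv F) (fun z => (∑ k, (z - ρ k)⁻¹) + logDeriv h z)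
      (Metric.sphere ζ r) := fun z hz => by
    have hzc := Metric.sphere_subset_closedBall hz
    rw [hFe]
    exact logDeriv_prod_sub_mul (fun k hk => hρ k (by rwa [← hk])) (h0 z hzc)
      (hh.differentiableAt (hV.mem_nhds (hS hzc)))
  have hlog := differentiableOn_logDeriv hV hh hS h0
  have hI1 : CircleIntegrable (fun z => ∑ k, (z - ρ k)⁻¹) ζ r := by
    refine ContinuousOn.circleIntegrable hr.le (continuousOn_finsetSum _ fun k _ z hz => ?_)
    have hz0 : z - ρ k ≠ 0 := sub_ne_zero.2 fun hk => hρ k (by rwa [← hk])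
    have hc : ContinuousAt (fun z => z - ρ k) z := by fun_prop
    exact (hc.inv₀ hz0).continuousWithinAt
  have hI2 : CircleIntegrable (logDeriv h) ζ r :=
    (hlog.continuousOn.mono Metric.sphere_subset_closedBall).circleIntegrable hr.le
  have h3 : (∮ z in C(ζ, r), logDeriv h z) = 0 :=
    (hlog.diffContOnCl_ball le_rfl).circleIntegral_eq_zero hr.le
  rw [circleIntegral.integral_congr hr.le hsph, circleIntegral.integral_add hI1 hI2, h3, add_zero,
    circleIntegral_sum_inv_sub hr hρ]

/-- Rouché: the logarithmic derivatives of close functions have the same integral. -/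
theorem circleIntegral_logDeriv_eq {V : Set ℂ} (hV : IsOpen V) {F D : ℂ → ℂ}
    (hF : DifferentiableOn ℂ F V) (hD : DifferentiableOn ℂ D V) {ζ : ℂ} {r : ℝ} (hr : 0 < r)
    (hS : Metric.sphere ζ r ⊆ V) (hlt : ∀ z ∈ Metric.sphere ζ r, ‖F z - D z‖ < ‖D z‖) :
    (∮ z in C(ζ, r), logDeriv F z) = ∮ z in C(ζ, r), logDeriv D z := by
  have hD0 : ∀ z ∈ Metric.sphere ζ r, D z ≠ 0 := fun z hz h0 => by
    have := hlt z hz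
    rw [h0, norm_zero] at this
    exact absurd this (not_lt.2 (norm_nonneg _))
  have hF0 : ∀ z ∈ Metric.sphere ζ r, F z ≠ 0 := fun z hz h0 => by
    have := hlt z hz
    rw [h0, zero_sub, norm_neg] at this
    exact lt_irrefl _ this
  have hint : ∀ G : ℂ → ℂ, DifferentiableOn ℂ G V → (∀ z ∈ Metric.sphere ζ r, G z ≠ 0) →
      CircleIntegrable (logDeriv G) ζ r := fun G hG hG0 =>
    ContinuousOn.circleIntegrable hr.le fun z hz => by
      have hz' := hV.mem_nhds (hS hz)
      exact (((hG.deriv hV).differentiableAt hz').continuousAt.div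
        (hG.differentiableAt hz').continuousAt (hG0 z hz)).continuousWithinAt
  rw [← sub_eq_zero, ← circleIntegral.integral_sub (hint F hF hF0) (hint D hD hD0)]
  -- On the circle the quotient stays within distance one of `1`, so the principal logarithm of it
  -- is a primitive of the difference of the logarithmic derivatives.
  refine circleIntegral.integral_eq_zero_of_hasDerivWithinAt (f := fun z => Complex.log (F z / D z))
    hr.le fun z hz => ?_
  have hz' := hV.mem_nhds (hS hz)
  have hFz := hF.differentiableAt hz'
  have hDz := hD.differentiableAt hz'
  have hq : F z / D z ∈ Complex.slitPlane := by
    refine Or.inl ?_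
    have h1 : ‖F z / D z - 1‖ < 1 := by
      rw [div_sub_one (hD0 z hz), norm_div, div_lt_one (norm_pos_iff.2 (hD0 z hz))]
      exact hlt z hz
    have h2 := (abs_lt.1 ((Complex.abs_re_le_norm _).trans_lt h1)).1
    rw [Complex.sub_re, Complex.one_re] at h2
    linarith
  have h3 := ((hFz.div hDz (hD0 z hz)).hasDerivAt.clog hq).hasDerivWithinAt (s := Metric.sphere ζ r)
  refine h3.congr_deriv ?_
  exact logDeriv_div z (hF0 z hz) (hD0 z hz) hFz hDz

end ZeroFactorization

/-! ### Continuous selection from paths of unordered tuples. -/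

section ContinuousSelection

variable {E : Type*} [PseudoMetricSpace E]

theorem perm_apply_inv_apply {α : Type*} (π : Equiv.Perm α) (k : α) : π (π⁻¹ k) = k :=
  π.apply_symm_apply k

/-- A chain with small steps in a union of small balls does not move far. -/
theorem dist_le_of_chain {p : ℕ → E} {r : ℝ} {b : ℕ} (s : Finset E) :
    ∀ a, a ≤ b → (∀ i, a ≤ i → i ≤ b → ∃ c ∈ s, dist (p i) c ≤ r) →
      (∀ i, a ≤ i → i < b → dist (p (i + 1)) (p i) ≤ r) →
      dist (p b) (p a) ≤ 3 * r * s.card := by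
  classical
  induction s using Finset.strongInduction with
  | H s ih =>
    intro a hab hc hstep
    obtain ⟨c, hcs, hca⟩ := hc a le_rfl hab
    have hr : 0 ≤ r := dist_nonneg.trans hca
    -- Jumping to the last visit to the ball around `c` costs at most `2 r`, the next step at most
    -- `r`, and afterwards `c` is no longer needed.
    set i := Nat.findGreatest (fun i => a ≤ i ∧ dist (p i) c ≤ r) b with hi
    have hspec : a ≤ i ∧ dist (p i) c ≤ r :=
      Nat.findGreatest_spec (P := fun i => a ≤ i ∧ dist (p i) c ≤ r) hab ⟨le_rfl, hca⟩
    have hib : i ≤ b := Nat.findGreatest_le b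
    have hia : dist (p i) (p a) ≤ 2 * r := by
      have := dist_triangle_right (p i) (p a) c
      linarith [hspec.2]
    have hcard : (1 : ℝ) ≤ s.card := by exact_mod_cast Finset.card_pos.2 ⟨c, hcs⟩
    rcases hib.eq_or_lt with h | h
    · rw [h] at hia
      nlinarith
    · have h1 := ih (s.erase c) (Finset.erase_ssubset hcs) (i + 1) h (fun j hj hjb => by
        obtain ⟨c', hc's, hc'⟩ := hc j (by omega) hjb
        refine ⟨c', Finset.mem_erase.2 ⟨?_, hc's⟩, hc'⟩
        rintro rfl
        exact Nat.findGreatest_is_greatest (P := fun i => a ≤ i ∧ dist (p i) c' ≤ r)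
          (show i < j by omega) hjb ⟨by omega, hc'⟩) (fun j hj hjb => hstep j (by omega) hjb)
      have h2 := hstep i hspec.1 h
      have h3 : ((s.erase c).card : ℝ) = s.card - 1 := by
        rw [Finset.card_erase_of_mem hcs, Nat.cast_sub (by exact_mod_cast hcard), Nat.cast_one]
      rw [h3] at h1
      have h4 := dist_triangle4 (p b) (p (i + 1)) (p i) (p a)
      nlinarith

variable {m : ℕ}

/-- A uniformly continuous family of unordered tuples has a continuous selection. -/
theorem exists_continuousOn_selection {R : ℝ → Fin m → E}
    (hU : ∀ ε > 0, ∃ δ > 0, ∀ s t, dist s t < δ →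
      ∃ π : Equiv.Perm (Fin m), ∀ k, dist (R t (π k)) (R s k) < ε) :
    ∃ x : ℝ → Fin m → E, ContinuousOn x (Set.Ici 0) ∧
      ∀ t, 0 ≤ t → ∃ π : Equiv.Perm (Fin m), x t = R t ∘ π := by
  choose! δ hδ hmatch using hU
  set ε : ℕ → ℝ := fun i => 1 / ((i : ℝ) + 1) with hε
  have hεpos : ∀ i, 0 < ε i := fun i => by positivity
  have hεlim : Filter.Tendsto ε Filter.atTop (nhds 0) := tendsto_one_div_add_atTop_nhds_zero_nat
  set h : ℕ → ℝ := fun i => min (δ (ε i)) (ε i) / 2 with hh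
  have hhpos : ∀ i, 0 < h i := fun i => half_pos (lt_min (hδ _ (hεpos i)) (hεpos i))
  have hhδ : ∀ i, h i < δ (ε i) := fun i =>
    (half_lt_self (lt_min (hδ _ (hεpos i)) (hεpos i))).trans_le (min_le_left _ _)
  have hhε : ∀ i, h i < ε i := fun i =>
    (half_lt_self (lt_min (hδ _ (hεpos i)) (hεpos i))).trans_le (min_le_right _ _)
  -- chains on grids
  have hchain : ∀ i, ∃ τ : ℕ → Equiv.Perm (Fin m), ∀ j k,
      dist (R ((j + 1 : ℕ) * h i) (τ (j + 1) k)) (R (j * h i) (τ j k)) < ε i := fun i => by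
    have hst : ∀ j : ℕ, ∃ π : Equiv.Perm (Fin m), ∀ k,
        dist (R ((j + 1 : ℕ) * h i) (π k)) (R (j * h i) k) < ε i := fun j => by
      refine hmatch _ (hεpos i) _ _ ?_
      rw [dist_comm, Real.dist_eq]
      push_cast
      rw [add_mul, one_mul, add_sub_cancel_left, abs_of_pos (hhpos i)]
      exact hhδ i
    choose π hπ using hst
    exact ⟨fun j => Nat.rec 1 (fun j σ => π j * σ) j, fun j k => hπ j _⟩
  choose τ hτ using hchain
  set P : ℕ → ℕ → Fin m → E := fun i j k => R (j * h i) (τ i j k) with hP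
  have hfloor : ∀ i t, 0 ≤ t → dist t (⌊t / h i⌋₊ * h i) < h i := fun i t ht => by
    have h1 := Nat.floor_le (div_nonneg ht (hhpos i).le)
    have h2 := Nat.lt_floor_add_one (t / h i)
    rw [le_div_iff₀ (hhpos i)] at h1
    rw [div_lt_iff₀ (hhpos i)] at h2
    rw [Real.dist_eq, abs_of_nonneg (by linarith)]
    linarith
  have hρ : ∀ i t, ∃ ρ : Equiv.Perm (Fin m), 0 ≤ t → ∀ k,
      dist (P i ⌊t / h i⌋₊ k) (R t (ρ k)) < ε i := fun i t => by
    by_cases ht : 0 ≤ t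
    · obtain ⟨π, hπ⟩ := hmatch _ (hεpos i) t (⌊t / h i⌋₊ * h i) ((hfloor i t ht).trans (hhδ i))
      refine ⟨π⁻¹ * τ i ⌊t / h i⌋₊, fun _ k => ?_⟩
      have := hπ (π⁻¹ (τ i ⌊t / h i⌋₊ k))
      rwa [perm_apply_inv_apply] at this
    · exact ⟨1, fun h => absurd h ht⟩
  choose ρ hρ using hρ
  -- limit along an ultrafilter
  set U : Ultrafilter ℕ := Filter.hyperfilter ℕ
  have hUle : (U : Filter ℕ) ≤ Filter.atTop := Nat.hyperfilter_le_atTop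
  -- There are finitely many permutations, so the ultrafilter settles on one for each `t`.
  have hconst : ∀ t, ∃ a : Equiv.Perm (Fin m), ∀ᶠ i in (U : Filter ℕ), ρ i t = a := fun t => by
    obtain ⟨a, ha⟩ := Ultrafilter.eq_pure_of_finite (U.map fun i => ρ i t)
    refine ⟨a, ?_⟩
    have : ({a} : Set _) ∈ U.map fun i => ρ i t := by rw [ha]; exact Set.mem_singleton a
    exact this
  choose a ha using hconst
  have hlim : ∀ t, 0 ≤ t → ∀ k, Filter.Tendsto (fun i => P i ⌊t / h i⌋₊ k) U
      (nhds (R t (a t k))) := fun t ht k => by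
    rw [tendsto_iff_dist_tendsto_zero]
    refine squeeze_zero' (Filter.Eventually.of_forall fun _ => dist_nonneg) ?_ (hεlim.mono_left hUle)
    filter_upwards [ha t] with i hi
    rw [← hi]
    exact (hρ i t ht k).le
  -- The chain from `s` to `t` stays in `m` balls of radius `r` around the members of `R s`, so its
  -- displacement is bounded independently of the number of grid points; the bound passes to the
  -- limit.
  have hmod : ∀ r > 0, ∀ s t, 0 ≤ s → s ≤ t → t - s < δ r / 2 → ∀ k,
      dist (R t (a t k)) (R s (a s k)) ≤ 3 * r * m := fun r hr s t hs hst hlt k => by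
    classical
    refine le_of_tendsto ((hlim t (hs.trans hst) k).dist (hlim s hs k)) ?_
    have hδr := hδ r hr
    have he1 : ∀ᶠ i in (U : Filter ℕ), ε i < min r (δ r / 2) :=
      hUle ((tendsto_order.1 hεlim).2 _ (by positivity))
    filter_upwards [he1] with i hi
    have hir := hi.trans_le (min_le_left _ _)
    have hiδ := (hhε i).trans (hi.trans_le (min_le_right _ _))
    have hc := dist_le_of_chain (p := fun j => P i j k) (r := r) (b := ⌊t / h i⌋₊)
      (Finset.univ.image (R s)) ⌊s / h i⌋₊
      (Nat.floor_le_floor (by have := hhpos i; gcongr)) (fun j hj1 hj2 => ?_)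
      (fun j _ _ => (hτ i j k).le.trans hir.le)
    · refine hc.trans ?_
      have : ((Finset.univ.image (R s)).card : ℝ) ≤ m := by
        exact_mod_cast Finset.card_image_le.trans_eq (Finset.card_fin m)
      gcongr
    · have hd : dist s (j * h i) < δ r := by
        have h1 := abs_lt.1 (hfloor i s hs)
        have h2 := Nat.floor_le (div_nonneg (hs.trans hst) (hhpos i).le)
        rw [le_div_iff₀ (hhpos i)] at h2
        have h3 : (⌊s / h i⌋₊ : ℝ) * h i ≤ j * h i := by have := hhpos i; gcongr
        have h4 : (j : ℝ) * h i ≤ ⌊t / h i⌋₊ * h i := by have := hhpos i; gcongr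
        rw [Real.dist_eq, abs_lt]
        constructor <;> linarith
      obtain ⟨π, hπ⟩ := hmatch r hr s _ hd
      refine ⟨R s (π⁻¹ (τ i j k)), Finset.mem_image_of_mem _ (Finset.mem_univ _), ?_⟩
      have := hπ (π⁻¹ (τ i j k))
      rw [perm_apply_inv_apply] at this
      exact this.le
  refine ⟨fun t => R t ∘ a t, ?_, fun t _ => ⟨a t, rfl⟩⟩
  refine continuousOn_pi.2 fun k => Metric.continuousOn_iff.2 fun s hs η hη => ?_
  -- The added `1` covers `m = 0` and makes the inequality strict.
  set r := η / (3 * m + 1) with hr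
  have hrpos : 0 < r := by positivity
  have hrη : 3 * r * m < η := by
    have h1 : r * (3 * m + 1) = η := div_mul_cancel₀ _ (by positivity)
    nlinarith
  refine ⟨δ r / 2, half_pos (hδ r hrpos), fun t ht hts => ?_⟩
  rw [Real.dist_eq, abs_lt] at hts
  rcases le_total s t with h1 | h1
  · exact (hmod r hrpos s t hs h1 (by linarith) k).trans_lt hrη
  · rw [dist_comm]
    exact (hmod r hrpos t s ht h1 (by linarith) k).trans_lt hrη

/-- A Lebesgue number for one period works everywhere: both tuples are matched within `ε / 2` to the
same reference tuple. Only `s` has to be moved into `[0, T]`; `t` is moved by the same multiple of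
`T`. -/
theorem uniform_matching_of_periodic {R : ℝ → Fin m → E} {T : ℝ} (hT : 0 < T)
    (hper : Function.Periodic R T)
    (hR : ∀ s, ∀ ε > 0, ∀ᶠ t in nhds s,
      ∃ π : Equiv.Perm (Fin m), ∀ k, dist (R t (π k)) (R s k) < ε) :
    ∀ ε > 0, ∃ δ > 0, ∀ s t, dist s t < δ →
      ∃ π : Equiv.Perm (Fin m), ∀ k, dist (R t (π k)) (R s k) < ε := by
  intro ε hε
  obtain ⟨δ, hδ, hL⟩ := lebesgue_number_lemma_of_metric (s := Set.Icc 0 T)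
    (c := fun s : ℝ => interior {t | ∃ π : Equiv.Perm (Fin m), ∀ k,
      dist (R t (π k)) (R s k) < ε / 2}) isCompact_Icc (fun _ => isOpen_interior)
    (fun s _ => Set.mem_iUnion.2 ⟨s, mem_interior_iff_mem_nhds.2 (hR s _ (half_pos hε))⟩)
  refine ⟨δ, hδ, fun s t hst => ?_⟩
  set n := toIcoDiv hT 0 s
  have hs : s - n • T ∈ Set.Icc 0 T := by
    have := sub_toIcoDiv_zsmul_mem_Ico hT 0 s
    rw [zero_add] at this
    exact Set.Ico_subset_Icc_self this
  obtain ⟨u, hu⟩ := hL _ hs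
  obtain ⟨π, hπ⟩ := interior_subset (hu (Metric.mem_ball_self hδ))
  obtain ⟨π', hπ'⟩ := interior_subset (hu (show t - n • T ∈ Metric.ball (s - n • T) δ by
    rw [Metric.mem_ball, dist_sub_right, dist_comm]; exact hst))
  rw [hper.sub_zsmul_eq] at hπ hπ'
  refine ⟨π' * π⁻¹, fun k => ?_⟩
  have h1 := hπ (π⁻¹ k)
  have h2 := hπ' (π⁻¹ k)
  rw [perm_apply_inv_apply] at h1
  have h3 := dist_triangle_right (R t (π' (π⁻¹ k))) (R s k) (R u (π⁻¹ k))
  rw [Equiv.Perm.mul_apply]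
  linarith

/-- A continuous periodic family of unordered tuples is parametrized by continuous functions that
are permuted after a period. -/
theorem exists_continuous_selection_of_periodic {R : ℝ → Fin m → E} {T : ℝ} (hT : 0 < T)
    (hper : Function.Periodic R T)
    (hR : ∀ s, ∀ ε > 0, ∀ᶠ t in nhds s,
      ∃ π : Equiv.Perm (Fin m), ∀ k, dist (R t (π k)) (R s k) < ε) :
    ∃ (x : ℝ → Fin m → E) (σ : Equiv.Perm (Fin m)), Continuous x ∧
      (∀ t k, x (t + T) k = x t (σ k)) ∧ ∀ t, ∃ π : Equiv.Perm (Fin m), x t = R t ∘ π := by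
  obtain ⟨x, hx, hxR⟩ := exists_continuousOn_selection (uniform_matching_of_periodic hT hper hR)
  obtain ⟨π₀, h₀⟩ := hxR 0 le_rfl
  obtain ⟨π₁, h₁⟩ := hxR T hT.le
  set σ := π₀⁻¹ * π₁
  have hσ : x T = x 0 ∘ σ := by
    have : R T = R 0 := by simpa using hper 0
    rw [h₁, h₀, this]
    funext k
    simp [σ]
  set y : ℝ → Fin m → E := fun t => x (t - toIcoDiv hT 0 t • T) ∘ ⇑(σ ^ toIcoDiv hT 0 t) with hy
  have hIco : ∀ t, t - toIcoDiv hT 0 t • T ∈ Set.Ico 0 T := fun t => by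
    simpa using sub_toIcoDiv_zsmul_mem_Ico hT 0 t
  refine ⟨y, σ, ?_, fun t k => ?_, fun t => ?_⟩
  · have hdiv : ∀ (j : ℤ) t, j • T ≤ t → t < (j + 1) • T → toIcoDiv hT 0 t = j :=
      fun j t h1 h2 => toIcoDiv_eq_of_sub_zsmul_mem_Ico hT (by
        rw [add_smul, one_smul] at h2
        constructor <;> linarith)
    -- The definition of `y` uses half-open periods; the formula extends to the right endpoint
    -- because `x T = x 0 ∘ σ`, which is what makes the pieces glue continuously.
    have hEq : ∀ j : ℤ, Set.EqOn y (fun t => x (t - j • T) ∘ ⇑(σ ^ j))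
        (Set.Icc (j • T) ((j + 1) • T)) := fun j t ht => by
      rcases ht.2.eq_or_lt with h | h
      · have h1 : toIcoDiv hT 0 t = j + 1 := hdiv (j + 1) t h.ge (by
          rw [h, add_smul (j + 1), one_smul]; linarith)
        have h2 : (j + 1) • T - j • T = T := by rw [add_smul, one_smul, add_sub_cancel_left]
        simp only [hy]
        rw [h1, h, sub_self, h2, hσ, zpow_add, zpow_one, (Commute.refl σ).zpow_left j |>.eq]
        rfl
      · simp only [hy, hdiv j t ht.1 h]
    have hfin : LocallyFinite fun j : ℤ => Set.Icc (j • T) ((j + 1) • T) := fun t => by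
      refine ⟨Metric.ball t 1, Metric.ball_mem_nhds t one_pos,
        (Set.finite_Icc ⌊(t - 1) / T - 1⌋ ⌈(t + 1) / T⌉).subset ?_⟩
      rintro j ⟨u, ⟨hu1, hu2⟩, hu3⟩
      rw [Metric.mem_ball, Real.dist_eq, abs_lt] at hu3
      simp only [zsmul_eq_mul, Int.cast_add, Int.cast_one] at hu1 hu2
      constructor
      · have : (t - 1) / T - 1 ≤ (j : ℝ) := by
          rw [sub_le_iff_le_add, div_le_iff₀ hT]
          linarith
        exact_mod_cast (Int.floor_le _).trans this
      · have : (j : ℝ) ≤ (t + 1) / T := by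
          rw [le_div_iff₀ hT]
          linarith
        exact_mod_cast this.trans (Int.le_ceil _)
    refine hfin.continuous (Set.eq_univ_of_forall fun t => Set.mem_iUnion.2
      ⟨toIcoDiv hT 0 t, ?_⟩) (fun j => isClosed_Icc) fun j => ContinuousOn.congr ?_ (hEq j)
    · have := hIco t
      rw [Set.mem_Ico] at this
      rw [Set.mem_Icc, add_smul, one_smul]
      constructor <;> linarith
    · refine continuousOn_pi.2 fun k => ?_
      have h2 := continuousOn_pi.1 hx ((σ ^ j) k)
      refine h2.comp (f := fun t : ℝ => t - j • T) (by fun_prop) fun t ht => ?_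
      exact sub_nonneg.2 ht.1
  · simp only [hy, toIcoDiv_add_right, add_smul, one_smul, add_sub_add_right_eq_sub, zpow_add,
      zpow_one, Function.comp, Equiv.Perm.mul_apply]
  · obtain ⟨π, hπ⟩ := hxR _ (hIco t).1
    refine ⟨π * σ ^ toIcoDiv hT 0 t, ?_⟩
    simp only [hy, hπ, hper.sub_zsmul_eq]
    rfl

end ContinuousSelection

/-! ### Zeros of perturbations in a disk. -/

section RootsInDisk

theorem exists_center_factorization {V : Set ℂ} (hV : IsOpen V) {D : ℂ → ℂ}
    (hD : DifferentiableOn ℂ D V) {w : ℂ} (hw : w ∈ V) (htop : analyticOrderAt D w ≠ ⊤) :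
    ∃ g : ℂ → ℂ, DifferentiableOn ℂ g V ∧ g w ≠ 0 ∧
      ∀ z, D z = (∏ _k : Fin (analyticOrderNatAt D w), (z - w)) * g z := by
  obtain ⟨k, g, hg, hgw, hDg⟩ := exists_factor_zero hV hD hw htop
  have h1 : ∀ z, D z = (∏ _j : Fin k, (z - w)) * g z := fun z => by simp [hDg]
  have h2 : analyticOrderNatAt D w = k := by
    have := analyticOrderAt_prod_sub_mul hV hg h1 hw hgw
    simp only [Finset.filter_true, Finset.card_univ, Fintype.card_fin] at this
    rw [analyticOrderNatAt, this, ENat.toNat_natCast]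
  rw [h2]
  exact ⟨g, hg, hgw, h1⟩

theorem exists_separating_radius (Z : Finset ℂ) {U : Set ℂ} (hU : IsOpen U) (hZ : ↑Z ⊆ U) {ε : ℝ}
    (hε : 0 < ε) : ∃ r : ℝ, 0 < r ∧ r < ε ∧ (∀ w ∈ Z, Metric.closedBall w r ⊆ U) ∧
      ∀ w ∈ Z, ∀ w' ∈ Z, w ≠ w' → 2 * r < dist w w' := by
  have h1 : ∀ᶠ r in nhds (0 : ℝ), ∀ w ∈ Z, Metric.closedBall w r ⊆ U :=
    (Finset.eventually_all Z).2 fun w hw => eventually_closedBall_subset (hU.mem_nhds (hZ hw))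
  have h2 : ∀ᶠ r in nhds (0 : ℝ), ∀ w ∈ Z, ∀ w' ∈ Z, w ≠ w' → 2 * r < dist w w' := by
    refine (Finset.eventually_all Z).2 fun w _ => (Finset.eventually_all Z).2 fun w' _ => ?_
    by_cases h : w = w'
    · exact Filter.Eventually.of_forall fun r hr => absurd h hr
    · have hd := dist_pos.2 h
      have : ∀ᶠ r in nhds (0 : ℝ), r < dist w w' / 2 := gt_mem_nhds (half_pos hd)
      filter_upwards [this] with r hr _
      linarith
  have h3 : ∀ᶠ r in nhdsWithin (0 : ℝ) (Set.Ioi 0), 0 < r := self_mem_nhdsWithin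
  have h4 : ∀ᶠ r in nhds (0 : ℝ), r < ε := gt_mem_nhds hε
  obtain ⟨r, hr⟩ := (h3.and ((h4.and (h1.and h2)).filter_mono nhdsWithin_le_nhds)).exists
  exact ⟨r, hr.1, hr.2.1, hr.2.2.1, hr.2.2.2⟩

open scoped Classical in
/-- Tuples with equally many members in disjoint sets around the values of the first are matched by
a permutation. -/
theorem exists_perm_of_card_eq {α : Type*} {m : ℕ} {a b : Fin m → α} {B : α → Set α}
    (hB : ∀ i j, a i ≠ a j → Disjoint (B (a i)) (B (a j)))
    (hcard : ∀ i, (Finset.univ.filter fun k => a k = a i).card =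
      (Finset.univ.filter fun k => b k ∈ B (a i)).card) :
    ∃ π : Equiv.Perm (Fin m), ∀ k, b (π k) ∈ B (a k) := by
  -- For each value the indices are matched separately; disjointness of the sets makes the glued map
  -- injective, hence a permutation.
  have hg : ∀ c : Set.range a, ∃ g : Fin m → Fin m, Set.InjOn g {k | a k = c} ∧
      ∀ k, a k = c → b (g k) ∈ B c := by
    rintro ⟨c, i, rfl⟩
    let e := Finset.equivOfCardEq (hcard i)
    refine ⟨fun k => if hk : a k = a i then (e ⟨k, by simp [hk]⟩ : Fin m) else k, ?_, ?_⟩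
    · intro k hk l hl hkl
      simp only [Set.mem_ofPred_eq] at hk hl
      simp only [dif_pos hk, dif_pos hl] at hkl
      simpa using e.injective (Subtype.ext hkl)
    · intro k hk
      simp only [dif_pos hk]
      exact (Finset.mem_filter.1 (e ⟨k, by simp [hk]⟩).2).2
  choose g hgi hgm using hg
  let f : Fin m → Fin m := fun k => g ⟨a k, k, rfl⟩ k
  have hfm : ∀ k, b (f k) ∈ B (a k) := fun k => hgm ⟨a k, k, rfl⟩ k rfl
  have hf : Function.Injective f := fun k l hkl => by
    have hkl' : a k = a l := by
      by_contra h
      have h1 := hfm k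
      rw [hkl] at h1
      exact Set.disjoint_left.1 (hB k l h) h1 (hfm l)
    refine hgi ⟨a k, k, rfl⟩ rfl hkl'.symm ?_
    have : (⟨a l, l, rfl⟩ : Set.range a) = ⟨a k, k, rfl⟩ := Subtype.ext hkl'.symm
    change g _ k = g _ l at hkl
    rw [this] at hkl
    exact hkl
  exact ⟨Equiv.ofBijective f (Finite.injective_iff_bijective.1 hf), hfm⟩

variable {V : Set ℂ} {w : ℂ} {r : ℝ} {m : ℕ}

/-- `ρ` lists the zeros of `f` in the disk with multiplicity. -/
def IsRootList (V : Set ℂ) (w : ℂ) (r : ℝ) (f : ℂ → ℂ) (ρ : Fin m → ℂ) : Prop :=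
  (∀ k, ρ k ∈ Metric.ball w r) ∧ ∃ h : ℂ → ℂ, DifferentiableOn ℂ h V ∧
    (∀ z ∈ Metric.closedBall w r, h z ≠ 0) ∧ ∀ z, f z = (∏ k, (z - ρ k)) * h z

theorem IsRootList.comp {f : ℂ → ℂ} {ρ : Fin m → ℂ} (h : IsRootList V w r f ρ)
    (π : Equiv.Perm (Fin m)) : IsRootList V w r f (ρ ∘ π) := by
  obtain ⟨h1, g, h2, h3, h4⟩ := h
  refine ⟨fun k => h1 _, g, h2, h3, fun z => ?_⟩
  rw [h4, ← Equiv.prod_comp π]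
  rfl

theorem IsRootList.eq_zero_iff {f : ℂ → ℂ} {ρ : Fin m → ℂ} (h : IsRootList V w r f ρ) {z : ℂ}
    (hz : z ∈ Metric.closedBall w r) : f z = 0 ↔ ∃ k, ρ k = z := by
  obtain ⟨-, g, -, h3, h4⟩ := h
  rw [h4, mul_eq_zero, or_iff_left (h3 z hz), Finset.prod_eq_zero_iff]
  simp [sub_eq_zero, eq_comm]

theorem IsRootList.analyticOrderAt_eq {f : ℂ → ℂ} {ρ : Fin m → ℂ} (h : IsRootList V w r f ρ)
    (hV : IsOpen V) (hS : Metric.closedBall w r ⊆ V) {z : ℂ} (hz : z ∈ Metric.closedBall w r) :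
    analyticOrderAt f z = {k | ρ k = z}.encard := by
  obtain ⟨-, g, h2, h3, h4⟩ := h
  rw [analyticOrderAt_prod_sub_mul hV h2 h4 (hS hz) (h3 z hz), ← Set.encard_coe_eq_coe_finsetCard]
  simp

open scoped Classical in
theorem IsRootList.circleIntegral_logDeriv {f : ℂ → ℂ} {ρ : Fin m → ℂ}
    (h : IsRootList V w r f ρ) (hV : IsOpen V) (hS : Metric.closedBall w r ⊆ V) {ζ : ℂ} {s : ℝ}
    (hs : 0 < s) (hsr : Metric.closedBall ζ s ⊆ Metric.closedBall w r)
    (hne : ∀ z ∈ Metric.sphere ζ s, f z ≠ 0) :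
    (∮ z in C(ζ, s), logDeriv f z) =
      2 * Real.pi * Complex.I * (Finset.univ.filter fun k => ρ k ∈ Metric.ball ζ s).card := by
  have h0 := fun z hz => (h.eq_zero_iff (z := z) hz).2
  obtain ⟨-, g, h2, h3, h4⟩ := h
  exact circleIntegral_logDeriv_of_factorization hV h2 h4 hs (hsr.trans hS)
    (fun z hz => h3 z (hsr hz)) fun k hk => hne _ hk
      (h0 _ (hsr (Metric.sphere_subset_closedBall hk)) ⟨k, rfl⟩)

theorem two_pi_I_mul_natCast_injective {a b : ℕ}
    (h : 2 * Real.pi * Complex.I * (a : ℂ) = 2 * Real.pi * Complex.I * b) : a = b := by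
  exact_mod_cast mul_left_cancel₀ Complex.two_pi_I_ne_zero h

/-- Hurwitz: a function close to `D` on a circle has as many zeros in the disk. -/
theorem exists_isRootList (hV : IsOpen V) (hr : 0 < r) (hS : Metric.closedBall w r ⊆ V)
    {D F : ℂ → ℂ} (hD : DifferentiableOn ℂ D V) (htop : analyticOrderAt D w ≠ ⊤)
    (hD0 : ∀ z ∈ Metric.closedBall w r, z ≠ w → D z ≠ 0) (hF : DifferentiableOn ℂ F V)
    (hFD : ∀ z ∈ Metric.sphere w r, ‖F z - D z‖ < ‖D z‖) :
    ∃ ρ : Fin (analyticOrderNatAt D w) → ℂ, IsRootList V w r F ρ := by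
  classical
  have hwS := Metric.mem_closedBall_self (x := w) hr.le
  obtain ⟨g, hg, hgw, hDg⟩ := exists_center_factorization hV hD (hS hwS) htop
  have hDroot : IsRootList V w r D fun _ : Fin (analyticOrderNatAt D w) => w := by
    refine ⟨fun _ => Metric.mem_ball_self hr, g, hg, fun z hz hz0 => ?_, hDg⟩
    by_cases h : z = w
    · exact hgw (h ▸ hz0)
    · exact hD0 z hz h (by rw [hDg, hz0, mul_zero])
  have hne : ∀ z ∈ Metric.sphere w r, D z ≠ 0 := fun z hz =>
    hD0 z (Metric.sphere_subset_closedBall hz) (Metric.ne_of_mem_sphere hz hr.ne')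
  have hFne : ∀ z ∈ Metric.sphere w r, F z ≠ 0 := fun z hz h0 => by
    have := hFD z hz
    rw [h0, zero_sub, norm_neg] at this
    exact lt_irrefl _ this
  obtain ⟨m, ρ, h, hh, hρ, hh0, hFρ⟩ := exists_disk_factorization hV hr hS hF hFne
  have hFroot : IsRootList V w r F ρ := ⟨hρ, h, hh, hh0, hFρ⟩
  have h1 := circleIntegral_logDeriv_eq hV hF hD hr (Metric.sphere_subset_closedBall.trans hS) hFD
  rw [hFroot.circleIntegral_logDeriv hV hS hr le_rfl hFne,
    hDroot.circleIntegral_logDeriv hV hS hr le_rfl hne] at h1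
  have h2 := two_pi_I_mul_natCast_injective h1
  rw [Finset.filter_true_of_mem fun k _ => hρ k,
    Finset.filter_true_of_mem fun k _ => Metric.mem_ball_self hr, Finset.card_fin,
    Finset.card_fin] at h2
  subst h2
  exact ⟨ρ, hFroot⟩

/-- The zeros in a disk depend continuously on a parameter. -/
theorem eventually_exists_perm (hV : IsOpen V) (hS : Metric.closedBall w r ⊆ V) {F : ℝ → ℂ → ℂ}
    (hF : ∀ t, DifferentiableOn ℂ (F t) V)
    (hFc : ContinuousOn (Function.uncurry F) (Set.univ ×ˢ V)) {R : ℝ → Fin m → ℂ}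
    (hR : ∀ t, IsRootList V w r (F t) (R t)) (s : ℝ) {ε : ℝ} (hε : 0 < ε) :
    ∀ᶠ t in nhds s, ∃ π : Equiv.Perm (Fin m), ∀ k, dist (R t (π k)) (R s k) < ε := by
  classical
  obtain ⟨q, hq, hqε, hqS, hqd⟩ := exists_separating_radius (Finset.univ.image (R s))
    (Metric.isOpen_ball (x := w) (ε := r)) (by
      intro z hz
      simp only [Finset.coe_image, Finset.coe_univ, Set.image_univ, Set.mem_range] at hz
      obtain ⟨k, rfl⟩ := hz
      exact (hR s).1 k) hε
  have hmem : ∀ k, R s k ∈ Finset.univ.image (R s) := fun k =>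
    Finset.mem_image_of_mem _ (Finset.mem_univ _)
  have hqS' : ∀ k, Metric.closedBall (R s k) q ⊆ Metric.closedBall w r := fun k =>
    (hqS _ (hmem k)).trans Metric.ball_subset_closedBall
  have hne : ∀ k, ∀ z ∈ Metric.sphere (R s k) q, F s z ≠ 0 := fun k z hz h0 => by
    obtain ⟨l, hl⟩ := ((hR s).eq_zero_iff (hqS' k (Metric.sphere_subset_closedBall hz))).1 h0
    rw [Metric.mem_sphere, ← hl] at hz
    by_cases h : R s l = R s k
    · rw [h, dist_self] at hz
      exact hq.ne hz
    · have := hqd _ (hmem l) _ (hmem k) h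
      linarith
  have hclose : ∀ᶠ t in nhds s, ∀ k, ∀ z ∈ Metric.sphere (R s k) q,
      ‖F t z - F s z‖ < ‖F s z‖ := by
    refine Filter.eventually_all.2 fun k => ?_
    refine (isCompact_sphere (R s k) q).eventually_forall_of_forall_eventually fun z hz => ?_
    have hzV : z ∈ V := hS (hqS' k (Metric.sphere_subset_closedBall hz))
    have hc : ContinuousAt (Function.uncurry F) (s, z) :=
      hFc.continuousAt ((isOpen_univ.prod hV).mem_nhds ⟨Set.mem_univ _, hzV⟩)
    have hc2 : ContinuousAt (fun p : ℝ × ℂ => F s p.2) (s, z) :=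
      ContinuousAt.comp (f := Prod.snd) (g := F s)
        ((hF s).differentiableAt (hV.mem_nhds hzV)).continuousAt continuousAt_snd
    have hc3 : ContinuousAt (fun p : ℝ × ℂ => ‖F s p.2‖ - ‖F p.1 p.2 - F s p.2‖) (s, z) :=
      hc2.norm.sub (ContinuousAt.sub hc hc2).norm
    have h4 := hc3.eventually (lt_mem_nhds (show (0 : ℝ) < _ by
      simpa using norm_pos_iff.2 (hne k z hz)))
    filter_upwards [h4] with p hp
    exact sub_pos.1 hp
  filter_upwards [hclose] with t ht
  have hnet : ∀ k, ∀ z ∈ Metric.sphere (R s k) q, F t z ≠ 0 := fun k z hz h0 => by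
    have := ht k z hz
    rw [h0, zero_sub, norm_neg] at this
    exact lt_irrefl _ this
  -- Rouché on the small circles shows that `F t` has in each small disk as many zeros as `F s` has
  -- at its center.
  obtain ⟨π, hπ⟩ := exists_perm_of_card_eq (a := R s) (b := R t) (B := fun c => Metric.ball c q)
    (fun i j hij => Metric.ball_disjoint_ball (by
      have := hqd _ (hmem i) _ (hmem j) hij
      linarith)) fun i => by
      have h1 := circleIntegral_logDeriv_eq hV (hF t) (hF s) hq
        (Metric.sphere_subset_closedBall.trans ((hqS' i).trans hS)) (ht i)
      rw [(hR t).circleIntegral_logDeriv hV hS hq (hqS' i) (hnet i),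
        (hR s).circleIntegral_logDeriv hV hS hq (hqS' i) (hne i)] at h1
      refine Eq.trans ?_ (two_pi_I_mul_natCast_injective h1).symm
      congr 1
      ext k
      simp only [Finset.mem_filter, Finset.mem_univ, true_and, Metric.mem_ball]
      constructor
      · intro h
        rw [h, dist_self]
        exact hq
      · intro h
        by_contra hki
        have := hqd _ (hmem k) _ (hmem i) hki
        linarith
  exact ⟨π, fun k => (Metric.mem_ball.1 (hπ k)).trans hqε⟩

/-- The zeros that a periodic family of perturbations has near a zero of `D` form loops. -/
theorem exists_root_loops (hV : IsOpen V) (hr : 0 < r) (hS : Metric.closedBall w r ⊆ V)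
    {D : ℂ → ℂ} (hD : DifferentiableOn ℂ D V) (htop : analyticOrderAt D w ≠ ⊤)
    (hD0 : ∀ z ∈ Metric.closedBall w r, z ≠ w → D z ≠ 0) {F : ℝ → ℂ → ℂ} {T : ℝ} (hT : 0 < T)
    (hper : Function.Periodic F T) (hF : ∀ t, DifferentiableOn ℂ (F t) V)
    (hFc : ContinuousOn (Function.uncurry F) (Set.univ ×ˢ V))
    (hFD : ∀ t, ∀ z ∈ Metric.sphere w r, ‖F t z - D z‖ < ‖D z‖) :
    ∃ (x : ℝ → Fin (analyticOrderNatAt D w) → ℂ)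
      (σ : Equiv.Perm (Fin (analyticOrderNatAt D w))), Continuous x ∧
      (∀ t k, x (t + T) k = x t (σ k)) ∧ ∀ t, IsRootList V w r (F t) (x t) := by
  -- The list of zeros is chosen as a function of `f` and not of `t`, so that it inherits the exact
  -- periodicity of `F`.
  have hpick : ∀ f : ℂ → ℂ, ∃ ρ : Fin (analyticOrderNatAt D w) → ℂ,
      DifferentiableOn ℂ f V → (∀ z ∈ Metric.sphere w r, ‖f z - D z‖ < ‖D z‖) →
      IsRootList V w r f ρ := fun f => by
    by_cases h : DifferentiableOn ℂ f V ∧ ∀ z ∈ Metric.sphere w r, ‖f z - D z‖ < ‖D z‖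
    · obtain ⟨ρ, hρ⟩ := exists_isRootList hV hr hS hD htop hD0 h.1 h.2
      exact ⟨ρ, fun _ _ => hρ⟩
    · exact ⟨0, fun h1 h2 => absurd ⟨h1, h2⟩ h⟩
  choose pick hpick using hpick
  have hR : ∀ t, IsRootList V w r (F t) (pick (F t)) := fun t => hpick _ (hF t) (hFD t)
  obtain ⟨x, σ, hx, hσ, hπ⟩ := exists_continuous_selection_of_periodic (R := fun t => pick (F t))
    hT (fun t => by simp only [hper t]) fun s ε hε => eventually_exists_perm hV hS hF hFc hR s hε
  refine ⟨x, σ, hx, hσ, fun t => ?_⟩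
  obtain ⟨π, h⟩ := hπ t
  rw [h]
  exact (hR t).comp π

/-- In `D z = (z - w)^m g z` the cofactor is bounded below on the disk, so `|z - w|^m` is controlled
by `|D z|`. -/
theorem exists_norm_sub_le_rpow (hV : IsOpen V) (hr : 0 < r) (hS : Metric.closedBall w r ⊆ V)
    {D : ℂ → ℂ} (hD : DifferentiableOn ℂ D V) (htop : analyticOrderAt D w ≠ ⊤)
    (hD0 : ∀ z ∈ Metric.closedBall w r, z ≠ w → D z ≠ 0) (hm : 0 < analyticOrderNatAt D w) :
    ∃ C : ℝ, 0 ≤ C ∧ ∀ z ∈ Metric.closedBall w r,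
      ‖z - w‖ ≤ C * ‖D z‖ ^ (1 / (analyticOrderNatAt D w : ℝ)) := by
  obtain ⟨g, hg, hgw, hDg⟩ := exists_center_factorization hV hD
    (hS (Metric.mem_closedBall_self hr.le)) htop
  set m := analyticOrderNatAt D w
  obtain ⟨c, hc, hcg⟩ := (isCompact_closedBall w r).exists_forall_le' (f := fun z => ‖g z‖) (a := 0)
    (hg.continuousOn.mono hS).norm fun z hz => by
      rw [norm_pos_iff]
      intro hz0
      by_cases h : z = w
      · exact hgw (h ▸ hz0)
      · exact hD0 z hz h (by rw [hDg, hz0, mul_zero])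
  refine ⟨(1 / c) ^ (1 / (m : ℝ)), by positivity, fun z hz => ?_⟩
  rw [← Real.mul_rpow (by positivity) (norm_nonneg _)]
  have h1 : ‖z - w‖ ^ m ≤ 1 / c * ‖D z‖ := by
    have : ‖D z‖ = ‖z - w‖ ^ m * ‖g z‖ := by
      rw [hDg, norm_mul, Finset.prod_const, Finset.card_fin, norm_pow]
    rw [this, one_div, inv_mul_eq_div, le_div_iff₀ hc]
    exact mul_le_mul_of_nonneg_left (hcg z hz) (by positivity)
  calc ‖z - w‖ = (‖z - w‖ ^ m) ^ (1 / (m : ℝ)) := by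
        rw [one_div, Real.pow_rpow_inv_natCast (norm_nonneg _) hm.ne']
    _ ≤ _ := Real.rpow_le_rpow (by positivity) h1 (by positivity)

end RootsInDisk

/-! ### Loops of zeros in a compact set. -/

section RootLoops

variable {K : Set ℂ} {D : ℂ → ℂ}

theorem mem_interior_of_eq_zero (hK : IsCompact K) (hbd : ∀ z ∈ frontier K, D z ≠ 0) {z : ℂ}
    (hz : z ∈ K) (h0 : D z = 0) : z ∈ interior K := by
  by_contra h
  exact hbd z (hK.isClosed.frontier_eq ▸ ⟨hz, h⟩) h0

/-- The interior points near which `D` vanishes identically form an open set. It is also closed in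
the plane: at a limit point `D` vanishes by continuity, so that point is interior, and the identity
theorem applies. Were it nonempty, `K` would be the whole plane. Connectedness of `K` is not needed.
-/
theorem analyticOrderAt_ne_top_of_frontier (hK : IsCompact K) (hDc : ContinuousOn D K)
    (hDd : DifferentiableOn ℂ D (interior K)) (hbd : ∀ z ∈ frontier K, D z ≠ 0) {z : ℂ}
    (hz : z ∈ interior K) : analyticOrderAt D z ≠ ⊤ := by
  intro htop
  set S : Set ℂ := {y | y ∈ interior K ∧ ∀ᶠ x in nhds y, D x = 0} with hS
  have hopen : IsOpen S := by
    refine isOpen_iff_mem_nhds.2 fun y hy => ?_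
    filter_upwards [isOpen_interior.mem_nhds hy.1, eventually_eventually_nhds.2 hy.2] with x h1 h2
    exact ⟨h1, h2⟩
  have hSK : S ⊆ K := fun y hy => interior_subset hy.1
  have hclosed : IsClosed S := by
    refine isClosed_iff_frequently.2 fun y hy => ?_
    have hyK : y ∈ K := hK.isClosed.closure_subset_iff.2 hSK (mem_closure_iff_frequently.2 hy)
    have hSZ : S ⊆ K ∩ D ⁻¹' {0} := fun x hx => ⟨hSK hx, hx.2.self_of_nhds⟩
    have hZc : IsClosed (K ∩ D ⁻¹' {0}) :=
      hDc.preimage_isClosed_of_isClosed hK.isClosed isClosed_singleton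
    have hy0 : D y = 0 := (hZc.closure_subset_iff.2 hSZ (mem_closure_iff_frequently.2 hy)).2
    have hyi := mem_interior_of_eq_zero hK hbd hyK hy0
    refine ⟨hyi, ?_⟩
    by_cases hyS : y ∈ S
    · exact hyS.2
    · refine ((hDd.analyticAt (isOpen_interior.mem_nhds hyi)).frequently_zero_iff_eventually_zero).1 ?_
      rw [frequently_nhdsWithin_iff]
      refine hy.mono fun x hx => ⟨hx.2.self_of_nhds, ?_⟩
      rintro rfl
      exact hyS hx
  have huniv : S = Set.univ := IsClopen.eq_univ ⟨hclosed, hopen⟩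
    ⟨z, hz, analyticOrderAt_eq_top.1 htop⟩
  have : K = Set.univ := Set.eq_univ_of_univ_subset (huniv ▸ hSK)
  exact noncompact_univ ℂ (this ▸ hK)

theorem finite_zeros_of_frontier (hK : IsCompact K) (hDc : ContinuousOn D K)
    (hDd : DifferentiableOn ℂ D (interior K)) (hbd : ∀ z ∈ frontier K, D z ≠ 0) :
    {z ∈ K | D z = 0}.Finite := by
  have hZc : IsClosed (K ∩ D ⁻¹' {0}) :=
    hDc.preimage_isClosed_of_isClosed hK.isClosed isClosed_singleton
  have hsub : K ∩ D ⁻¹' {0} ⊆ interior K := fun z hz => mem_interior_of_eq_zero hK hbd hz.1 hz.2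
  refine (finite_zeros_of_order_ne_top isOpen_interior hsub
    (hK.of_isClosed_subset hZc Set.inter_subset_left) hDd fun z hz =>
      analyticOrderAt_ne_top_of_frontier hK hDc hDd hbd (hsub hz)).subset fun z hz => ⟨hz, hz.2⟩

theorem analyticOrderNatAt_pos_of_frontier (hK : IsCompact K) (hDc : ContinuousOn D K)
    (hDd : DifferentiableOn ℂ D (interior K)) (hbd : ∀ z ∈ frontier K, D z ≠ 0) {z : ℂ}
    (hz : z ∈ K) (h0 : D z = 0) : 0 < analyticOrderNatAt D z := by
  have hzi := mem_interior_of_eq_zero hK hbd hz h0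
  have h1 := analyticOrderAt_ne_top_of_frontier hK hDc hDd hbd hzi
  have h2 : analyticOrderAt D z ≠ 0 :=
    (hDd.analyticAt (isOpen_interior.mem_nhds hzi)).analyticOrderAt_ne_zero.2 h0
  rw [Nat.pos_iff_ne_zero, analyticOrderNatAt, Ne, ENat.toNat_eq_zero, not_or]
  exact ⟨h2, h1⟩

/-- The zeros in a compact set `K` of small periodic perturbations of `D` form loops around the
zeros of `D`. -/
theorem exists_root_loops_of_frontier (hK : IsCompact K) (hDc : ContinuousOn D K)
    (hDd : DifferentiableOn ℂ D (interior K)) (hbd : ∀ z ∈ frontier K, D z ≠ 0) :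
    ∃ C δ₀ : ℝ, 0 < C ∧ 0 < δ₀ ∧ ∀ (δ T : ℝ) (F : ℝ → ℂ → ℂ), δ ≤ δ₀ → 0 < T →
      Function.Periodic F T → (∀ t, DifferentiableOn ℂ (F t) (interior K)) →
      ContinuousOn (Function.uncurry F) (Set.univ ×ˢ interior K) →
      (∀ t, ∀ z ∈ K, ‖F t z - D z‖ ≤ δ) →
      ∃ (loop : (w : ℂ) → Fin (analyticOrderNatAt D w) → ℝ → ℂ)
        (σ : (w : ℂ) → Equiv.Perm (Fin (analyticOrderNatAt D w))),
        (∀ w ∈ K, D w = 0 → ∀ k, Continuous (loop w k) ∧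
          (∀ t, loop w k (t + T) = loop w (σ w k) t) ∧
          ∀ t, loop w k t ∈ interior K ∧
            ‖loop w k t - w‖ ≤ C * δ ^ (1 / (analyticOrderNatAt D w : ℝ))) ∧
        (∀ t, ∀ z ∈ K, F t z = 0 ↔ ∃ w ∈ K, D w = 0 ∧ ∃ k, loop w k t = z) ∧
        ∀ t, ∀ z ∈ interior K, analyticOrderAt (F t) z =
          {p : Σ w : ℂ, Fin (analyticOrderNatAt D w) |
            (p.1 ∈ K ∧ D p.1 = 0) ∧ loop p.1 p.2 t = z}.encard := by
  classical
  have hfin := finite_zeros_of_frontier hK hDc hDd hbd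
  set Z := hfin.toFinset with hZdef
  have hZ : ∀ w, w ∈ Z ↔ w ∈ K ∧ D w = 0 := fun w => by simp [hZdef]
  have hZi : ∀ w ∈ Z, w ∈ interior K := fun w hw =>
    mem_interior_of_eq_zero hK hbd ((hZ w).1 hw).1 ((hZ w).1 hw).2
  obtain ⟨r, hr, -, hrK, hrd⟩ := exists_separating_radius Z isOpen_interior hZi one_pos
  have htop : ∀ w ∈ Z, analyticOrderAt D w ≠ ⊤ := fun w hw =>
    analyticOrderAt_ne_top_of_frontier hK hDc hDd hbd (hZi w hw)
  have hD0 : ∀ w ∈ Z, ∀ z ∈ Metric.closedBall w r, z ≠ w → D z ≠ 0 := fun w hw z hz hzw h0 => by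
    have h1 := hrd z ((hZ z).2 ⟨interior_subset (hrK w hw hz), h0⟩) w hw hzw
    have h2 := Metric.mem_closedBall.1 hz
    linarith
  have hdisj : ∀ w ∈ Z, ∀ w' ∈ Z, ∀ z ∈ Metric.closedBall w r, z ∈ Metric.ball w' r → w = w' :=
    fun w hw w' hw' z hz hz' => by
      by_contra h
      have h1 := hrd w hw w' hw' h
      have h2 := dist_triangle_left w w' z
      have h3 := Metric.mem_closedBall.1 hz
      have h4 := Metric.mem_ball.1 hz'
      linarith
  have hCw : ∀ w, ∃ C : ℝ, 0 ≤ C ∧ (w ∈ Z → ∀ z ∈ Metric.closedBall w r,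
      ‖z - w‖ ≤ C * ‖D z‖ ^ (1 / (analyticOrderNatAt D w : ℝ))) := fun w => by
    by_cases hw : w ∈ Z
    · obtain ⟨C, hC, h⟩ := exists_norm_sub_le_rpow isOpen_interior hr (hrK w hw) hDd (htop w hw)
        (hD0 w hw) (analyticOrderNatAt_pos_of_frontier hK hDc hDd hbd ((hZ w).1 hw).1
          ((hZ w).1 hw).2)
      exact ⟨C, hC, fun _ => h⟩
    · exact ⟨0, le_rfl, fun h => absurd h hw⟩
  choose Cw hCw0 hCw using hCw
  -- Away from the disks `|D|` has a positive lower bound `c`. Perturbations of size at most `c / 2`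
  -- have no zeros there and satisfy Rouché's inequality on the circles.
  have hK' : IsCompact (K \ ⋃ w ∈ Z, Metric.ball w r) :=
    hK.diff (isOpen_biUnion fun w _ => Metric.isOpen_ball)
  obtain ⟨c, hc, hcD⟩ := hK'.exists_forall_le' (f := fun z => ‖D z‖) (a := 0)
    (hDc.mono Set.sdiff_subset).norm fun z hz => norm_pos_iff.2 fun h0 =>
      hz.2 (Set.mem_biUnion ((hZ z).2 ⟨hz.1, h0⟩) (Metric.mem_ball_self hr))
  refine ⟨1 + ∑ w ∈ Z, Cw w, c / 2, by
    have := Finset.sum_nonneg fun w (_ : w ∈ Z) => hCw0 w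
    linarith, half_pos hc, fun δ T F hδ hT hper hF hFc hFD => ?_⟩
  have hFDs : ∀ w ∈ Z, ∀ t, ∀ z ∈ Metric.sphere w r, ‖F t z - D z‖ < ‖D z‖ :=
    fun w hw t z hz => by
      have hzc := Metric.sphere_subset_closedBall hz
      have hzK : z ∈ K := interior_subset (hrK w hw hzc)
      have h1 := hcD z ⟨hzK, fun hmem => by
        obtain ⟨w', hw', hzw'⟩ := Set.mem_iUnion₂.1 hmem
        have := hdisj w hw w' hw' z hzc hzw'
        subst this
        rw [Metric.mem_ball, Metric.mem_sphere.1 hz] at hzw'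
        exact lt_irrefl _ hzw'⟩
      have h2 := hFD t z hzK
      linarith
  -- Off the zero set a default is supplied, since the loops are functions of every complex number
  -- `w`.
  have hloops : ∀ w, ∃ (x : ℝ → Fin (analyticOrderNatAt D w) → ℂ)
      (σ : Equiv.Perm (Fin (analyticOrderNatAt D w))), w ∈ Z → Continuous x ∧
      (∀ t k, x (t + T) k = x t (σ k)) ∧ ∀ t, IsRootList (interior K) w r (F t) (x t) :=
    fun w => by
      by_cases hw : w ∈ Z
      · obtain ⟨x, σ, h⟩ := exists_root_loops isOpen_interior hr (hrK w hw) hDd (htop w hw)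
          (hD0 w hw) hT hper hF hFc (hFDs w hw)
        exact ⟨x, σ, fun _ => h⟩
      · exact ⟨0, 1, fun h => absurd h hw⟩
  choose x σ hx using hloops
  have hmem : ∀ w ∈ Z, ∀ t k, x w t k ∈ Metric.ball w r := fun w hw t k => ((hx w hw).2.2 t).1 k
  have hroot : ∀ w ∈ Z, ∀ t k, F t (x w t k) = 0 := fun w hw t k =>
    (((hx w hw).2.2 t).eq_zero_iff (Metric.ball_subset_closedBall (hmem w hw t k))).2 ⟨k, rfl⟩
  have hin : ∀ t, ∀ z ∈ K, F t z = 0 → ∃ w ∈ Z, z ∈ Metric.ball w r := fun t z hz h0 => by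
    by_contra! hno
    have h1 := hcD z ⟨hz, fun hmem => by
      obtain ⟨w', hw', hzw'⟩ := Set.mem_iUnion₂.1 hmem
      exact hno w' hw' hzw'⟩
    have h2 := hFD t z hz
    rw [h0, zero_sub, norm_neg] at h2
    linarith
  refine ⟨fun w k t => x w t k, σ, fun w hwK hw0 k => ?_, fun t z hz => ?_, fun t z hz => ?_⟩
  · have hw := (hZ w).2 ⟨hwK, hw0⟩
    refine ⟨continuous_pi_iff.1 (hx w hw).1 k, fun t => (hx w hw).2.1 t k, fun t => ?_⟩
    have hb := Metric.ball_subset_closedBall (hmem w hw t k)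
    refine ⟨hrK w hw hb, (hCw w hw _ hb).trans ?_⟩
    have h1 := hFD t _ (interior_subset (hrK w hw hb))
    rw [hroot w hw, zero_sub, norm_neg] at h1
    have h2 : Cw w ≤ 1 + ∑ w ∈ Z, Cw w := by
      have := Finset.single_le_sum (f := Cw) (fun w _ => hCw0 w) hw
      linarith
    have h3 := (norm_nonneg _).trans h1
    have h4 := hCw0 w
    have h5 := h4.trans h2
    gcongr
  · constructor
    · intro h0
      obtain ⟨w, hw, hzw⟩ := hin t z hz h0
      exact ⟨w, ((hZ w).1 hw).1, ((hZ w).1 hw).2,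
        (((hx w hw).2.2 t).eq_zero_iff (Metric.ball_subset_closedBall hzw)).1 h0⟩
    · rintro ⟨w, hwK, hw0, k, rfl⟩
      exact hroot w ((hZ w).2 ⟨hwK, hw0⟩) t k
  · by_cases hex : ∃ w ∈ Z, z ∈ Metric.ball w r
    · obtain ⟨w, hw, hzw⟩ := hex
      rw [((hx w hw).2.2 t).analyticOrderAt_eq isOpen_interior (hrK w hw)
        (Metric.ball_subset_closedBall hzw), ← Function.Injective.encard_image
          (sigma_mk_injective (β := fun w => Fin (analyticOrderNatAt D w)) (i := w))]
      congr 1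
      ext ⟨w', k⟩
      constructor
      · rintro ⟨l, hl, he⟩
        cases he
        exact ⟨(hZ w).1 hw, hl⟩
      · rintro ⟨h1, h2⟩
        have h3 : w' = w := hdisj w' ((hZ w').2 h1) w hw z (by
          rw [← h2]
          exact Metric.ball_subset_closedBall (hmem w' ((hZ w').2 h1) t k)) hzw
        subst h3
        exact ⟨k, h2, rfl⟩
    · have hne : F t z ≠ 0 := fun h0 => hex (hin t z (interior_subset hz) h0)
      rw [((hF t).analyticAt (isOpen_interior.mem_nhds hz)).analyticOrderAt_eq_zero.2 hne]
      symm
      rw [Set.encard_eq_zero]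
      refine Set.eq_empty_of_forall_notMem fun p hp => hne ?_
      rw [← hp.2]
      exact hroot _ ((hZ _).2 hp.1) t _

end RootLoops

/-! ### Regularity in the spectral parameter. -/

section ParameterRegularity

/-- This is used for the limit matrix, as a limit in `x`, and for the homoclinic Evans function, as
a limit of normalized periodic ones. -/
theorem regular_of_uniform_limit {E ι : Type*} [NormedAddCommGroup E] [NormedSpace ℂ E]
    [CompleteSpace E] {l : Filter ι} [l.NeBot] {f : ι → ℂ → E} {g : ℂ → E} {K : Set ℂ} {b : ι → ℝ}
    (hb : Filter.Tendsto b l (nhds 0))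
    (hf : ∀ᶠ i in l, ContinuousOn (f i) K ∧ DifferentiableOn ℂ (f i) (interior K) ∧
      ∀ z ∈ K, ‖f i z - g z‖ ≤ b i) :
    ContinuousOn g K ∧ DifferentiableOn ℂ g (interior K) := by
  have hu : TendstoUniformlyOn f g l K := by
    refine Metric.tendstoUniformlyOn_iff.2 fun ε hε => ?_
    filter_upwards [hf, hb.eventually (gt_mem_nhds hε)] with i hi hbi z hz
    rw [dist_comm, dist_eq_norm]
    exact (hi.2.2 z hz).trans_lt hbi
  exact ⟨hu.continuousOn (hf.mono fun i hi => hi.1).frequently,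
    (hu.mono interior_subset).tendstoLocallyUniformlyOn.differentiableOn
      (hf.mono fun i hi => hi.2.1) isOpen_interior⟩

variable {n : ℕ}

theorem continuous_cmat_det : Continuous fun M : CMat n => M.det :=
  (continuous_id (X := CMat n)).matrix_det

theorem differentiableOn_cmat_det {U : Set ℂ} {G : ℂ → CMat n} (hG : DifferentiableOn ℂ G U) :
    DifferentiableOn ℂ (fun z => (G z).det) U := by
  have hentry : ∀ i j, DifferentiableOn ℂ (fun z => G z i j) U := fun i j =>
    (LinearMap.toContinuousLinearMap
      (Matrix.entryLinearMap ℂ ℂ i j : CMat n →ₗ[ℂ] ℂ)).differentiable.comp_differentiableOn hG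
  simp only [Matrix.det_apply]
  refine DifferentiableOn.fun_sum fun σ _ => DifferentiableOn.const_smul ?_ _
  exact DifferentiableOn.fun_finsetProd fun i _ => hentry _ _

theorem differentiableOn_det_sub_smul {U : Set ℂ} {G : ℂ → CMat n} (hG : DifferentiableOn ℂ G U)
    (γ : ℂ) : DifferentiableOn ℂ (fun z => (G z - γ • (1 : CMat n)).det) U :=
  differentiableOn_cmat_det (hG.sub_const _)

theorem continuousOn_det_sub_exp_smul {S : Set ℂ} {G : ℂ → CMat n} (hG : ContinuousOn G S) :
    ContinuousOn (fun p : ℝ × ℂ => (G p.2 - Complex.exp (p.1 * Complex.I) • (1 : CMat n)).det)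
      (Set.univ ×ˢ S) := by
  refine continuous_cmat_det.comp_continuousOn (ContinuousOn.sub ?_ ?_)
  · exact hG.comp continuousOn_snd fun p hp => hp.2
  · have h : Continuous fun p : ℝ × ℂ => Complex.exp (p.1 * Complex.I) := by fun_prop
    exact (h.smul continuous_const).continuousOn

/-- The pairs of a point of `K` and an eigenvalue there form a compact set, being the zero set of
the characteristic determinant in a bounded region. -/
theorem exists_spectral_gap {K : Set ℂ} (hK : IsCompact K) {B : ℂ → CMat n}
    (hB : ContinuousOn B K) {η : ℝ} (hgap : ∀ z ∈ K, ∀ μ ∈ spectrum ℂ (B z), η < |μ.re|) :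
    ∃ g', η < g' ∧ ∀ z ∈ K, ∀ μ ∈ spectrum ℂ (B z), g' ≤ |μ.re| := by
  obtain ⟨L, hL⟩ := hK.exists_bound_of_continuousOn hB
  have hspec : ∀ z μ, μ ∈ spectrum ℂ (B z) ↔ (B z - μ • (1 : CMat n)).det = 0 := fun z μ => by
    rw [spectrum.mem_iff, Matrix.isUnit_iff_isUnit_det, isUnit_iff_ne_zero, not_not,
      ← neg_sub, Matrix.det_neg, Algebra.algebraMap_eq_smul_one]
    simp
  have hc : ContinuousOn (fun p : ℂ × ℂ => (B p.1 - p.2 • (1 : CMat n)).det)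
      (K ×ˢ Metric.closedBall 0 L) := by
    refine continuous_cmat_det.comp_continuousOn (ContinuousOn.sub ?_ ?_)
    · exact hB.comp continuousOn_fst fun p hp => hp.1
    · exact (continuous_snd.smul continuous_const).continuousOn
  have hcomp : IsCompact (K ×ˢ Metric.closedBall (0 : ℂ) L) := hK.prod (isCompact_closedBall _ _)
  have hS : IsCompact ((K ×ˢ Metric.closedBall (0 : ℂ) L) ∩
      (fun p : ℂ × ℂ => (B p.1 - p.2 • (1 : CMat n)).det) ⁻¹' {0}) :=
    hcomp.of_isClosed_subset (hc.preimage_isClosed_of_isClosed hcomp.isClosed isClosed_singleton)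
      Set.inter_subset_left
  obtain ⟨g', hg', h⟩ := hS.exists_forall_le' (f := fun p : ℂ × ℂ => |p.2.re|) (a := η)
    (by fun_prop) fun p hp => hgap p.1 hp.1.1 p.2 ((hspec _ _).2 hp.2)
  refine ⟨g', hg', fun z hz μ hμ => h (z, μ) ⟨⟨hz, ?_⟩, (hspec _ _).1 hμ⟩⟩
  rw [mem_closedBall_zero_iff]
  refine (spectrum.norm_le_norm_mul_of_mem hμ).trans ?_
  have h1 := norm_one_matrix_le n
  nlinarith [norm_nonneg (B z), hL z hz]

end ParameterRegularity

/-! ### The family of systems near the homoclinic limit. -/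

section Family

variable {n : ℕ} {A : ℝ → ℝ → ℂ → CMat n} {Ainf : ℂ → CMat n} {X : ℝ → ℝ} {M C ν θ : ℝ} {K : Set ℂ}

theorem IsHomoclinicLimitFamily.C_nonneg (hA : IsHomoclinicLimitFamily A Ainf X M C ν θ)
    {z : ℂ} (hz : ‖z‖ ≤ M) : 0 ≤ C := by
  have := (norm_nonneg _).trans (hA.limit_bound z hz 0)
  simpa using this

theorem IsHomoclinicLimitFamily.differentiable (hA : IsHomoclinicLimitFamily A Ainf X M C ν θ)
    {ε : ℝ} (hε : 0 ≤ ε) (x : ℝ) : Differentiable ℂ (A ε x) := fun z =>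
  (hA.analytic ε hε x z trivial).differentiableAt

theorem IsHomoclinicLimitFamily.continuous (hA : IsHomoclinicLimitFamily A Ainf X M C ν θ)
    {ε : ℝ} (hε : 0 ≤ ε) (z : ℂ) : Continuous fun x => A ε x z := (hA.contDiff ε hε z).continuous

theorem IsHomoclinicLimitFamily.limit_regular (hA : IsHomoclinicLimitFamily A Ainf X M C ν θ)
    (hKM : ∀ z ∈ K, ‖z‖ ≤ M) : ContinuousOn Ainf K ∧ DifferentiableOn ℂ Ainf (interior K) := by
  have hlim : Filter.Tendsto (fun x : ℝ => C * Real.exp (-ν * x)) Filter.atTop (nhds 0) := by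
    have : Filter.Tendsto (fun x : ℝ => Real.exp (-ν * x)) Filter.atTop (nhds 0) :=
      Real.tendsto_exp_atBot.comp
        (Filter.tendsto_id.const_mul_atTop_of_neg (neg_neg_of_pos hA.ν_pos))
    simpa using this.const_mul C
  refine regular_of_uniform_limit (f := fun x => A 0 x) hlim ?_
  filter_upwards [Filter.eventually_ge_atTop 0] with x hx
  have hd := hA.differentiable le_rfl x
  refine ⟨hd.continuous.continuousOn, hd.differentiableOn, fun z hz => ?_⟩
  have := hA.limit_bound z (hKM z hz) x
  rwa [abs_of_nonneg hx] at this

theorem IsHomoclinicLimitFamily.norm_zero_le (hA : IsHomoclinicLimitFamily A Ainf X M C ν θ)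
    {z : ℂ} (hz : ‖z‖ ≤ M) (x : ℝ) : ‖A 0 x z‖ ≤ ‖Ainf z‖ + C := by
  have h1 := hA.limit_bound z hz x
  have h2 : Real.exp (-ν * |x|) ≤ 1 := Real.exp_le_one_iff.2 (by
    have := mul_nonneg hA.ν_pos.le (abs_nonneg x)
    linarith)
  have h3 := mul_le_mul_of_nonneg_left h2 (hA.C_nonneg hz)
  have h4 := norm_le_insert' (A 0 x z) (Ainf z)
  linarith

/-- Periodicity moves `x` into the one period on which the comparison with the homoclinic
coefficient is available. -/
theorem IsHomoclinicLimitFamily.norm_le (hA : IsHomoclinicLimitFamily A Ainf X M C ν θ) {ε : ℝ}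
    (hε : 0 < ε) {z : ℂ} (hz : ‖z‖ ≤ M) (x : ℝ) : ‖A ε x z‖ ≤ ‖Ainf z‖ + 2 * C := by
  have hX := hA.period_pos ε hε
  obtain ⟨y, hy, hxy⟩ := (hA.periodic ε hε z).exists_mem_Ioc hX x (-(X ε / 2))
  change A ε x z = A ε y z at hxy
  have hy' : |y| ≤ X ε / 2 := abs_le.2 ⟨hy.1.le, by linarith [hy.2]⟩
  have h1 := hA.converge_bound ε hε z hz y hy'
  have h2 : Real.exp (-θ * X ε / 2) ≤ 1 := Real.exp_le_one_iff.2 (by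
    have := mul_pos hA.θ_pos hX
    linarith)
  have h3 := mul_le_mul_of_nonneg_left h2 (hA.C_nonneg hz)
  have h4 := norm_le_insert' (A ε y z) (A 0 y z)
  have h5 := hA.norm_zero_le hz y
  rw [hxy]
  linarith

theorem IsHomoclinicLimitFamily.solutionOperator_regular
    (hA : IsHomoclinicLimitFamily A Ainf X M C ν θ) (hK : IsCompact K) (hKM : ∀ z ∈ K, ‖z‖ ≤ M)
    {ε : ℝ} (hε : 0 ≤ ε) (x : ℝ) :
    ContinuousOn (fun z => solutionOperator (fun s => A ε s z) x) K ∧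
      DifferentiableOn ℂ (fun z => solutionOperator (fun s => A ε s z) x) (interior K) := by
  obtain ⟨L, hL⟩ := hK.exists_bound_of_continuousOn (hA.limit_regular hKM).1
  refine solutionOperator_param isOpen_interior interior_subset (fun z _ => hA.continuous hε z)
    (fun R => ⟨L + 2 * C, fun s _ z hz => ?_⟩)
    (fun s => (hA.differentiable hε s).continuous.continuousOn)
    (fun s => (hA.differentiable hε s).differentiableOn) x
  have h1 := hL z hz
  have h2 := hA.C_nonneg (hKM z hz)
  rcases hε.eq_or_lt with h | h
  · subst h
    have := hA.norm_zero_le (hKM z hz) s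
    linarith
  · have := hA.norm_le h (hKM z hz) s
    linarith

theorem IsHomoclinicLimitFamily.flow_regular
    (hA : IsHomoclinicLimitFamily A Ainf X M C ν θ) (hK : IsCompact K) (hKM : ∀ z ∈ K, ‖z‖ ≤ M)
    (x : ℝ) : ContinuousOn (fun z => flow (Ainf z) x) K ∧
      DifferentiableOn ℂ (fun z => flow (Ainf z) x) (interior K) := by
  have h := hA.limit_regular hKM
  obtain ⟨L, hL⟩ := hK.exists_bound_of_continuousOn h.1
  exact solutionOperator_param (a := fun _ => Ainf) isOpen_interior interior_subset
    (fun z _ => continuous_const) (fun R => ⟨L, fun s _ z hz => hL z hz⟩) (fun _ => h.1)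
    (fun _ => h.2) x

theorem IsHomoclinicLimitFamily.wronskianRatio_regular
    (hA : IsHomoclinicLimitFamily A Ainf X M C ν θ) (hK : IsCompact K) (hKM : ∀ z ∈ K, ‖z‖ ≤ M)
    (x : ℝ) : ContinuousOn (fun z => wronskianRatio (fun s => A 0 s z) (Ainf z) x) K ∧
      DifferentiableOn ℂ (fun z => wronskianRatio (fun s => A 0 s z) (Ainf z) x) (interior K) := by
  have h1 := hA.flow_regular hK hKM x
  have h2 := hA.solutionOperator_regular hK hKM le_rfl x
  have h3 : ∀ z, (solutionOperator (fun s => A 0 s z) x).det ≠ 0 := fun z =>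
    (isUnit_det_solutionOperator (hA.continuous le_rfl z) x).ne_zero
  exact ⟨(continuous_cmat_det.comp_continuousOn h1.1).div
      (continuous_cmat_det.comp_continuousOn h2.1) fun z _ => h3 z,
    (differentiableOn_cmat_det h1.2).div (differentiableOn_cmat_det h2.2) fun z _ => h3 z⟩

/-- The periodic Evans function normalized to converge to the homoclinic one. -/
noncomputable def normalizedEvans (A : ℝ → ℝ → ℂ → CMat n) (Ainf : ℂ → CMat n) (X : ℝ → ℝ) (ε t : ℝ)
    (z : ℂ) : ℂ :=
  wronskianRatio (fun s => A 0 s z) (Ainf z) (X ε / 2) *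
    (periodicEvans (A ε) (X ε) z (Complex.exp (t * Complex.I)) /
      (flow (Ainf z) (X ε) - Complex.exp (t * Complex.I) • (1 : CMat n)).det)

theorem normalizedEvans_periodic (ε : ℝ) :
    Function.Periodic (normalizedEvans A Ainf X ε) (2 * Real.pi) := fun t => by
  have h : Complex.exp (((t + 2 * Real.pi : ℝ) : ℂ) * Complex.I) = Complex.exp (t * Complex.I) := by
    push_cast
    rw [add_mul, Complex.exp_add, Complex.exp_two_pi_mul_I, mul_one]
  funext z
  simp only [normalizedEvans, h]

theorem IsHomoclinicLimitFamily.normalizedEvans_regular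
    (hA : IsHomoclinicLimitFamily A Ainf X M C ν θ) (hK : IsCompact K) (hKM : ∀ z ∈ K, ‖z‖ ≤ M)
    {ε : ℝ} (hε : 0 < ε) (hne : ∀ z ∈ K, ∀ γ : ℂ, ‖γ‖ = 1 →
      (flow (Ainf z) (X ε) - γ • (1 : CMat n)).det ≠ 0) :
    ContinuousOn (Function.uncurry (normalizedEvans A Ainf X ε)) (Set.univ ×ˢ K) ∧
      ∀ t, DifferentiableOn ℂ (normalizedEvans A Ainf X ε t) (interior K) := by
  have h1 := hA.wronskianRatio_regular hK hKM (X ε / 2)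
  have h2 := hA.solutionOperator_regular hK hKM hε.le (X ε)
  have h3 := hA.flow_regular hK hKM (X ε)
  refine ⟨?_, fun t => ?_⟩
  · refine (h1.1.comp continuousOn_snd fun p hp => hp.2).mul
      ((continuousOn_det_sub_exp_smul h2.1).div (continuousOn_det_sub_exp_smul h3.1) fun p hp => ?_)
    exact hne p.2 hp.2 _ (Complex.norm_exp_ofReal_mul_I p.1)
  · refine h1.2.mul ((differentiableOn_det_sub_smul h2.2 _).div
      (differentiableOn_det_sub_smul h3.2 _) fun z hz => ?_)
    exact hne z (interior_subset hz) _ (Complex.norm_exp_ofReal_mul_I t)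

/-- On `K` the homoclinic eigenvalues are the zeros of the homoclinic Evans function, and the
normalized periodic Evans functions converge to it exponentially in the period. -/
theorem IsHomoclinicLimitFamily.exists_normalizedEvans_sub_le
    (hA : IsHomoclinicLimitFamily A Ainf X M C ν θ) (hK : IsCompact K) (hKM : ∀ z ∈ K, ‖z‖ ≤ M)
    {η : ℝ} (hη : 0 < η) (hην : η < ν) (hηθ : η < θ)
    (hgap : ∀ z ∈ K, ∀ μ ∈ spectrum ℂ (Ainf z), η < |μ.re|) :
    (∀ z ∈ K, z ∈ homoclinicEigenvalues (A 0) ↔ homoclinicEvans (A 0) Ainf z = 0) ∧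
    ∃ K₀ X₀ : ℝ, ∀ ε, 0 < ε → X₀ ≤ X ε →
      (∀ z ∈ K, ∀ γ : ℂ, ‖γ‖ = 1 → (flow (Ainf z) (X ε) - γ • (1 : CMat n)).det ≠ 0) ∧
      ∀ t, ∀ z ∈ K, ‖normalizedEvans A Ainf X ε t z - homoclinicEvans (A 0) Ainf z‖ ≤
        K₀ * Real.exp (-η * (X ε / 2)) := by
  have hreg := hA.limit_regular hKM
  obtain ⟨L, hL⟩ := hK.exists_bound_of_continuousOn hreg.1
  obtain ⟨g', hηg', hg'⟩ := exists_spectral_gap hK hreg.1 hgap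
  -- The dichotomy rate lies strictly between: `g < g'` absorbs polynomial growth, `η < g` keeps the
  -- lattice sums finite.
  set g := (η + g') / 2
  have hηg : η < g := by simp only [g]; linarith
  have hgg' : g < g' := by simp only [g]; linarith
  obtain ⟨c, -, hdich⟩ := exists_dichotomy n (le_max_right L 0) (hη.trans hηg) hgg'
  have hD : ∀ z ∈ K, ∃ Qs Qu, IsDichotomy (Ainf z) Qs Qu c g := fun z hz =>
    hdich _ ((hL z hz).trans (le_max_left _ _)) (hg' z hz)
  -- The chosen value is meaningful once some value exists, which the conjugators provide.
  have hE : ∀ z ∈ K, IsEvansValue (fun x => A 0 x z) (Ainf z) (homoclinicEvans (A 0) Ainf z) :=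
    fun z hz => by
      obtain ⟨Qs, Qu, hd⟩ := hD z hz
      have hb := hA.limit_bound z (hKM z hz)
      obtain ⟨Pp, hPp⟩ := exists_isConjugator_Ici (hA.continuous le_rfl z) hA.ν_pos
        fun x hx => by simpa only [abs_of_nonneg hx] using hb x
      obtain ⟨Pm, hPm⟩ := exists_isConjugator_Iic (hA.continuous le_rfl z) hA.ν_pos
        fun x _ => hb x
      exact Classical.epsilon_spec (exists_isEvansValue hd hPm hPp)
  refine ⟨fun z hz => ?_, ?_⟩
  · obtain ⟨Qs, Qu, hd⟩ := hD z hz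
    obtain ⟨Pm, Pp, hPm, hPp, h⟩ := (hE z hz).exists_conjugators hd
    rw [h]
    exact exists_decaying_solution_iff (hA.continuous le_rfl z) hd (hη.trans hηg) hPm hPp
  · obtain ⟨K₀, X₀, h⟩ := exists_norm_periodic_sub_evans_le n (L := max L 0) (C := C) (c := c)
      hη hην hηθ hηg
    choose! Qs Qu hd using hD
    have key := fun ε (hε : 0 < ε) (hX : X₀ ≤ X ε) z (hz : z ∈ K) (γ : ℂ) (hγ : ‖γ‖ = 1) =>
        h (fun x => A 0 x z) (fun x => A ε x z) (Ainf z) (Qs z) (Qu z) (X ε) γ _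
          ⟨hA.continuous le_rfl z, (hL z hz).trans (le_max_left _ _), hA.limit_bound z (hKM z hz)⟩
          (hd z hz) (hA.continuous hε.le z) (hA.periodic ε hε z) hγ hX (fun x hx => by
            have := hA.converge_bound ε hε z (hKM z hz) x hx
            rwa [mul_div_assoc] at this) (hE z hz)
    exact ⟨K₀, X₀, fun ε hε hX => ⟨fun z hz γ hγ => (key ε hε hX z hz γ hγ).1,
      fun t z hz => (key ε hε hX z hz _ (Complex.norm_exp_ofReal_mul_I t)).2⟩⟩

end Family

section Family

variable {n : ℕ} {A : ℝ → ℝ → ℂ → CMat n} {Ainf : ℂ → CMat n} {X : ℝ → ℝ} {M C ν θ : ℝ} {K : Set ℂ}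

theorem tendsto_exp_neg_mul_half {l : Filter ℝ} (hX : Filter.Tendsto X l Filter.atTop) {η : ℝ}
    (hη : 0 < η) (K₀ : ℝ) :
    Filter.Tendsto (fun ε => K₀ * Real.exp (-η * (X ε / 2))) l (nhds 0) := by
  have h1 : Filter.Tendsto (fun ε => -η * (X ε / 2)) l Filter.atBot :=
    (hX.atTop_div_const two_pos).const_mul_atTop_of_neg (neg_neg_of_pos hη)
  simpa using (Real.tendsto_exp_atBot.comp h1).const_mul K₀

theorem IsHomoclinicLimitFamily.homoclinicEvans_regular
    (hA : IsHomoclinicLimitFamily A Ainf X M C ν θ) (hK : IsCompact K) (hKM : ∀ z ∈ K, ‖z‖ ≤ M)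
    {η K₀ X₀ : ℝ} (hη : 0 < η) (h : ∀ ε, 0 < ε → X₀ ≤ X ε →
      (∀ z ∈ K, ∀ γ : ℂ, ‖γ‖ = 1 → (flow (Ainf z) (X ε) - γ • (1 : CMat n)).det ≠ 0) ∧
      ∀ t, ∀ z ∈ K, ‖normalizedEvans A Ainf X ε t z - homoclinicEvans (A 0) Ainf z‖ ≤
        K₀ * Real.exp (-η * (X ε / 2))) :
    ContinuousOn (homoclinicEvans (A 0) Ainf) K ∧
      DifferentiableOn ℂ (homoclinicEvans (A 0) Ainf) (interior K) := by
  refine regular_of_uniform_limit (f := fun ε => normalizedEvans A Ainf X ε 0)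
    (tendsto_exp_neg_mul_half hA.period_tendsto hη K₀) ?_
  filter_upwards [self_mem_nhdsWithin, hA.period_tendsto.eventually_ge_atTop X₀] with ε hε hX
  have h1 := h ε hε hX
  have h2 := hA.normalizedEvans_regular hK hKM hε h1.1
  exact ⟨h2.1.comp (f := fun z : ℂ => ((0 : ℝ), z)) (by fun_prop) fun z hz => ⟨trivial, hz⟩,
    h2.2 0, h1.2 0⟩

theorem IsHomoclinicLimitFamily.normalizedEvans_eq_zero_iff
    (hA : IsHomoclinicLimitFamily A Ainf X M C ν θ) {ε t : ℝ} {z : ℂ}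
    (hne : (flow (Ainf z) (X ε) - Complex.exp (t * Complex.I) • (1 : CMat n)).det ≠ 0) :
    normalizedEvans A Ainf X ε t z = 0 ↔
      periodicEvans (A ε) (X ε) z (Complex.exp (t * Complex.I)) = 0 := by
  have h := wronskianRatio_ne_zero (B := Ainf z) (hA.continuous le_rfl z) (X ε / 2)
  simp [normalizedEvans, h, hne]

/-- The normalizing factors are holomorphic and nonvanishing in the interior of `K`, hence of order
zero. -/
theorem IsHomoclinicLimitFamily.analyticOrderAt_normalizedEvans
    (hA : IsHomoclinicLimitFamily A Ainf X M C ν θ) (hK : IsCompact K) (hKM : ∀ z ∈ K, ‖z‖ ≤ M)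
    {ε : ℝ} (hε : 0 < ε) (hne : ∀ z ∈ K, ∀ γ : ℂ, ‖γ‖ = 1 →
      (flow (Ainf z) (X ε) - γ • (1 : CMat n)).det ≠ 0) (t : ℝ) {z : ℂ} (hz : z ∈ interior K) :
    analyticOrderAt (normalizedEvans A Ainf X ε t) z =
      analyticOrderAt (fun y => periodicEvans (A ε) (X ε) y (Complex.exp (t * Complex.I))) z := by
  have hnet : ∀ y ∈ interior K,
      (flow (Ainf y) (X ε) - Complex.exp (t * Complex.I) • (1 : CMat n)).det ≠ 0 := fun y hy =>
    hne y (interior_subset hy) _ (Complex.norm_exp_ofReal_mul_I t)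
  have hn := isOpen_interior.mem_nhds hz
  have h1 : AnalyticAt ℂ (fun y => wronskianRatio (fun s => A 0 s y) (Ainf y) (X ε / 2)) z :=
    (hA.wronskianRatio_regular hK hKM (X ε / 2)).2.analyticAt hn
  have h2 : AnalyticAt ℂ
      (fun y => periodicEvans (A ε) (X ε) y (Complex.exp (t * Complex.I))) z :=
    (differentiableOn_det_sub_smul
      (hA.solutionOperator_regular hK hKM hε.le (X ε)).2 _).analyticAt hn
  have h3 : AnalyticAt ℂ (fun y => (flow (Ainf y) (X ε) -
      Complex.exp (t * Complex.I) • (1 : CMat n)).det) z :=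
    (differentiableOn_det_sub_smul (hA.flow_regular hK hKM (X ε)).2 _).analyticAt hn
  have h4 := h3.inv (hnet z hz)
  have hfun : normalizedEvans A Ainf X ε t =
      (fun y => wronskianRatio (fun s => A 0 s y) (Ainf y) (X ε / 2)) *
        ((fun y => periodicEvans (A ε) (X ε) y (Complex.exp (t * Complex.I))) *
          (fun y => (flow (Ainf y) (X ε) - Complex.exp (t * Complex.I) • (1 : CMat n)).det)⁻¹) := by
    funext y
    simp [normalizedEvans, div_eq_mul_inv]
  rw [hfun, analyticOrderAt_mul h1 (h2.mul h4), analyticOrderAt_mul h2 h4,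
    h1.analyticOrderAt_eq_zero.2 (wronskianRatio_ne_zero (hA.continuous le_rfl z) _),
    h4.analyticOrderAt_eq_zero.2 (inv_ne_zero (hnet z hz)), zero_add, add_zero]

end Family

/-! ### Assembly of the corollary. -/

theorem corollary4p3 {n : ℕ} (A : ℝ → ℝ → ℂ → Matrix (Fin n) (Fin n) ℂ)
    (Ainf : ℂ → Matrix (Fin n) (Fin n) ℂ) (X : ℝ → ℝ) (M C₀ ν θ : ℝ)
    (hA : IsHomoclinicLimitFamily A Ainf X M C₀ ν θ)
    (Λ : Set ℂ) (hΛ : IsHyperbolicityDomain Ainf Λ)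
    (K : Set ℂ) (hK : IsCompact K) (hKΛ : K ⊆ Λ) (hKM : ∀ z ∈ K, ‖z‖ ≤ M)
    (hbd : ∀ z ∈ frontier K, homoclinicEvans (A 0) Ainf z ≠ 0)
    (η : ℝ) (hη : 0 < η) (hην : η < ν) (hηθ : η < θ)
    (hgap : ∀ z ∈ K, ∀ μ ∈ spectrum ℂ (Ainf z), η < |μ.re|) :
    -- the eigenvalues of the homoclinic problem in `K` are finitely many, of finite multiplicity
    (homoclinicEigenvalues (A 0) ∩ K).Finite ∧
    (∀ w ∈ homoclinicEigenvalues (A 0) ∩ K, 0 < homoclinicMultiplicity (A 0) Ainf w) ∧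
    ∃ C X₀ : ℝ, 0 < C ∧ ∀ ε : ℝ, 0 < ε → X₀ ≤ X ε →
      -- the loops `t ↦ loop w k t`, `γ = exp (i t)`; a turn of `γ` permutes those around `w`
      ∃ (loop : (w : ℂ) → Fin (homoclinicMultiplicity (A 0) Ainf w) → ℝ → ℂ)
        (σ : (w : ℂ) → Equiv.Perm (Fin (homoclinicMultiplicity (A 0) Ainf w))),
        (∀ w ∈ homoclinicEigenvalues (A 0) ∩ K, ∀ k,
          Continuous (loop w k) ∧
          (∀ t : ℝ, loop w k (t + 2 * Real.pi) = loop w (σ w k) t) ∧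
          (∀ t : ℝ, ‖loop w k t - w‖ ≤
            C * Real.exp (-η * X ε / (2 * (homoclinicMultiplicity (A 0) Ainf w : ℝ))))) ∧
        -- the spectrum in `K` is the union of the loops
        periodicSpectrum (A ε) (X ε) ∩ K =
          (⋃ w ∈ homoclinicEigenvalues (A 0) ∩ K, ⋃ k, Set.range (loop w k)) ∧
        -- the points `loop w k t` are the `γ`-eigenvalues in `K`, `γ = exp (i t)` ...
        (∀ t : ℝ, {z ∈ K | periodicEvans (A ε) (X ε) z (Complex.exp (t * Complex.I)) = 0} =
          {z | ∃ w ∈ homoclinicEigenvalues (A 0) ∩ K, ∃ k, loop w k t = z}) ∧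
        -- ... repeated according to multiplicity
        (∀ t : ℝ, ∀ z ∈ K,
          analyticOrderAt
            (fun y => periodicEvans (A ε) (X ε) y (Complex.exp (t * Complex.I))) z =
          {p : Σ w : ℂ, Fin (homoclinicMultiplicity (A 0) Ainf w) |
            p.1 ∈ homoclinicEigenvalues (A 0) ∩ K ∧ loop p.1 p.2 t = z}.encard) := by
  obtain ⟨heig, K₀, X₀, hconv⟩ :=
    hA.exists_normalizedEvans_sub_le hK hKM hη hην hηθ hgap
  obtain ⟨hDc, hDd⟩ := hA.homoclinicEvans_regular hK hKM hη hconv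
  have hmem : ∀ w, w ∈ homoclinicEigenvalues (A 0) ∩ K ↔
      w ∈ K ∧ homoclinicEvans (A 0) Ainf w = 0 := fun w =>
    ⟨fun h => ⟨h.2, (heig w h.2).1 h.1⟩, fun h => ⟨(heig w h.1).2 h.2, h.1⟩⟩
  refine ⟨(finite_zeros_of_frontier hK hDc hDd hbd).subset fun w hw => (hmem w).1 hw,
    fun w hw => analyticOrderNatAt_pos_of_frontier hK hDc hDd hbd hw.2 ((hmem w).1 hw).2, ?_⟩
  obtain ⟨C, δ₀, hC, hδ₀, hloop⟩ := exists_root_loops_of_frontier hK hDc hDd hbd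
  -- A constant at least `1` dominates its own `m`-th root, so one prefactor serves all
  -- multiplicities.
  set K₁ := max K₀ 1
  have hK₁ : 1 ≤ K₁ := le_max_right _ _
  obtain ⟨X₁, hX₁⟩ := Filter.eventually_atTop.1 ((tendsto_exp_neg_mul_half (X := id)
    Filter.tendsto_id hη K₁).eventually (gt_mem_nhds hδ₀))
  refine ⟨C * K₁, max X₀ X₁, by positivity, fun ε hε hX => ?_⟩
  obtain ⟨hne, hclose⟩ := hconv ε hε ((le_max_left _ _).trans hX)
  obtain ⟨hFc, hFd⟩ := hA.normalizedEvans_regular hK hKM hε hne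
  obtain ⟨loop, σ, h1, h2, h3⟩ := hloop (K₁ * Real.exp (-η * (X ε / 2))) (2 * Real.pi)
    (normalizedEvans A Ainf X ε) (hX₁ _ ((le_max_right _ _).trans hX)).le Real.two_pi_pos
    (normalizedEvans_periodic ε) hFd (hFc.mono (Set.prod_mono_right interior_subset))
    fun t z hz => (hclose t z hz).trans (by gcongr; exact le_max_left _ _)
  have hzero : ∀ t : ℝ, ∀ z ∈ K,
      periodicEvans (A ε) (X ε) z (Complex.exp (t * Complex.I)) = 0 ↔
      ∃ w ∈ homoclinicEigenvalues (A 0) ∩ K, ∃ k, loop w k t = z := fun t z hz => by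
    rw [← hA.normalizedEvans_eq_zero_iff (hne z hz _ (Complex.norm_exp_ofReal_mul_I t)),
      h2 t z hz]
    exact exists_congr fun w => by rw [hmem, and_assoc]
  have hint : ∀ w ∈ homoclinicEigenvalues (A 0) ∩ K, ∀ k t, loop w k t ∈ interior K :=
    fun w hw k t => ((h1 w ((hmem w).1 hw).1 ((hmem w).1 hw).2 k).2.2 t).1
  refine ⟨loop, σ, fun w hw k => ?_, ?_, fun t => ?_, fun t z hz => ?_⟩
  · obtain ⟨hcont, hper, hb⟩ := h1 w ((hmem w).1 hw).1 ((hmem w).1 hw).2 k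
    refine ⟨hcont, hper, fun t => (hb t).2.trans ?_⟩
    have hm : 1 ≤ analyticOrderNatAt (homoclinicEvans (A 0) Ainf) w :=
      analyticOrderNatAt_pos_of_frontier hK hDc hDd hbd hw.2 ((hmem w).1 hw).2
    change _ ≤ _ * Real.exp (_ / (2 * (analyticOrderNatAt (homoclinicEvans (A 0) Ainf) w : ℝ)))
    set m := analyticOrderNatAt (homoclinicEvans (A 0) Ainf) w
    have hm' : (1 : ℝ) ≤ m := by exact_mod_cast hm
    rw [Real.mul_rpow (by positivity) (Real.exp_nonneg _), ← Real.exp_mul,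
      show -η * (X ε / 2) * (1 / (m : ℝ)) = -η * X ε / (2 * m) by field_simp,
      mul_assoc]
    gcongr
    calc K₁ ^ (1 / (m : ℝ)) ≤ K₁ ^ (1 : ℝ) :=
          Real.rpow_le_rpow_of_exponent_le hK₁ ((div_le_one (by positivity)).2 hm')
      _ = K₁ := Real.rpow_one _
  · ext z
    simp only [Set.mem_inter_iff, Set.mem_iUnion, Set.mem_range, exists_prop]
    constructor
    · rintro ⟨⟨γ, hγ, h0⟩, hz⟩
      have hγ' : Complex.exp (Complex.arg γ * Complex.I) = γ := by
        have := Complex.norm_mul_exp_arg_mul_I γ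
        rwa [hγ, Complex.ofReal_one, one_mul] at this
      obtain ⟨w, hw, k, hk⟩ := (hzero (Complex.arg γ) z hz).1 (by rwa [hγ'])
      exact ⟨w, hw, k, _, hk⟩
    · rintro ⟨w, hw, k, t, rfl⟩
      have hz := interior_subset (hint w hw k t)
      exact ⟨⟨_, Complex.norm_exp_ofReal_mul_I t, (hzero t _ hz).2 ⟨w, hw, k, rfl⟩⟩, hz⟩
  · ext z
    constructor
    · rintro ⟨hz, h0⟩
      exact (hzero t z hz).1 h0
    · rintro ⟨w, hw, k, rfl⟩
      have hz := interior_subset (hint w hw k t)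
      exact ⟨hz, (hzero t _ hz).2 ⟨w, hw, k, rfl⟩⟩
  -- The loops stay in the interior of `K`. At a boundary point the Evans function is nonzero, so
  -- both counts are zero there.
  · by_cases hzi : z ∈ interior K
    · rw [← hA.analyticOrderAt_normalizedEvans hK hKM hε hne t hzi, h3 t z hzi]
      congr 1
      ext p
      exact and_congr_left fun _ => (hmem p.1).symm
    · have hno : ¬∃ w ∈ homoclinicEigenvalues (A 0) ∩ K, ∃ k, loop w k t = z := by
        rintro ⟨w, hw, k, rfl⟩
        exact hzi (hint w hw k t)
      have h0 : analyticOrderAt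
          (fun y => periodicEvans (A ε) (X ε) y (Complex.exp (t * Complex.I))) z = 0 :=
        analyticOrderAt_eq_zero.2 (Or.inr ((hzero t z hz).not.2 hno))
      rw [h0, eq_comm, Set.encard_eq_zero]
      exact Set.eq_empty_of_forall_notMem fun p hp => hno ⟨p.1, hp.1, p.2, hp.2⟩
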